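/- **Definitions.** A Boolean relation of arity $n\ge 1$ is a set $R\subseteq\{0,1\}^n$. A *constraint language* $\Gamma$ is a finite set of non-empty Boolean relations (each of some arity $n\ge1$). A *$\Gamma$-clause* is $R(x_1,\dots,x_n)$ with $R\in\Gamma$ of arity $n$ and (not necessarily distinct) variables $x_1,\dots,x_n$; an assignment $\alpha$ satisfies it iff $(\alpha(x_1),\dots,\alpha(x_n))\in R$. A *$\Gamma$-formula* is a finite (possibly empty) conjunction of $\Gamma$-clauses. Two formulas are *equivalent*, $\psi\equiv\varphi$, if they are satisfied by the same assignments. An $n$-ary relation $R$ is *irreducible* if every conjunction $R_1(\dots)\wedge\dots\wedge R_m(\dots)$, $m\ge1$, of clauses over arbitrary Boolean relations which is equivalent to $R(x_1,\dots,x_n)$ ($x_1,\dots,x_n$ distinct) contains a clause of arity at least $n$. $R$ is *bijunctive* if $R(x_1,\dots,x_n)$ is equivalent to a formula over the set of all binary Boolean relations. $\Gamma$ is irreducible (bijunctive) if every relation in $\Gamma$ is. $\mathrm{MEE}(\Gamma)$ is the decision problem: given a $\Gamma$-formula $\varphi$ and an integer $k$ (variable names and $k$ written in binary), is there a $\Gamma$-formula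 $\psi$ with at most $k$ clauses and $\psi\equiv\varphi$? **Theorem.** Let $\Gamma$ be a constraint language which is irreducible and bijunctive. Then: 1. every relation in $\Gamma$ is, up to a permutation of its arguments, one of: the full unary relation $\{0,1\}$, the literals $x$ and $\overline{x}$, the binary relations $x\vee y$ (OR), $\neg(x\wedge y)$ (NAND), $x\rightarrow y$, $x=y$, $x\oplus y$ (XOR); 2. $\mathrm{MEE}(\Gamma)\in\mathrm{P}$. -/

import Mathlib

/-! ### Boolean relations and constraint formulas -/

/-- A finitary Boolean relation: a set of tuples in `{0,1}^arity`, of arity at least one. -/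
structure BoolRel where
  arity : ℕ
  arity_pos : 0 < arity
  tuples : Set (Fin arity → Bool)

/-- A clause `R(x₁,…,xₙ)` with `R ∈ Γ`. Variables are natural numbers and may be repeated. -/
structure Clause (Γ : Set BoolRel) where
  rel : Γ
  args : Fin rel.1.arity → ℕ

/-- A `Γ`-formula is a finite conjunction of `Γ`-clauses, given as a list;
its size is the length of the list. -/
abbrev CFormula (Γ : Set BoolRel) : Type := List (Clause Γ)

/-- `α` satisfies the clause `R(x₁,…,xₙ)` iff `(α(x₁),…,α(xₙ)) ∈ R`. -/
def Clause.Sat {Γ : Set BoolRel} (C : Clause Γ) (α : ℕ → Bool) : Prop :=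
  (fun i => α (C.args i)) ∈ C.rel.1.tuples

/-- `α` satisfies a formula iff it satisfies each of its clauses. -/
def CFormula.Sat {Γ : Set BoolRel} (φ : CFormula Γ) (α : ℕ → Bool) : Prop :=
  ∀ C ∈ φ, C.Sat α

/-- Two formulas are equivalent iff the same assignments satisfy them. -/
def CFormula.Equivalent {Γ Δ : Set BoolRel} (φ : CFormula Γ) (ψ : CFormula Δ) : Prop :=
  ∀ α : ℕ → Bool, CFormula.Sat φ α ↔ CFormula.Sat ψ α

/-- `φ` expresses the `n`-ary relation `R`: it is equivalent to `R(x₁,…,xₙ)` for the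
distinct variables `x₁,…,xₙ`, which are named `0,…,n-1` here. -/
def CFormula.Expresses {Γ : Set BoolRel} (φ : CFormula Γ) (R : BoolRel) : Prop :=
  ∀ α : ℕ → Bool, CFormula.Sat φ α ↔ (fun i : Fin R.arity => α i) ∈ R.tuples

/-! ### Irreducible and bijunctive relations -/

/-- An `n`-ary relation `R` is irreducible if every formula `R₁(…) ∧ … ∧ Rₘ(…)`, `m ≥ 1`, over
arbitrary Boolean relations which is equivalent to `R(x₁,…,xₙ)` has a clause of arity `≥ n`. -/
def BoolRel.Irreducible (R : BoolRel) : Prop :=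
  ∀ φ : CFormula Set.univ, φ ≠ [] → CFormula.Expresses φ R →
    ∃ C ∈ φ, R.arity ≤ C.rel.1.arity

/-- A relation is bijunctive if a formula over the binary Boolean relations expresses it. -/
def BoolRel.Bijunctive (R : BoolRel) : Prop :=
  ∃ φ : CFormula {S : BoolRel | S.arity = 2}, CFormula.Expresses φ R

/-- A constraint language is a finite set of non-empty Boolean relations. -/
structure ConstraintLanguage where
  rels : Finset BoolRel
  nonempty : ∀ R ∈ rels, R.tuples.Nonempty

/-- A constraint language is irreducible if each of its relations is. -/
def ConstraintLanguage.Irreducible (Γ : ConstraintLanguage) : Prop :=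
  ∀ R ∈ Γ.rels, R.Irreducible

/-- A constraint language is bijunctive if each of its relations is. -/
def ConstraintLanguage.Bijunctive (Γ : ConstraintLanguage) : Prop :=
  ∀ R ∈ Γ.rels, R.Bijunctive

/-- The set of relations of a constraint language. -/
abbrev ConstraintLanguage.toSet (Γ : ConstraintLanguage) : Set BoolRel := {R | R ∈ Γ.rels}

/-! ### The basic relations -/

namespace BoolRel

/-- `R` is a permutation of `S`: they agree up to the order of the arguments. -/
def IsPermutationOf (R S : BoolRel) : Prop :=
  ∃ e : Fin S.arity ≃ Fin R.arity, ∀ t : Fin R.arity → Bool, t ∈ R.tuples ↔ t ∘ e ∈ S.tuples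

/-- The unary relation `{0,1}`. -/
def top1 : BoolRel := ⟨1, by decide, Set.univ⟩
/-- The positive literal `x`. -/
def posLit : BoolRel := ⟨1, by decide, {t | t 0 = true}⟩
/-- The negative literal `¬x`. -/
def negLit : BoolRel := ⟨1, by decide, {t | t 0 = false}⟩
/-- `x ∨ y`. -/
def or2 : BoolRel := ⟨2, by decide, {t | t 0 = true ∨ t 1 = true}⟩
/-- `¬(x ∧ y)`. -/
def nand2 : BoolRel := ⟨2, by decide, {t | ¬(t 0 = true ∧ t 1 = true)}⟩
/-- `x → y`. -/
def imp2 : BoolRel := ⟨2, by decide, {t | t 0 = true → t 1 = true}⟩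
/-- `x = y`. -/
def eq2 : BoolRel := ⟨2, by decide, {t | t 0 = t 1}⟩
/-- `x ⊕ y`. -/
def xor2 : BoolRel := ⟨2, by decide, {t | t 0 ≠ t 1}⟩

end BoolRel

/-! ### The minimization problem and polynomial time -/

/-- An instance of `MEE(Γ)`: a `Γ`-formula `φ` and an integer `k`. -/
structure MEEInstance (Γ : ConstraintLanguage) where
  formula : CFormula Γ.toSet
  bound : ℤ

/-- `MEE(Γ)`: is there a `Γ`-formula with at most `k` clauses which is equivalent to `φ`? -/
def MEE (Γ : ConstraintLanguage) (I : MEEInstance Γ) : Prop :=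
  ∃ ψ : CFormula Γ.toSet, (ψ.length : ℤ) ≤ I.bound ∧ CFormula.Equivalent ψ I.formula

/-- The finite input alphabet: one symbol for each relation of `Γ`, the two bits, and a
delimiter. -/
inductive MEESymbol (Γ : ConstraintLanguage) where
  | rel (R : Γ.toSet)
  | bit (b : Bool)
  | sep

/-- A natural number in binary, followed by a delimiter. -/
def MEESymbol.encodeNat {Γ : ConstraintLanguage} (n : ℕ) : List (MEESymbol Γ) :=
  (Computability.encodeNat n).map .bit ++ [.sep]

/-- An integer: a sign bit, then its absolute value. -/
def MEESymbol.encodeInt {Γ : ConstraintLanguage} (k : ℤ) : List (MEESymbol Γ) :=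
  .bit (decide (k < 0)) :: encodeNat k.natAbs

/-- A clause: the symbol of its relation, then the names of its variables in order. -/
def MEESymbol.encodeClause {Γ : ConstraintLanguage} (C : Clause Γ.toSet) : List (MEESymbol Γ) :=
  .rel C.rel :: (List.ofFn C.args).flatMap encodeNat

/-- An instance: the bound, then all clauses of the formula. -/
def MEEInstance.encode {Γ : ConstraintLanguage} (I : MEEInstance Γ) : List (MEESymbol Γ) :=
  MEESymbol.encodeInt I.bound ++ I.formula.flatMap MEESymbol.encodeClause

open Classical in
/-- The decision problem `p`, whose instances are written as words by `enc`, is in `P`: some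
Turing machine decides `p` in time polynomial in the length of the encoded instance. -/
def InP {α S : Type} (enc : α → List S) (p : α → Prop) : Prop :=
  Nonempty (Turing.TM2ComputableInPolyTime enc Computability.encodeBool (fun a => decide (p a)))

/-! ### The encoding is unambiguous -/

theorem MEESymbol.encodeNat_append_inj {Γ : ConstraintLanguage} {m n : ℕ}
    {u v : List (MEESymbol Γ)} (h : encodeNat m ++ u = encodeNat n ++ v) : m = n ∧ u = v := by
  have key : ∀ a b : List Bool, a.map MEESymbol.bit ++ [MEESymbol.sep] ++ u
      = b.map MEESymbol.bit ++ [MEESymbol.sep] ++ v → a = b ∧ u = v := by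
    intro a
    induction a with
    | nil => intro b hb; cases b <;> simp_all
    | cons x a ih =>
      intro b hb
      cases b with
      | nil => simp at hb
      | cons y b =>
        simp only [List.map_cons, List.cons_append, List.cons.injEq, MEESymbol.bit.injEq] at hb
        obtain ⟨h1, h2⟩ := ih b hb.2
        exact ⟨by rw [hb.1, h1], h2⟩
  obtain ⟨h1, h2⟩ := key _ _ h
  exact ⟨by rw [← Computability.decode_encodeNat m, h1, Computability.decode_encodeNat], h2⟩

theorem MEESymbol.encodeNats_append_inj {Γ : ConstraintLanguage} {u v : List (MEESymbol Γ)} :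
    ∀ a b : List ℕ, a.length = b.length →
      a.flatMap encodeNat ++ u = b.flatMap encodeNat ++ v → a = b ∧ u = v
  | [], [], _, h => ⟨rfl, by simpa using h⟩
  | x :: a, y :: b, hl, h => by
    simp only [List.flatMap_cons, List.append_assoc] at h
    obtain ⟨h1, h2⟩ := encodeNat_append_inj h
    obtain ⟨h3, h4⟩ := encodeNats_append_inj a b (by simpa using hl) h2
    exact ⟨by rw [h1, h3], h4⟩

theorem MEESymbol.encodeClauses_inj {Γ : ConstraintLanguage} :
    ∀ φ ψ : List (Clause Γ.toSet),
      φ.flatMap encodeClause = ψ.flatMap encodeClause → φ = ψ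
  | [], [], _ => rfl
  | [], D :: ψ, h => by simp [encodeClause] at h
  | C :: φ, [], h => by simp [encodeClause] at h
  | ⟨R, x⟩ :: φ, ⟨S, y⟩ :: ψ, h => by
    simp only [List.flatMap_cons, encodeClause, List.cons_append, List.cons.injEq,
      MEESymbol.rel.injEq] at h
    obtain ⟨rfl, h⟩ := h
    obtain ⟨h1, h2⟩ := encodeNats_append_inj _ _ (by simp) h
    rw [List.ofFn_injective h1, encodeClauses_inj φ ψ h2]

theorem MEEInstance.encode_injective {Γ : ConstraintLanguage} :
    Function.Injective (MEEInstance.encode (Γ := Γ)) := by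
  rintro ⟨φ, k⟩ ⟨ψ, l⟩ h
  simp only [MEEInstance.encode, MEESymbol.encodeInt, List.cons_append, List.cons.injEq,
    MEESymbol.bit.injEq, decide_eq_decide] at h
  obtain ⟨h1, h2⟩ := MEESymbol.encodeNat_append_inj h.2
  have hk : k = l := by omega
  rw [hk, MEESymbol.encodeClauses_inj φ ψ h2]

/-! Classification. A formula over binary relations has no clause of arity above two, so an
irreducible bijunctive relation is at most binary (`arity_le_two`). A non-empty binary relation that
is a product of two unary ones is reducible; a truth-table check (`exists_kind_table`) shows that
otherwise it is OR, NAND, an implication, equality or XOR.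

Minimization. A clause is a constraint of one of finitely many kinds, and a constraint is a set of
implications between literals. As in 2-SAT, entailment between literals and satisfiability can be
read off paths in the implication graph (`le_iff_reach`, `satisfiable_iff`). For satisfiable
formulas the minimum is given by a formula in terms of semantic data alone. Call a variable forced
if it has the same value in all models, and free otherwise; group the free variables into classes of
variables that are equal or opposite in all models. In every equivalent formula, three disjoint
groups of constraints are needed.

(1) Constraints that depend on a forced variable: at least one per forced variable, and one more if
all forced values equal `s` but no available kind acts as the literal with value `s`
(`card_forced_le`, `card_forced_lt`). The argument removes forced variables of degree at most one
and double counts when none is left.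

(2) Constraints inside one class: a spanning tree if equations of the right sign are available, a
closed walk of implications otherwise; `cost` tabulates the outcome, and `cost_le_countP` is the
bound.

(3) Constraints between different classes: each pair of neighbours in the order of the classes needs
its own implication, and a clause carries exactly one implication and its contrapositive
(`length_covers_le`). Hence half the number of neighbouring pairs appears, and twice the optimum is
the convenient quantity.

`twiceOpt_le` adds up the three bounds. Conversely `exists_forcing`, `exists_class` and
`exists_order` attain them one by one; the kinds they use are available because the given formula
could not express its own models without them. `exists_optimal` joins the parts. An unsatisfiable
formula needs one constraint if XOR is available, and two otherwise.

Complexity. The optimum is computed from the transitive closure of the implication graph. Membership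
in P requires an actual stack machine, so structured programs are compiled to machine code
(`Exec.steps`), all data are trees in prefix notation, and `PT` is the class of functions on trees
computed by such programs in polynomial time. It is closed under composition, pairing, case
distinction and folds with polynomially bounded accumulators, which suffices to express the whole
decision procedure; `PT.inP` then produces the machine. As numbers are unary in this encoding,
variable names remain bit strings and the bound is evaluated only up to a cap. -/

/-! ### Structured programs for stack machines -/

namespace StackProg

open Turing

section Generic

variable {K : Type} {Γ : K → Type} {σ : Type}

/-- Structured programs over the stacks `Γ` with internal state in `σ`. -/
inductive Prog (Γ : K → Type) (σ : Type) : Type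
  | skip : Prog Γ σ
  | push (k : K) (f : σ → Γ k) : Prog Γ σ
  | pop (k : K) (f : σ → Option (Γ k) → σ) : Prog Γ σ
  | seq (p q : Prog Γ σ) : Prog Γ σ
  | ite (b : σ → Bool) (p q : Prog Γ σ) : Prog Γ σ
  | loop (b : σ → Bool) (p : Prog Γ σ) : Prog Γ σ

/-- The labels used by the machine code of a program. -/
def Prog.Lab : Prog Γ σ → Type
  | .skip => Unit
  | .push _ _ => Unit
  | .pop _ _ => Unit
  | .seq p q => p.Lab ⊕ q.Lab
  | .ite _ p q => Option (p.Lab ⊕ q.Lab)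
  | .loop _ p => Option p.Lab

/-- The label at which a program starts. -/
def Prog.entry : (p : Prog Γ σ) → p.Lab
  | .skip => ()
  | .push _ _ => ()
  | .pop _ _ => ()
  | .seq p _ => Sum.inl p.entry
  | .ite _ _ _ => none
  | .loop _ _ => none

theorem Prog.finite_lab : (p : Prog Γ σ) → Finite p.Lab
  | .skip => inferInstanceAs (Finite Unit)
  | .push _ _ => inferInstanceAs (Finite Unit)
  | .pop _ _ => inferInstanceAs (Finite Unit)
  | .seq p q => by
    have := p.finite_lab
    have := q.finite_lab
    exact inferInstanceAs (Finite (p.Lab ⊕ q.Lab))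
  | .ite _ p q => by
    have := p.finite_lab
    have := q.finite_lab
    exact inferInstanceAs (Finite (Option (p.Lab ⊕ q.Lab)))
  | .loop _ p => by
    have := p.finite_lab
    exact inferInstanceAs (Finite (Option p.Lab))

/-- The machine code of a program, whose labels are embedded by `emb` into those of the whole
machine, and which continues at `exit`. -/
def Prog.code {Λ : Type} : (p : Prog Γ σ) → (p.Lab → Λ) → Λ → p.Lab → TM2.Stmt Γ Λ σ
  | .skip, _, exit, _ => .goto fun _ => exit
  | .push k f, _, exit, _ => .push k f (.goto fun _ => exit)
  | .pop k f, _, exit, _ => .pop k f (.goto fun _ => exit)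
  | .seq p q, emb, exit, l =>
    match l with
    | .inl l => p.code (emb ∘ Sum.inl) (emb (Sum.inr q.entry)) l
    | .inr l => q.code (emb ∘ Sum.inr) exit l
  | .ite b p q, emb, exit, l =>
    match l with
    | none => .branch b (.goto fun _ => emb (some (Sum.inl p.entry)))
        (.goto fun _ => emb (some (Sum.inr q.entry)))
    | some (.inl l) => p.code (emb ∘ some ∘ Sum.inl) exit l
    | some (.inr l) => q.code (emb ∘ some ∘ Sum.inr) exit l
  | .loop b p, emb, exit, l =>
    match l with
    | none => .branch b (.goto fun _ => emb (some p.entry)) (.goto fun _ => exit)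
    | some l => p.code (emb ∘ some) (emb none) l

variable [DecidableEq K]

/-- `Exec p v S v' S' n`: the program `p`, started in the state `v` with the stacks `S`, ends
after `n` steps in the state `v'` with the stacks `S'`. -/
inductive Exec : Prog Γ σ → σ → (∀ k, List (Γ k)) → σ → (∀ k, List (Γ k)) → ℕ → Prop
  | skip {v S} : Exec .skip v S v S 1
  | push {k f v S} : Exec (.push k f) v S v (Function.update S k (f v :: S k)) 1
  | pop {k f v S} :
      Exec (.pop k f) v S (f v (S k).head?) (Function.update S k (S k).tail) 1
  | seq {p q v S v₁ S₁ v₂ S₂ m n} : Exec p v S v₁ S₁ m → Exec q v₁ S₁ v₂ S₂ n →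
      Exec (.seq p q) v S v₂ S₂ (m + n)
  | ite_true {b : σ → Bool} {p q v S v₁ S₁ n} : b v = true → Exec p v S v₁ S₁ n →
      Exec (.ite b p q) v S v₁ S₁ (1 + n)
  | ite_false {b : σ → Bool} {p q v S v₁ S₁ n} : b v = false → Exec q v S v₁ S₁ n →
      Exec (.ite b p q) v S v₁ S₁ (1 + n)
  | loop_false {b : σ → Bool} {p v S} : b v = false → Exec (.loop b p) v S v S 1
  | loop_true {b : σ → Bool} {p v S v₁ S₁ v₂ S₂ m n} : b v = true → Exec p v S v₁ S₁ m →
      Exec (.loop b p) v₁ S₁ v₂ S₂ n → Exec (.loop b p) v S v₂ S₂ (1 + (m + n))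

/-- The machine `M` goes from `c` to `d` in `n` steps. -/
def Steps {Λ : Type} (M : Λ → TM2.Stmt Γ Λ σ) (c d : TM2.Cfg Γ Λ σ) (n : ℕ) : Prop :=
  (flip bind (TM2.step M))^[n] (some c) = some d

theorem Steps.trans {Λ : Type} {M : Λ → TM2.Stmt Γ Λ σ} {c d e : TM2.Cfg Γ Λ σ} {m n : ℕ}
    (h₁ : Steps M c d m) (h₂ : Steps M d e n) : Steps M c e (m + n) := by
  unfold Steps at *
  rw [Nat.add_comm, Function.iterate_add_apply, h₁, h₂]

theorem Steps.single {Λ : Type} {M : Λ → TM2.Stmt Γ Λ σ} {c d : TM2.Cfg Γ Λ σ}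
    (h : TM2.step M c = some d) : Steps M c d 1 := h

/-- Correctness of the compiler. Quantifying over the machine, the embedding of labels and the exit
makes the induction work: a subprogram sits in the same machine with a composed embedding and with
the entry of its successor as exit. Each `push`, `pop`, `skip` and branch is one machine step, and
sequencing is free. -/
theorem Exec.steps {p : Prog Γ σ} {v S v' S' n} (h : Exec p v S v' S' n) :
    ∀ {Λ : Type} (M : Λ → TM2.Stmt Γ Λ σ) (emb : p.Lab → Λ) (exit : Λ),
      (∀ l, M (emb l) = p.code emb exit l) →
      Steps M ⟨some (emb p.entry), v, S⟩ ⟨some exit, v', S'⟩ n := by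
  induction h with
  | skip => intro Λ M emb exit hM; apply Steps.single; simp [TM2.step, hM, Prog.code]
  | push => intro Λ M emb exit hM; apply Steps.single; simp [TM2.step, hM, Prog.code]
  | pop => intro Λ M emb exit hM; apply Steps.single; simp [TM2.step, hM, Prog.code]
  | @seq p q _ _ _ _ _ _ _ _ _ _ ihp ihq =>
    intro Λ M emb exit hM
    exact (ihp M (emb ∘ Sum.inl) (emb (Sum.inr q.entry)) (fun l => hM (.inl l))).trans
      (ihq M (emb ∘ Sum.inr) exit (fun l => hM (.inr l)))
  | @ite_true b p q _ _ _ _ _ hb _ ih =>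
    intro Λ M emb exit hM
    refine Steps.trans (Steps.single ?_)
      (ih M (emb ∘ some ∘ Sum.inl) exit (fun l => hM (some (.inl l))))
    simp only [TM2.step, Prog.entry, Option.some.injEq]
    rw [hM none]
    simp only [Prog.code, TM2.stepAux, hb, cond_true]
    rfl
  | @ite_false b p q _ _ _ _ _ hb _ ih =>
    intro Λ M emb exit hM
    refine Steps.trans (Steps.single ?_)
      (ih M (emb ∘ some ∘ Sum.inr) exit (fun l => hM (some (.inr l))))
    simp only [TM2.step, Prog.entry, Option.some.injEq]
    rw [hM none]
    simp only [Prog.code, TM2.stepAux, hb, cond_false]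
    rfl
  | @loop_false b p _ _ hb =>
    intro Λ M emb exit hM
    refine Steps.single ?_
    simp only [TM2.step, Prog.entry, Option.some.injEq]
    rw [hM none]
    simp [Prog.code, hb]
  | @loop_true b p _ _ _ _ _ _ _ _ hb _ _ ihp ihl =>
    intro Λ M emb exit hM
    refine Steps.trans (Steps.single ?_)
      ((ihp M (emb ∘ some) (emb none) (fun l => hM (some l))).trans (ihl M emb exit hM))
    simp only [TM2.step, Prog.entry, Option.some.injEq]
    rw [hM none]
    simp only [Prog.code, TM2.stepAux, hb, cond_true]
    rfl

end Generic

/-! ### Trees on the stacks of a fixed machine -/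

/-- Binary trees, the universal data type. -/
inductive Tree : Type
  | nil : Tree
  | cons (x y : Tree) : Tree

namespace Tree

/-- Trees are written in prefix notation. -/
def code : Tree → List Bool
  | nil => [false]
  | cons x y => true :: (x.code ++ y.code)

/-- The size of a tree is the length of its code. -/
def size (x : Tree) : ℕ := x.code.length

@[simp] theorem size_nil : size nil = 1 := rfl

@[simp] theorem size_cons (x y : Tree) : size (cons x y) = x.size + y.size + 1 := by
  simp [size, code]

theorem one_le_size (x : Tree) : 1 ≤ x.size := by cases x <;> simp

end Tree

/-- The codes of a list of trees, in order. -/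
def codes (xs : List Tree) : List Bool := xs.flatMap Tree.code

@[simp] theorem codes_nil : codes [] = [] := rfl

@[simp] theorem codes_cons (x : Tree) (xs : List Tree) : codes (x :: xs) = x.code ++ codes xs :=
  rfl

@[simp] theorem codes_append (xs ys : List Tree) : codes (xs ++ ys) = codes xs ++ codes ys := by
  simp [codes]

/-- The stacks that hold trees: the main one and two for saved values. -/
inductive Val : Type
  | w | a | b
  deriving DecidableEq

/-- The stacks: the input, a buffer, a counter, and those that hold trees. -/
inductive Stk : Type
  | inp | tmp | cnt
  | val (j : Val)
  deriving DecidableEq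

instance : Fintype Stk :=
  ⟨{.inp, .tmp, .cnt, .val .w, .val .a, .val .b}, by rintro (_ | _ | _ | _ | _ | _) <;> decide⟩

/-- The alphabets of the stacks. -/
abbrev Alph (S : Type) : Stk → Type
  | .inp => S
  | _ => Bool

/-- The internal state: the last input symbol, the last bit, the last counter mark. -/
abbrev Reg (S : Type) : Type := Option S × Option Bool × Option Bool

/-- The contents of all stacks. -/
def stk {S : Type} (i : List S) (f : Val → List Bool) (t c : List Bool) :
    (k : Stk) → List (Alph S k)
  | .inp => i
  | .tmp => t
  | .cnt => c
  | .val j => f j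

section Fixed

variable {S : Type}

@[simp] theorem update_stk_inp (i : List S) (f t c l) :
    Function.update (stk i f t c) Stk.inp l = stk l f t c := by
  funext k; cases k <;> rfl

@[simp] theorem update_stk_tmp (i : List S) (f t c l) :
    Function.update (stk i f t c) Stk.tmp l = stk i f l c := by
  funext k; cases k <;> rfl

@[simp] theorem update_stk_cnt (i : List S) (f t c l) :
    Function.update (stk i f t c) Stk.cnt l = stk i f t l := by
  funext k; cases k <;> rfl

@[simp] theorem update_stk_val (i : List S) (f t c j l) :
    Function.update (stk i f t c) (Stk.val j) l = stk i (Function.update f j l) t c := by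
  funext k
  cases k with
  | val k =>
    by_cases h : k = j
    · subst h; simp [stk]
    · simp [stk, h]
  | _ => rfl

/-- Programs of the fixed machine. -/
abbrev TProg (S : Type) : Type := Prog (Alph S) (Reg S)

/-- `p` goes from `v, A` to some state and the stacks `B` within `n` steps. -/
def Leads (p : TProg S) (v : Reg S) (A : (k : Stk) → List (Alph S k)) (v' : Reg S)
    (B : (k : Stk) → List (Alph S k)) (n : ℕ) : Prop :=
  ∃ m ≤ n, Exec p v A v' B m

theorem Leads.mono {p : TProg S} {v A v' B m n} (h : Leads p v A v' B m) (hmn : m ≤ n) :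
    Leads p v A v' B n :=
  let ⟨k, hk, e⟩ := h
  ⟨k, hk.trans hmn, e⟩

theorem Leads.seq {p q : TProg S} {v A v₁ A₁ v₂ A₂ m n} (hp : Leads p v A v₁ A₁ m)
    (hq : Leads q v₁ A₁ v₂ A₂ n) : Leads (.seq p q) v A v₂ A₂ (m + n) :=
  let ⟨k, hk, e⟩ := hp
  let ⟨l, hl, e'⟩ := hq
  ⟨k + l, Nat.add_le_add hk hl, e.seq e'⟩

theorem Leads.ite_true {b : Reg S → Bool} {p q : TProg S} {v A v₁ A₁ n} (hb : b v = true)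
    (hp : Leads p v A v₁ A₁ n) : Leads (.ite b p q) v A v₁ A₁ (n + 1) :=
  let ⟨k, hk, e⟩ := hp
  ⟨1 + k, by omega, .ite_true hb e⟩

theorem Leads.ite_false {b : Reg S → Bool} {p q : TProg S} {v A v₁ A₁ n} (hb : b v = false)
    (hq : Leads q v A v₁ A₁ n) : Leads (.ite b p q) v A v₁ A₁ (n + 1) :=
  let ⟨k, hk, e⟩ := hq
  ⟨1 + k, by omega, .ite_false hb e⟩

theorem Leads.loop_false {b : Reg S → Bool} {p : TProg S} {v A} (hb : b v = false) :
    Leads (.loop b p) v A v A 1 :=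
  ⟨1, le_rfl, .loop_false hb⟩

theorem Leads.loop_true {b : Reg S → Bool} {p : TProg S} {v A v₁ A₁ v₂ A₂ m n}
    (hb : b v = true) (hp : Leads p v A v₁ A₁ m) (hl : Leads (.loop b p) v₁ A₁ v₂ A₂ n) :
    Leads (.loop b p) v A v₂ A₂ (m + n + 1) :=
  let ⟨k, hk, e⟩ := hp
  let ⟨l, hl, e'⟩ := hl
  ⟨1 + (k + l), by omega, .loop_true hb e e'⟩

theorem leads_push {k f} {v : Reg S} {A : (k : Stk) → List (Alph S k)} :
    Leads (.push k f) v A v (Function.update A k (f v :: A k)) 1 :=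
  ⟨1, le_rfl, .push⟩

theorem leads_pop {k f} {v : Reg S} {A : (k : Stk) → List (Alph S k)} :
    Leads (.pop k f) v A (f v (A k).head?) (Function.update A k (A k).tail) 1 :=
  ⟨1, le_rfl, .pop⟩

/-- Push the constant `c` on the stack `j`. -/
def pushVal (j : Val) (c : Bool) : TProg S := .push (.val j) fun _ => c

/-- Pop a bit from the stack `j` into the state. -/
def popVal (j : Val) : TProg S := .pop (.val j) fun v o => (v.1, o, v.2.2)

/-- Push the last bit on the stack `j`. -/
def putVal (j : Val) : TProg S := .push (.val j) fun v => v.2.1.getD false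

/-- Push the last bit on the buffer. -/
def putTmp : TProg S := .push .tmp fun v => v.2.1.getD false

/-- Pop a bit from the buffer into the state. -/
def popTmp : TProg S := .pop .tmp fun v o => (v.1, o, v.2.2)

/-- Push a mark on the counter. -/
def incCnt : TProg S := .push .cnt fun _ => true

/-- Pop a mark from the counter into the state. -/
def decCnt : TProg S := .pop .cnt fun v o => (v.1, v.2.1, o)

theorem leads_pushVal (j c v) (i : List S) (f t u) :
    Leads (pushVal j c) v (stk i f t u) v (stk i (Function.update f j (c :: f j)) t u) 1 := by
  simpa [stk, pushVal, popVal, putVal, putTmp, popTmp, incCnt, decCnt]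
    using leads_push (k := Stk.val j) (f := fun _ => c) (v := v)
    (A := stk i f t u)

theorem leads_popVal (j v) (i : List S) (f t u) :
    Leads (popVal j) v (stk i f t u) (v.1, (f j).head?, v.2.2)
      (stk i (Function.update f j (f j).tail) t u) 1 := by
  simpa [stk, pushVal, popVal, putVal, putTmp, popTmp, incCnt, decCnt]
    using leads_pop (k := Stk.val j)
    (f := fun (v : Reg S) o => (v.1, o, v.2.2)) (v := v) (A := stk i f t u)

theorem leads_putVal (j v) (i : List S) (f t u) :
    Leads (putVal j) v (stk i f t u) v
      (stk i (Function.update f j (v.2.1.getD false :: f j)) t u) 1 := by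
  simpa [stk, pushVal, popVal, putVal, putTmp, popTmp, incCnt, decCnt]
    using leads_push (k := Stk.val j)
    (f := fun (v : Reg S) => v.2.1.getD false) (v := v) (A := stk i f t u)

theorem leads_putTmp (v) (i : List S) (f t u) :
    Leads putTmp v (stk i f t u) v (stk i f (v.2.1.getD false :: t) u) 1 := by
  simpa [stk, pushVal, popVal, putVal, putTmp, popTmp, incCnt, decCnt]
    using leads_push (k := Stk.tmp)
    (f := fun (v : Reg S) => v.2.1.getD false) (v := v) (A := stk i f t u)

theorem leads_popTmp (v) (i : List S) (f t u) :
    Leads popTmp v (stk i f t u) (v.1, t.head?, v.2.2) (stk i f t.tail u) 1 := by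
  simpa [stk, pushVal, popVal, putVal, putTmp, popTmp, incCnt, decCnt]
    using leads_pop (k := Stk.tmp)
    (f := fun (v : Reg S) o => (v.1, o, v.2.2)) (v := v) (A := stk i f t u)

theorem leads_incCnt (v) (i : List S) (f t u) :
    Leads incCnt v (stk i f t u) v (stk i f t (true :: u)) 1 := by
  simpa [stk, pushVal, popVal, putVal, putTmp, popTmp, incCnt, decCnt]
    using leads_push (k := Stk.cnt)
    (f := fun (_ : Reg S) => true) (v := v) (A := stk i f t u)

theorem leads_decCnt (v) (i : List S) (f t u) :
    Leads decCnt v (stk i f t u) (v.1, v.2.1, u.head?) (stk i f t u.tail) 1 := by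
  simpa [stk, pushVal, popVal, putVal, putTmp, popTmp, incCnt, decCnt]
    using leads_pop (k := Stk.cnt)
    (f := fun (v : Reg S) o => (v.1, v.2.1, o)) (v := v) (A := stk i f t u)

end Fixed

end StackProg

namespace StackProg

/-! ### Moving, copying and deleting whole trees -/

section Fixed

variable {S : Type}

/-- One step of moving a tree from the stack `i` to the buffer; the counter holds the number of
trees which are still to be moved after the present one. -/
def readStep (i : Val) : TProg S :=
  .seq (popVal i) (.seq putTmp (.ite (fun v => v.2.1 == some true) incCnt decCnt))

/-- Move a tree from the stack `i` to the buffer. -/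
def readTree (i : Val) : TProg S :=
  .seq incCnt (.seq decCnt (.loop (fun v => v.2.2.isSome) (readStep i)))

/-- Move the buffer to the stack `j`. -/
def flush (j : Val) : TProg S :=
  .seq popTmp (.loop (fun v => v.2.1.isSome) (.seq (putVal j) popTmp))

/-- Move the buffer to both of the stacks `j` and `k`. -/
def flushBoth (j k : Val) : TProg S :=
  .seq popTmp (.loop (fun v => v.2.1.isSome) (.seq (putVal j) (.seq (putVal k) popTmp)))

/-- Empty the buffer. -/
def clearTmp : TProg S :=
  .seq popTmp (.loop (fun v => v.2.1.isSome) popTmp)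

/-- Move a tree from the stack `i` to the stack `j`. -/
def move (i j : Val) : TProg S := .seq (readTree i) (flush j)

/-- Prefix notation is self-delimiting: `true` replaces one pending tree by two, and `false`
completes one. One pending tree is recorded by the mark in the state, the others by the counter. The
continuation form, which extends a run that starts after `x`, lets the two subtrees of a node be
chained. Each bit costs four steps for the body and one for the test. -/
theorem leads_read_loop (i : Val) (inp : List S) (x : Tree) :
    ∀ {s o f t c r v' A' n}, f i = x.code ++ r →
      Leads (.loop (fun v => v.2.2.isSome) (readStep i)) (s, some false, c.head?)
        (stk inp (Function.update f i r) (x.code.reverse ++ t) c.tail) v' A' n →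
      Leads (.loop (fun v => v.2.2.isSome) (readStep i)) (s, o, some true)
        (stk inp f t c) v' A' (n + 5 * x.size) := by
  induction x with
  | nil =>
    intro s o f t c r v' A' n hf h
    simp only [Tree.code, List.cons_append, List.nil_append] at hf
    have step : Leads (readStep i) (s, o, some true) (stk inp f t c) (s, some false, c.head?)
        (stk inp (Function.update f i r) (false :: t) c.tail) 4 := by
      refine (leads_popVal _ _ _ _ _ _).seq ((leads_putTmp _ _ _ _ _).seq
        (.ite_false ?_ ?_)) |>.mono (m := 1 + (1 + (1 + 1))) (by omega)
      · simp [hf]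
      · simpa [hf] using leads_decCnt (s, some false, some true) inp (Function.update f i r)
          (false :: t) c
    exact (Leads.loop_true rfl step (by simpa [Tree.code] using h)).mono (by simp; omega)
  | cons x y ihx ihy =>
    intro s o f t c r v' A' n hf h
    simp only [Tree.code, List.cons_append, List.append_assoc] at hf
    have step : Leads (readStep i) (s, o, some true) (stk inp f t c) (s, some true, some true)
        (stk inp (Function.update f i (x.code ++ (y.code ++ r))) (true :: t) (true :: c)) 4 := by
      refine (leads_popVal _ _ _ _ _ _).seq ((leads_putTmp _ _ _ _ _).seq
        (.ite_true ?_ ?_)) |>.mono (m := 1 + (1 + (1 + 1))) (by omega)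
      · simp [hf]
      · simpa [hf] using leads_incCnt (s, some true, some true) inp
          (Function.update f i (x.code ++ (y.code ++ r))) (true :: t) c
    refine (Leads.loop_true rfl step (ihx (r := y.code ++ r) (by simp)
      (ihy (r := r) (by simp) (n := n) ?_))).mono (by simp; omega)
    simpa [Tree.code] using h

theorem leads_readTree (i : Val) (inp : List S) (x : Tree) {v f t r} (hf : f i = x.code ++ r) :
    Leads (readTree i) v (stk inp f t []) (v.1, some false, none)
      (stk inp (Function.update f i r) (x.code.reverse ++ t) []) (5 * x.size + 3) := by
  refine ((leads_incCnt _ _ _ _ _).seq ((leads_decCnt _ _ _ _ _).seq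
    (leads_read_loop i inp x hf (.loop_false rfl)))).mono (by omega)

theorem leads_flush (j : Val) (inp : List S) (t : List Bool) : ∀ {v f c},
    Leads (flush j) v (stk inp f t c) (v.1, none, v.2.2)
      (stk inp (Function.update f j (t.reverse ++ f j)) [] c) (3 * t.length + 2) := by
  have key : ∀ (t : List Bool) {s f c o},
      Leads (.loop (fun v => v.2.1.isSome) (.seq (putVal j) popTmp)) (s, t.head?, o)
        (stk inp f t.tail c) (s, none, o)
        (stk inp (Function.update f j (t.reverse ++ f j)) [] c) (3 * t.length + 1) := by
    intro t
    induction t with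
    | nil => intro s f c o; simpa using Leads.loop_false rfl
    | cons b t ih =>
      intro s f c o
      refine (Leads.loop_true rfl ((leads_putVal _ _ _ _ _ _).seq (leads_popTmp _ _ _ _ _))
        ?_).mono (m := 2 + (3 * t.length + 1) + 1) (by simp; omega)
      simpa using ih (s := s) (f := Function.update f j (b :: f j)) (c := c) (o := o)
  intro v f c
  exact ((leads_popTmp _ _ _ _ _).seq (key t)).mono (by omega)

theorem leads_flushBoth (j k : Val) (hjk : j ≠ k) (inp : List S) (t : List Bool) : ∀ {v f c},
    Leads (flushBoth j k) v (stk inp f t c) (v.1, none, v.2.2)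
      (stk inp (Function.update (Function.update f j (t.reverse ++ f j)) k (t.reverse ++ f k)) [] c)
      (4 * t.length + 2) := by
  have key : ∀ (t : List Bool) {s f c o},
      Leads (.loop (fun v => v.2.1.isSome) (.seq (putVal j) (.seq (putVal k) popTmp)))
        (s, t.head?, o) (stk inp f t.tail c) (s, none, o)
        (stk inp (Function.update (Function.update f j (t.reverse ++ f j)) k (t.reverse ++ f k))
          [] c) (4 * t.length + 1) := by
    intro t
    induction t with
    | nil => intro s f c o; simpa using Leads.loop_false rfl
    | cons b t ih =>
      intro s f c o
      refine (Leads.loop_true rfl ((leads_putVal _ _ _ _ _ _).seq ((leads_putVal _ _ _ _ _ _).seq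
        (leads_popTmp _ _ _ _ _))) ?_).mono (m := 3 + (4 * t.length + 1) + 1) (by simp; omega)
      have := ih (s := s) (f := Function.update (Function.update f j (b :: f j)) k (b :: f k))
        (c := c) (o := o)
      have e : Function.update (Function.update (Function.update (Function.update f j (b :: f j)) k
          (b :: f k)) j (t.reverse ++ b :: f j)) k (t.reverse ++ b :: f k) =
          Function.update (Function.update f j (t.reverse ++ b :: f j)) k
            (t.reverse ++ b :: f k) := by
        funext l
        by_cases h1 : l = k
        · subst h1; simp
        · by_cases h2 : l = j
          · subst h2; simp [h1]
          · simp [h1, h2]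
      simpa [hjk, hjk.symm, e] using this
  intro v f c
  exact ((leads_popTmp _ _ _ _ _).seq (key t)).mono (by omega)

theorem leads_clearTmp (inp : List S) (t : List Bool) : ∀ {v f c},
    Leads clearTmp v (stk inp f t c) (v.1, none, v.2.2) (stk inp f [] c) (2 * t.length + 2) := by
  have key : ∀ (t : List Bool) {s f c o},
      Leads (.loop (fun v => v.2.1.isSome) popTmp) (s, t.head?, o)
        (stk inp f t.tail c) (s, none, o) (stk inp f [] c) (2 * t.length + 1) := by
    intro t
    induction t with
    | nil => intro s f c o; simpa using Leads.loop_false rfl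
    | cons b t ih =>
      intro s f c o
      exact (Leads.loop_true rfl (leads_popTmp _ _ _ _ _) ih).mono (by simp; omega)
  intro v f c
  exact ((leads_popTmp _ _ _ _ _).seq (key t)).mono (by omega)

theorem leads_move (i j : Val) (inp : List S) (x : Tree) {v f r} (hf : f i = x.code ++ r)
    (hij : i ≠ j) : Leads (move i j) v (stk inp f [] []) (v.1, none, none)
      (stk inp (Function.update (Function.update f i r) j (x.code ++ f j)) [] [])
      (8 * x.size + 5) := by
  have := (leads_readTree i inp x (v := v) (t := []) hf).seq
    (leads_flush j inp (x.code.reverse ++ []))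
  simp only [List.append_nil, List.length_reverse, List.reverse_reverse,
    Function.update_of_ne hij.symm] at this
  exact this.mono (by simp only [Tree.size]; omega)

/-! ### Programs that transform the main stack -/

/-- `p` replaces the trees `xs` on top of the main stack by `ys`, within `n` steps. -/
def Tr (p : TProg S) (xs ys : List Tree) (n : ℕ) : Prop :=
  ∀ v f r, f Val.w = codes xs ++ r →
    ∃ v', Leads p v (stk [] f [] []) v' (stk [] (Function.update f Val.w (codes ys ++ r)) [] []) n

theorem Tr.mono {p : TProg S} {xs ys m n} (h : Tr p xs ys m) (hmn : m ≤ n) : Tr p xs ys n :=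
  fun v f r hf => let ⟨v', hv⟩ := h v f r hf; ⟨v', hv.mono hmn⟩

/-- The remainder `r` of the main stack is arbitrary in `Tr`, so further trees may be absorbed into
it. -/
theorem Tr.frame {p : TProg S} {xs ys n} (h : Tr p xs ys n) (zs : List Tree) :
    Tr p (xs ++ zs) (ys ++ zs) n := fun v f r hf => by
  simpa using h v f (codes zs ++ r) (by simpa using hf)

theorem Tr.seq {p q : TProg S} {xs ys zs m n} (hp : Tr p xs ys m) (hq : Tr q ys zs n) :
    Tr (.seq p q) xs zs (m + n) := fun v f r hf => by
  obtain ⟨v₁, h₁⟩ := hp v f r hf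
  obtain ⟨v₂, h₂⟩ := hq v₁ _ r (Function.update_self _ _ _)
  exact ⟨v₂, h₁.seq (by simpa using h₂)⟩

theorem tr_skip (xs : List Tree) : Tr (.skip : TProg S) xs xs 1 := fun v f r hf =>
  ⟨v, 1, le_rfl, by simpa [← hf] using Exec.skip⟩

/-- Run `p` below the top tree. -/
def dip (p : TProg S) : TProg S := .seq (move .w .a) (.seq p (move .a .w))

theorem Tr.dip {p : TProg S} {xs ys n} (h : Tr p xs ys n) (x : Tree) :
    Tr (dip p) (x :: xs) (x :: ys) (n + 16 * x.size + 10) := fun v f r hf => by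
  have h₁ := leads_move .w .a [] x (v := v) (f := f) (r := codes xs ++ r) (by simpa using hf)
    (by decide)
  obtain ⟨v₂, h₂⟩ := h (v.1, none, none) _ r (show Function.update (Function.update f Val.w
    (codes xs ++ r)) Val.a (x.code ++ f Val.a) Val.w = _ by simp)
  have h₃ := leads_move .a .w [] x (v := v₂) (f := Function.update (Function.update (Function.update
    f Val.w (codes xs ++ r)) Val.a (x.code ++ f Val.a)) Val.w (codes ys ++ r)) (r := f Val.a)
    (by simp) (by decide)
  refine ⟨(v₂.1, none, none), cast ?_ ((h₁.seq (h₂.seq h₃)).mono (n := n + 16 * x.size + 10) (by omega))⟩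
  congr 2
  funext j
  cases j <;> simp

/-- Exchange the two top trees. -/
def swap : TProg S := .seq (move .w .a) (.seq (move .w .b) (.seq (move .a .w) (move .b .w)))

theorem tr_swap (x y : Tree) :
    Tr (swap : TProg S) [x, y] [y, x] (16 * x.size + 16 * y.size + 20) := fun v f r hf => by
  have h₁ := leads_move .w .a [] x (v := v) (f := f) (r := y.code ++ r) (by simpa using hf)
    (by decide)
  have h₂ := leads_move .w .b [] y (v := (v.1, none, none)) (r := r)
    (f := Function.update (Function.update f Val.w (y.code ++ r)) Val.a (x.code ++ f Val.a))
    (by simp) (by decide)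
  have h₃ := leads_move .a .w [] x (v := (v.1, none, none)) (r := f Val.a) (f := Function.update
    (Function.update (Function.update (Function.update f Val.w (y.code ++ r)) Val.a
      (x.code ++ f Val.a)) Val.w r) Val.b (y.code ++ f Val.b))
    (by simp) (by decide)
  have h₄ := leads_move .b .w [] y (v := (v.1, none, none)) (r := f Val.b) (f := Function.update
    (Function.update (Function.update (Function.update (Function.update (Function.update f Val.w
      (y.code ++ r)) Val.a (x.code ++ f Val.a)) Val.w r) Val.b (y.code ++ f Val.b)) Val.a
      (f Val.a)) Val.w (x.code ++ r))
    (by simp) (by decide)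
  simp only [ne_eq, reduceCtorEq, not_false_eq_true, Function.update_of_ne, Function.update_self]
    at h₁ h₂ h₃ h₄
  refine ⟨(v.1, none, none), cast ?_ ((h₁.seq (h₂.seq (h₃.seq h₄))).mono
    (n := 16 * x.size + 16 * y.size + 20) (by omega))⟩
  congr 2
  funext j
  cases j <;> simp

/-- Copy the top tree. -/
def dup : TProg S := .seq (readTree .w) (.seq (flushBoth .w .a) (move .a .w))

theorem tr_dup (x : Tree) : Tr (dup : TProg S) [x] [x, x] (17 * x.size + 10) := fun v f r hf => by
  have h₁ := leads_readTree .w [] x (v := v) (f := f) (r := r) (t := []) (by simpa using hf)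
  have h₂ := leads_flushBoth .w .a (by decide) [] (x.code.reverse ++ [])
    (v := (v.1, some false, none)) (f := Function.update f Val.w r) (c := [])
  have h₃ := leads_move .a .w [] x (v := (v.1, none, none)) (r := f Val.a) (f := Function.update
    (Function.update (Function.update f Val.w r) Val.w (x.code ++ r)) Val.a (x.code ++ f Val.a))
    (by simp) (by decide)
  simp only [ne_eq, reduceCtorEq, not_false_eq_true, Function.update_of_ne, Function.update_self,
    List.append_nil, List.reverse_reverse, List.length_reverse]
    at h₁ h₂ h₃
  refine ⟨(v.1, none, none), cast ?_ ((h₁.seq (h₂.seq h₃)).mono (n := 17 * x.size + 10)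
    (by simp only [Tree.size]; omega))⟩
  congr 2
  funext j
  cases j <;> simp

/-- Remove the top tree. -/
def drop : TProg S := .seq (readTree .w) clearTmp

theorem tr_drop (x : Tree) : Tr (drop : TProg S) [x] [] (7 * x.size + 5) := fun v f r hf => by
  have h₁ := leads_readTree .w [] x (v := v) (f := f) (r := r) (t := []) (by simpa using hf)
  exact ⟨_, (h₁.seq (leads_clearTmp _ _)).mono (by simp [Tree.size]; omega)⟩

theorem tr_push_nil (xs : List Tree) : Tr (pushVal .w false : TProg S) xs (.nil :: xs) 1 :=
  fun v f r hf => ⟨v, by simpa [hf, Tree.code] using leads_pushVal .w false v [] f [] []⟩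

theorem tr_push_cons (x y : Tree) (xs : List Tree) :
    Tr (pushVal .w true : TProg S) (x :: y :: xs) (.cons x y :: xs) 1 :=
  fun v f r hf => ⟨v, by simpa [hf, Tree.code] using leads_pushVal .w true v [] f [] []⟩

/-- Distinguish the two forms of the top tree. -/
def caseTree (p q : TProg S) : TProg S :=
  .seq (popVal .w) (.ite (fun v => v.2.1 == some true) q p)

/-- The first bit of a code is the constructor. Popping it deletes a `nil` completely and turns a
`cons` into its two subtrees, so no further unpacking is needed. -/
theorem Tr.caseTree_nil {p q : TProg S} {xs ys n} (h : Tr p xs ys n) :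
    Tr (caseTree p q) (.nil :: xs) ys (n + 2) := fun v f r hf => by
  simp only [codes_cons, Tree.code, List.cons_append, List.nil_append] at hf
  obtain ⟨v', h'⟩ := h (v.1, some false, v.2.2) (Function.update f Val.w (codes xs ++ r)) r (by simp)
  refine ⟨v', ((leads_popVal .w v [] f [] []).seq (.ite_false (n := n) ?_ ?_)).mono (by omega)⟩
  · simp [hf]
  · simpa [hf] using h'

theorem Tr.caseTree_cons {p q : TProg S} {x y xs ys n} (h : Tr q (x :: y :: xs) ys n) :
    Tr (caseTree p q) (.cons x y :: xs) ys (n + 2) := fun v f r hf => by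
  simp only [codes_cons, Tree.code, List.cons_append, List.append_assoc] at hf
  obtain ⟨v', h'⟩ := h (v.1, some true, v.2.2)
    (Function.update f Val.w (codes (x :: y :: xs) ++ r)) r (by simp)
  refine ⟨v', ((leads_popVal .w v [] f [] []).seq (.ite_true (n := n) ?_ ?_)).mono (by omega)⟩
  · simp [hf]
  · simpa [hf] using h'

/-- The tree of a list of trees. -/
def listTree : List Tree → Tree
  | [] => .nil
  | x :: xs => .cons x (listTree xs)

/-- Run `p` for each element of the list on top of the stack. -/
def forEach (p : TProg S) : TProg S :=
  .seq (popVal .w) (.loop (fun v => v.2.1 == some true) (.seq p (popVal .w)))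

/-- The loop invariant is `ys`, the trees below the list, as a function of the elements that remain.
The body is only required to work on suffixes of `l`, so that a bound valid along this particular
run is enough. -/
theorem Tr.forEach {p : TProg S} {n : ℕ} {ys : List Tree → List Tree} : ∀ (l : List Tree),
    (∀ l₁ x l₂, l₁ ++ x :: l₂ = l →
      Tr p (x :: listTree l₂ :: ys (x :: l₂)) (listTree l₂ :: ys l₂) n) →
    Tr (forEach p) (listTree l :: ys l) (ys []) ((n + 2) * l.length + 2) := by
  -- The loop is always entered with the constructor bit of the remaining list already popped into
  -- the state.
  have key : ∀ (l : List Tree), (∀ l₁ x l₂, l₁ ++ x :: l₂ = l →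
      Tr p (x :: listTree l₂ :: ys (x :: l₂)) (listTree l₂ :: ys l₂) n) → ∀ s c f r,
      f Val.w = ((listTree l).code ++ codes (ys l) ++ r) →
      ∃ v', Leads (.loop (fun v => v.2.1 == some true) (.seq p (popVal .w)))
        (s, (f Val.w).head?, c) (stk [] (Function.update f Val.w (f Val.w).tail) [] []) v'
        (stk [] (Function.update f Val.w (codes (ys []) ++ r)) [] []) ((n + 2) * l.length + 1) := by
    intro l
    induction l with
    | nil =>
      intro _ s c f r hf
      exact ⟨_, by simpa [hf, listTree, Tree.code] using Leads.loop_false (by simp)⟩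
    | cons x l ih =>
      intro h s c f r hf
      obtain ⟨v₁, h₁⟩ := h [] x l rfl (s, some true, c) (Function.update f Val.w
        (codes (x :: listTree l :: ys (x :: l)) ++ r)) r (by simp)
      obtain ⟨v₂, h₂⟩ := ih (fun l₁ y l₂ e => h (x :: l₁) y l₂ (by simp [e])) v₁.1 v₁.2.2
        (Function.update f Val.w (codes (listTree l :: ys l) ++ r)) r (by simp)
      have e₁ : (f Val.w).tail = codes (x :: listTree l :: ys (x :: l)) ++ r := by
        simp [hf, listTree, Tree.code]
      have e₂ : (f Val.w).head? = some true := by simp [hf, listTree, Tree.code]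
      rw [e₁, e₂]
      simp only [Function.update_self, Function.update_idem] at h₁ h₂
      refine ⟨v₂, (Leads.loop_true rfl (h₁.seq (leads_popVal _ _ _ _ _ _)) (A₂ := stk [] _ [] [])
        (n := (n + 2) * l.length + 1) ?_).mono (by simp only [List.length_cons]; ring_nf; omega)⟩
      simpa using h₂
  intro l h v f r hf
  obtain ⟨v', h'⟩ := key l h v.1 v.2.2 f r (by simpa using hf)
  exact ⟨v', ((leads_popVal _ _ _ _ _ _).seq h').mono (by omega)⟩

end Fixed

end StackProg

namespace StackProg

open Turing Polynomial

theorem eval_nat_mono (q : ℕ[X]) {m n : ℕ} (h : m ≤ n) : q.eval m ≤ q.eval n := by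
  rw [eval_eq_sum, eval_eq_sum]
  exact Finset.sum_le_sum fun i _ => Nat.mul_le_mul_left _ (Nat.pow_le_pow_left h i)

/-- A step pushes at most one symbol. This is what turns time bounds into bounds for the size of
results. -/
theorem Exec.length_le {K : Type} [DecidableEq K] {Γ : K → Type} {σ : Type} {p : Prog Γ σ}
    {v S v' S' n} (h : Exec p v S v' S' n) (k : K) : (S' k).length ≤ (S k).length + n := by
  induction h with
  | @push k' f v S =>
    by_cases hk : k = k'
    · subst hk; simp
    · simp [hk]
  | @pop k' f v S =>
    by_cases hk : k = k'
    · subst hk; simp; omega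
    · simp [hk]
  | _ => omega

/-! ### Polynomial time functions on encoded types -/

/-- Types whose elements are represented by trees. -/
class Enc (α : Type) where
  enc : α → Tree

/-- The size of the representation. -/
def esize {α : Type} [Enc α] (a : α) : ℕ := (Enc.enc a).size

instance {α β : Type} [Enc α] [Enc β] : Enc (α × β) := ⟨fun x => .cons (Enc.enc x.1) (Enc.enc x.2)⟩

instance : Enc Bool := ⟨fun b => if b then .cons .nil .nil else .nil⟩

instance {α : Type} [Enc α] : Enc (List α) := ⟨fun l => listTree (l.map Enc.enc)⟩

/-- Natural numbers are represented in unary. -/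
instance : Enc ℕ := ⟨fun n => listTree (List.replicate n .nil)⟩

@[simp] theorem esize_pair {α β : Type} [Enc α] [Enc β] (a : α) (b : β) :
    esize (a, b) = esize a + esize b + 1 := by simp [esize, Enc.enc]

@[simp] theorem esize_nil {α : Type} [Enc α] : esize ([] : List α) = 1 := by
  simp [esize, Enc.enc, listTree]

@[simp] theorem esize_cons {α : Type} [Enc α] (a : α) (l : List α) :
    esize (a :: l) = esize a + esize l + 1 := by simp [esize, Enc.enc, listTree]

theorem length_le_esize {α : Type} [Enc α] (l : List α) : l.length ≤ esize l := by
  induction l with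
  | nil => simp
  | cons a l ih => simp; omega

@[simp] theorem esize_nat (n : ℕ) : esize n = 2 * n + 1 := by
  induction n with
  | zero => rfl
  | succ n ih =>
    simp only [esize, Enc.enc, List.replicate_succ, listTree, Tree.size_cons, Tree.size_nil] at *
    omega

/-- `f` is computed by a stack program in polynomial time. -/
def PT {α β : Type} [Enc α] [Enc β] (f : α → β) : Prop :=
  ∃ (p : (S : Type) → TProg S) (q : ℕ[X]), ∀ (S : Type) (a : α),
    Tr (p S) [Enc.enc a] [Enc.enc (f a)] (q.eval (esize a))

/-! ### Closure properties of polynomial time functions -/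

section PT

variable {α β γ δ : Type} [Enc α] [Enc β] [Enc γ] [Enc δ]

/-- The result is left on the main stack, which grows by at most the running time. The programs are
uniform in the input alphabet, so the empty one may be chosen for this estimate. -/
theorem PT.esize_le {f : α → β} (hf : PT f) : ∃ q : ℕ[X], ∀ a, esize (f a) ≤ q.eval (esize a) := by
  obtain ⟨p, q, h⟩ := hf
  refine ⟨X + q, fun a => ?_⟩
  obtain ⟨v', m, hm, e⟩ := h Empty a (none, none, none) (fun _ => (Enc.enc a).code) [] (by simp)
  have := e.length_le (Stk.val .w)
  simp only [stk, Function.update_self, codes_cons, codes_nil, List.append_nil] at this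
  simp only [esize, Tree.size, eval_add, eval_X] at *
  omega

theorem PT.congr {f g : α → β} (hf : PT f) (h : ∀ a, f a = g a) : PT g :=
  (funext h : f = g) ▸ hf

/-- Introduce a polynomial time function by giving the time as a function of the input. -/
theorem PT.of_le {f : α → β} (p : (S : Type) → TProg S) (t : α → ℕ)
    (h : ∀ S a, Tr (p S) [Enc.enc a] [Enc.enc (f a)] (t a))
    (ht : ∃ q : ℕ[X], ∀ a, t a ≤ q.eval (esize a)) : PT f :=
  let ⟨q, hq⟩ := ht
  ⟨p, q, fun S a => (h S a).mono (hq a)⟩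

theorem PT.id : PT (fun a : α => a) :=
  ⟨fun _ => .skip, 1, fun S a => by simpa using tr_skip _⟩

theorem PT.comp {g : β → γ} {f : α → β} (hg : PT g) (hf : PT f) : PT (fun a => g (f a)) := by
  obtain ⟨r, hr⟩ := hf.esize_le
  obtain ⟨p, q, hp⟩ := hf
  obtain ⟨p', q', hp'⟩ := hg
  refine ⟨fun S => .seq (p S) (p' S), q + q'.comp r, fun S a => ?_⟩
  refine ((hp S a).seq (hp' S (f a))).mono ?_
  simp only [eval_add, eval_comp]
  exact Nat.add_le_add_left (eval_nat_mono _ (hr a)) _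

theorem PT.pair {f : α → β} {g : α → γ} (hf : PT f) (hg : PT g) : PT (fun a => (f a, g a)) := by
  obtain ⟨r, hr⟩ := hf.esize_le
  obtain ⟨p, q, hp⟩ := hf
  obtain ⟨p', q', hp'⟩ := hg
  refine ⟨fun S => .seq dup (.seq (p S) (.seq (dip (p' S)) (pushVal .w true))),
    17 * X + 10 + q + q' + 16 * r + 11, fun S a => ?_⟩
  refine ((tr_dup _).seq (((hp S a).frame [_]).seq (((hp' S a).dip _).seq
    (tr_push_cons _ _ [])))).mono ?_
  have := hr a
  simp only [eval_add, eval_mul, eval_X, eval_ofNat]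
  simp only [esize] at *
  omega

theorem PT.fst : PT (fun a : α × β => a.1) := by
  refine ⟨fun S => caseTree .skip (dip drop), 23 * X + 20, fun S a => ?_⟩
  refine (Tr.caseTree_cons ((tr_drop _).dip _)).mono ?_
  simp only [esize, Enc.enc, eval_add, eval_mul, eval_X, eval_ofNat, Tree.size_cons]
  omega

theorem PT.snd : PT (fun a : α × β => a.2) := by
  refine ⟨fun S => caseTree .skip drop, 23 * X + 20, fun S a => ?_⟩
  refine (Tr.caseTree_cons ((tr_drop _).frame _)).mono ?_
  simp only [esize, Enc.enc, eval_add, eval_mul, eval_X, eval_ofNat, Tree.size_cons]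
  omega

/-- Push a fixed tree. -/
def pushTree {S : Type} : Tree → TProg S
  | .nil => pushVal .w false
  | .cons x y => .seq (pushTree y) (.seq (pushTree x) (pushVal .w true))

theorem tr_pushTree {S : Type} (x : Tree) (xs : List Tree) :
    Tr (pushTree x : TProg S) xs (x :: xs) x.size := by
  induction x generalizing xs with
  | nil => exact tr_push_nil xs
  | cons x y ihx ihy =>
    exact ((ihy xs).seq ((ihx _).seq (tr_push_cons x y xs))).mono (by simp; omega)

theorem PT.const (b : β) : PT (fun _ : α => b) := by
  refine ⟨fun S => .seq drop (pushTree (Enc.enc b)), 7 * X + 5 + C (esize b), fun S a => ?_⟩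
  refine ((tr_drop _).seq (tr_pushTree _ _)).mono ?_
  simp [esize]

theorem PT.ite {c : α → Bool} {f g : α → β} (hc : PT c) (hf : PT f) (hg : PT g) :
    PT (fun a => if c a then f a else g a) := by
  obtain ⟨p, q, hp⟩ := hc
  obtain ⟨p₁, q₁, hp₁⟩ := hf
  obtain ⟨p₂, q₂, hp₂⟩ := hg
  refine ⟨fun S => .seq dup (.seq (p S) (caseTree (p₂ S) (.seq drop (.seq drop (p₁ S))))),
    17 * X + 10 + q + q₁ + q₂ + 26, fun S a => ?_⟩
  have h₁ := (tr_dup (S := S) (Enc.enc a)).seq ((hp S a).frame [Enc.enc a])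
  cases h : c a
  · rw [h] at h₁
    refine ((tr_dup _).seq (((hp S a).frame [Enc.enc a]).seq (m := q.eval (esize a))
      (n := q₂.eval (esize a) + 2) ?_)).mono ?_
    · simp only [h, Bool.false_eq_true, if_false]
      exact ((hp₂ S a).caseTree_nil)
    · simp only [eval_add, eval_mul, eval_X, eval_ofNat]
      simp only [esize] at *
      omega
  · refine ((tr_dup _).seq (((hp S a).frame [Enc.enc a]).seq (m := q.eval (esize a))
      (n := 12 + (12 + q₁.eval (esize a)) + 2) ?_)).mono ?_
    · simp only [h, if_true]
      exact Tr.caseTree_cons (((tr_drop .nil).frame [.nil, Enc.enc a]).seq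
        (((tr_drop .nil).frame [Enc.enc a]).seq (hp₁ S a)))
    · simp only [eval_add, eval_mul, eval_X, eval_ofNat]
      simp only [esize] at *
      omega

theorem PT.not {c : α → Bool} (hc : PT c) : PT (fun a => !c a) :=
  (hc.ite (PT.const false) (PT.const true)).congr fun a => by cases c a <;> rfl

theorem PT.and {c d : α → Bool} (hc : PT c) (hd : PT d) : PT (fun a => c a && d a) :=
  (hc.ite hd (PT.const false)).congr fun a => by cases c a <;> rfl

theorem PT.or {c d : α → Bool} (hc : PT c) (hd : PT d) : PT (fun a => c a || d a) :=
  (hc.ite (PT.const true) hd).congr fun a => by cases c a <;> rfl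

theorem PT.cons {f : α → β} {l : α → List β} (hf : PT f) (hl : PT l) :
    PT (fun a => f a :: l a) :=
  hf.pair hl

/-- Case distinction on a list. -/
def listCases (l : List β) (x : γ) (f : β → List β → γ) : γ :=
  match l with
  | [] => x
  | b :: t => f b t

theorem PT.listCases {l : α → List β} {x : α → γ} {f : α → β → List β → γ} (hl : PT l) (hx : PT x)
    (hf : PT fun y : α × β × List β => f y.1 y.2.1 y.2.2) :
    PT (fun a => listCases (l a) (x a) (f a)) := by
  obtain ⟨r, hr⟩ := hl.esize_le
  obtain ⟨p, q, hp⟩ := hl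
  obtain ⟨p₁, q₁, hp₁⟩ := hx
  obtain ⟨p₂, q₂, hp₂⟩ := hf
  -- In the second case a pushed `true` rebuilds the pair of head and tail, `swap` brings the saved
  -- argument to the top, and another `true` pairs the two as the input of `p₂`.
  refine ⟨fun S => .seq dup (.seq (p S) (caseTree (p₁ S) (.seq (pushVal .w true)
    (.seq swap (.seq (pushVal .w true) (p₂ S)))))),
    17 * X + 10 + q + q₁ + (q₂.comp (r + X + 1) + 16 * r + 16 * X + 24), fun S a => ?_⟩
  cases h : l a with
  | nil =>
    refine ((tr_dup _).seq (((hp S a).frame [Enc.enc a]).seq (m := q.eval (esize a))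
      (n := q₁.eval (esize a) + 2) ?_)).mono ?_
    · simp only [h]
      exact (hp₁ S a).caseTree_nil
    · simp only [eval_add, eval_mul, eval_X, eval_ofNat]
      simp only [esize] at *
      omega
  | cons b t =>
    have hs := hr a
    rw [h] at hs
    refine ((tr_dup _).seq (((hp S a).frame [Enc.enc a]).seq (m := q.eval (esize a))
      (n := 1 + (16 * esize (b :: t) + 16 * esize a + 20 +
        (1 + q₂.eval (esize (a, b, t)))) + 2) ?_)).mono ?_
    · simp only [h]
      exact Tr.caseTree_cons ((tr_push_cons (Enc.enc b) (Enc.enc t) [Enc.enc a]).seq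
        ((tr_swap (Enc.enc (b :: t)) (Enc.enc a)).seq
          ((tr_push_cons (Enc.enc a) (Enc.enc (b :: t)) []).seq (hp₂ S (a, b, t)))))
    · have : q₂.eval (esize (a, b, t)) ≤ q₂.eval (r.eval (esize a) + esize a + 1) := by
        apply eval_nat_mono
        simp only [esize_pair, esize_cons] at *
        omega
      simp only [eval_add, eval_mul, eval_X, eval_ofNat, eval_comp, eval_one]
      simp only [esize] at *
      omega

/-- Iterating a polynomial time function can produce values of exponential size, hence the
hypothesis `hbound` on all intermediate accumulators. With it, each round costs a fixed polynomial
in the size of `c`. -/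
theorem PT.foldl_pair {f : β → α → β} (hf : PT fun x : β × α => f x.1 x.2) {l : γ → List α}
    {b : γ → β} (hl : PT l) (hb : PT b)
    (hbound : ∃ q : ℕ[X], ∀ c l₁, l₁ <+: l c → esize (l₁.foldl f (b c)) ≤ q.eval (esize c)) :
    PT (fun c => (l c).foldl f (b c)) := by
  obtain ⟨q, hq⟩ := hbound
  obtain ⟨r, hr⟩ := hl.esize_le
  have hlb := hl.pair hb
  obtain ⟨p, t, hp⟩ := hf
  obtain ⟨p₀, t₀, hp₀⟩ := hlb
  refine PT.of_le (fun S => .seq (p₀ S) (caseTree .skip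
    (forEach (.seq swap (.seq (dip (.seq swap (.seq (pushVal .w true) (p S)))) .skip)))))
    (fun c => t₀.eval (esize c) + (((16 * esize (l c) + 16 * esize (l c) + 20 +
      (16 * esize (l c) + 16 * q.eval (esize c) + 20 +
        (1 + t.eval (q.eval (esize c) + esize (l c) + 1)) + 16 * esize (l c) + 10 + 1) + 2) *
          (l c).length + 2) + 2)) (fun S c => ?_) ?_
  · refine (hp₀ S c).seq (Tr.caseTree_cons ?_)
    -- With `l₂` still to be read, the accumulator is the fold over the prefix of the complementary
    -- length.
    have key := Tr.forEach (S := S)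
      (p := .seq swap (.seq (dip (.seq swap (.seq (pushVal .w true) (p S)))) .skip))
      (n := 16 * esize (l c) + 16 * esize (l c) + 20 +
        (16 * esize (l c) + 16 * q.eval (esize c) + 20 +
        (1 + t.eval (q.eval (esize c) + esize (l c) + 1)) + 16 * esize (l c) + 10 + 1))
      (ys := fun l₂ => [Enc.enc ((List.take ((l c).length - l₂.length) (l c)).foldl f (b c))])
      ((l c).map Enc.enc) ?_
    · simp only [List.length_map, Nat.sub_self, List.take_zero, List.foldl_nil, List.length_nil,
        Nat.sub_zero, List.take_length] at key
      exact key
    · intro l₁ x l₂ h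
      obtain ⟨m₁, m₂, hm, rfl, hm₂⟩ := List.map_eq_append_iff.1 h.symm
      obtain ⟨a, m₃, rfl, rfl, rfl⟩ := List.map_eq_cons_iff.1 hm₂
      have hlc : (l c) = m₁ ++ a :: m₃ := hm
      have h₁ : List.take ((l c).length - (m₃.map Enc.enc).length) (l c) = m₁ ++ [a] := by
        rw [hlc, show m₁ ++ a :: m₃ = (m₁ ++ [a]) ++ m₃ by simp]
        exact List.take_left' (by simp; omega)
      have h₂ : List.take ((l c).length - (Enc.enc a :: m₃.map Enc.enc).length) (l c) = m₁ := by
        rw [hlc]; simp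
      have hb₁ := hq c m₁ ⟨a :: m₃, hlc.symm⟩
      have hsz : esize a + esize m₃ + 1 ≤ esize (l c) := by
        have : ∀ m : List α, esize (a :: m₃) ≤ esize (m ++ a :: m₃) := by
          intro m
          induction m with
          | nil => simp
          | cons y m ih => simp only [List.cons_append, esize_cons] at *; omega
        rw [hlc]
        simpa using this m₁
      rw [h₁, h₂, List.foldl_append]
      set acc := m₁.foldl f (b c)
      have s₁ := (tr_swap (S := S) (Enc.enc a) (listTree (m₃.map Enc.enc))).frame [Enc.enc acc]
      have s₂ := (tr_swap (S := S) (Enc.enc a) (Enc.enc acc)).seq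
        ((tr_push_cons (Enc.enc acc) (Enc.enc a) []).seq (hp S (acc, a)))
      have s₃ := s₂.dip (listTree (m₃.map Enc.enc))
      refine (s₁.seq (s₃.seq (tr_skip _))).mono ?_
      have ht : t.eval (esize (acc, a)) ≤ t.eval (q.eval (esize c) + esize (l c) + 1) := by
        apply eval_nat_mono
        simp only [esize_pair]
        omega
      have e₁ : (Enc.enc a).size = esize a := rfl
      have e₂ : (listTree (m₃.map Enc.enc)).size = esize m₃ := rfl
      have e₃ : (Enc.enc acc).size = esize acc := rfl
      rw [e₁, e₂, e₃]
      omega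
  · refine ⟨t₀ + (((16 * r + 16 * r + 20 + (16 * r + 16 * q + 20 +
        (1 + t.comp (q + r + 1)) + 16 * r + 10 + 1) + 2) * r + 2) + 2), fun c => ?_⟩
    simp only [eval_add, eval_mul, eval_ofNat, eval_comp, eval_one]
    have h₁ := hr c
    have h₂ := (length_le_esize (l c)).trans h₁
    have h₃ := eval_nat_mono t (show q.eval (esize c) + esize (l c) + 1 ≤
      q.eval (esize c) + r.eval (esize c) + 1 by omega)
    gcongr

/-- Folding with a context. -/
theorem PT.foldl {f : γ → β → α → β} (hf : PT fun x : γ × β × α => f x.1 x.2.1 x.2.2)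
    {l : γ → List α} {b : γ → β} (hl : PT l) (hb : PT b)
    (hbound : ∃ q : ℕ[X], ∀ c l₁, l₁ <+: l c → esize (l₁.foldl (f c) (b c)) ≤ q.eval (esize c)) :
    PT (fun c => (l c).foldl (f c) (b c)) := by
  have e : ∀ c (l₁ : List α) (x : β), l₁.foldl (fun (y : γ × β) a => (y.1, f y.1 y.2 a)) (c, x) =
      (c, l₁.foldl (f c) x) := by
    intro c l₁
    induction l₁ with
    | nil => intro x; rfl
    | cons a l₁ ih => intro x; simp [ih]
  -- The context travels unchanged as the first component of the accumulator.
  have := PT.foldl_pair (f := fun (y : γ × β) a => (y.1, f y.1 y.2 a)) (l := l)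
    (b := fun c => (c, b c)) ?_ hl (PT.id.pair hb) ?_
  · exact (PT.comp PT.snd this).congr fun c => by rw [e]
  · exact (PT.fst.comp PT.fst).pair
      (hf.comp ((PT.fst.comp PT.fst).pair ((PT.snd.comp PT.fst).pair PT.snd)))
  · obtain ⟨q, hq⟩ := hbound
    refine ⟨q + X + 1, fun c l₁ h => ?_⟩
    rw [e, esize_pair]
    have := hq c l₁ h
    simp only [eval_add, eval_X, eval_one]
    omega

end PT

end StackProg

namespace StackProg

open Turing Polynomial

/-! ### From programs to polynomial time Turing machines -/

section Machine

variable {S : Type}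

/-- Push fixed bits on the buffer. -/
def pushBits : List Bool → TProg S
  | [] => .skip
  | b :: l => .seq (.push .tmp fun _ => b) (pushBits l)

theorem leads_pushBits (l : List Bool) : ∀ (v : Reg S) (i : List S) (f t c),
    Leads (pushBits l) v (stk i f t c) v (stk i f (l.reverse ++ t) c) (l.length + 1) := by
  induction l with
  | nil => exact fun v i f t c => ⟨1, le_rfl, .skip⟩
  | cons b l ih =>
    intro v i f t c
    have h₁ : Leads (.push .tmp fun _ => b) v (stk i f t c) v (stk i f (b :: t) c) 1 := by
      simpa [stk] using leads_push (k := Stk.tmp) (f := fun (_ : Reg S) => b) (v := v)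
        (A := stk i f t c)
    exact (h₁.seq (by simpa using ih v i f (b :: t) c)).mono (by simp; omega)

/-- Pop an input symbol into the state. -/
def popInp : TProg S := .pop .inp fun v o => (o, v.2)

theorem leads_popInp (v) (i : List S) (f t u) :
    Leads popInp v (stk i f t u) (i.head?, v.2) (stk i.tail f t u) 1 := by
  simpa [stk, popInp] using leads_pop (k := Stk.inp)
    (f := fun (v : Reg S) o => (o, v.2)) (v := v) (A := stk i f t u)

/-- The tree of a list of input symbols. -/
def inputTree (c : S → Tree) (l : List S) : Tree := listTree (l.map c)

/-- Write the code of the last input symbol on the buffer. -/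
def emitSym [DecidableEq S] (c : S → Tree) : List S → TProg S
  | [] => .skip
  | s :: l => .ite (fun v => v.1 == some s) (pushBits (true :: (c s).code)) (emitSym c l)

theorem leads_emitSym [DecidableEq S] (c : S → Tree) (s : S) (l : List S) (hs : s ∈ l) (o i f t u) :
    Leads (emitSym c l) (some s, o) (stk i f t u) (some s, o)
      (stk i f ((c s).code.reverse ++ true :: t) u) ((c s).size + 2 + l.length) := by
  induction l with
  | nil => simp at hs
  | cons a l ih =>
    by_cases h : s = a
    · subst h
      have := leads_pushBits (true :: (c s).code) (some s, o) i f t u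
      have h := (this.ite_true (b := fun v => v.1 == some s) (q := emitSym c l) (by simp)).mono
        (n := (c s).size + 2 + (s :: l).length) (by simp [Tree.size])
      simpa [emitSym] using h
    · have := ih (by simpa [h] using hs)
      exact (this.ite_false (by simp [h])).mono (by simp only [List.length_cons]; omega)

/-- Move the input to the main stack, as a tree. -/
def readInput [DecidableEq S] (c : S → Tree) (l : List S) : TProg S :=
  .seq popInp (.seq (.loop (fun v => v.1.isSome) (.seq (emitSym c l) popInp))
    (.seq (pushBits [false]) (flush .w)))

/-- The code of a list of trees is a `true` before each element and one final `false`, so it can be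
written symbol by symbol. It is collected backwards on the buffer, and the final flush restores the
order. The factor `l.length` pays for the search of each symbol in the table of the alphabet. -/
theorem leads_readInput [DecidableEq S] (c : S → Tree) (l : List S) (hl : ∀ s, s ∈ l) (i : List S) (v f) :
    ∃ v', Leads (readInput c l) v (stk i f [] []) v'
      (stk [] (Function.update f Val.w ((inputTree c i).code ++ f Val.w)) [] [])
      (l.length * i.length + 8 * (inputTree c i).size + 10) := by
  have key : ∀ (i : List S) o t, ∃ v',
      Leads (.seq (.loop (fun v => v.1.isSome) (.seq (emitSym c l) popInp)) (pushBits [false]))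
        (i.head?, o) (stk i.tail f t []) v'
        (stk [] f ((inputTree c i).code.reverse ++ t) [])
        (l.length * i.length + 4 * (inputTree c i).size) := by
    intro i
    induction i with
    | nil =>
      intro o t
      exact ⟨_, ((Leads.loop_false rfl).seq (leads_pushBits [false] _ _ _ _ _)).mono (by
        simp [inputTree, listTree])⟩
    | cons s i ih =>
      intro o t
      obtain ⟨v', m, hm, e⟩ := ih o ((c s).code.reverse ++ true :: t)
      cases e with
      | @seq _ _ _ _ v₁ S₁ _ _ a b e₁ e₂ =>
        refine ⟨v', ?_⟩
        have h₁ := Leads.loop_true (b := fun v : Reg S => v.1.isSome) rfl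
          ((leads_emitSym c s l (hl s) o i f t []).seq (leads_popInp (some s, o) i f _ []))
          ⟨a, le_rfl, e₁⟩
        have h₂ : Leads (pushBits [false]) v₁ S₁ v' _ b := ⟨b, le_rfl, e₂⟩
        have h₃ := h₁.seq h₂
        simp only [inputTree, List.map_cons, listTree, Tree.code, List.reverse_cons,
          List.reverse_append, List.append_assoc, List.cons_append, List.nil_append] at h₃ ⊢
        refine h₃.mono ?_
        simp only [Tree.size_cons, List.length_cons, inputTree] at hm ⊢
        have := Tree.one_le_size (c s)
        ring_nf at hm ⊢
        omega
  obtain ⟨v', m, hm, e⟩ := key i v.2 []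
  cases e with
  | @seq _ _ _ _ v₁ S₁ _ _ a b e₁ e₂ =>
    have h₁ : Leads (.loop (fun v => v.1.isSome) (.seq (emitSym c l) popInp)) _ _ v₁ S₁ a :=
      ⟨a, le_rfl, e₁⟩
    have h₂ : Leads (pushBits [false]) v₁ S₁ v' _ b := ⟨b, le_rfl, e₂⟩
    have h₃ := leads_flush Val.w ([] : List S) ((inputTree c i).code.reverse ++ [])
      (v := v') (f := f) (c := [])
    refine ⟨_, ((leads_popInp v i f [] []).seq (h₁.seq (h₂.seq (by simpa using h₃)))).mono ?_⟩
    simp only [Tree.size] at *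
    omega

/-- Move the answer to the output stack and clear the main stack. -/
def writeAnswer : TProg S :=
  .seq (popVal .w) (.seq (putVal .a) (.loop (fun v => v.2.1.isSome) (popVal .w)))

/-- The first bit of the code of a Boolean is the Boolean itself. It goes to the output stack, and
the rest of the main stack, at most two bits, is discarded. -/
theorem leads_writeAnswer (b : Bool) (v : Reg S) (f) (hf : f Val.w = (Enc.enc b).code)
    (ha : f Val.a = []) (hb : f Val.b = []) :
    ∃ v', Leads writeAnswer v (stk [] f [] []) v'
      (stk [] (fun j => if j = Val.a then [b] else []) [] []) 10 := by
  have fin : ∀ g : Val → List Bool, (∀ j, g j = if j = Val.a then [b] else []) →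
      g = fun j => if j = Val.a then [b] else [] := fun g hg => funext hg
  cases b with
  | false =>
    have hw : f Val.w = [false] := hf
    have h := (leads_popVal .w v [] f [] []).seq ((leads_putVal .a _ _ _ _ _).seq
      (Leads.loop_true (b := fun v : Reg S => v.2.1.isSome) (by simp [hw]) (leads_popVal .w _ _ _ _ _) (Leads.loop_false (by simp [hw]))))
    refine ⟨(v.1, none, v.2.2), cast ?_ (h.mono (n := 10) (by norm_num))⟩
    congr 2
    · simp [hw]
    · apply fin
      rintro (_ | _ | _) <;> simp [hw, ha, hb]
  | true =>
    have hw : f Val.w = [true, false, false] := hf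
    have h := (leads_popVal .w v [] f [] []).seq ((leads_putVal .a _ _ _ _ _).seq
      (Leads.loop_true (b := fun v : Reg S => v.2.1.isSome) (by simp [hw]) (leads_popVal .w _ _ _ _ _)
      (Leads.loop_true (b := fun v : Reg S => v.2.1.isSome) (by simp [hw]) (leads_popVal .w _ _ _ _ _)
      (Leads.loop_true (b := fun v : Reg S => v.2.1.isSome) (by simp [hw]) (leads_popVal .w _ _ _ _ _)
        (Leads.loop_false (by simp [hw]))))))
    refine ⟨(v.1, none, v.2.2), cast ?_ (h.mono (n := 10) (by norm_num))⟩
    congr 2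
    · simp [hw]
    · apply fin
      rintro (_ | _ | _) <;> simp [hw, ha, hb]

/-- The Turing machine of a program. -/
noncomputable def machine [Fintype S] (p : TProg S) : FinTM2 where
  K := Stk
  k₀ := .inp
  k₁ := .val .a
  Γ := Alph S
  Λ := Option p.Lab
  main := some p.entry
  ΛFin := by
    have := p.finite_lab
    exact Fintype.ofFinite _
  σ := Reg S
  initialState := (none, none, none)
  Γk₀Fin := inferInstanceAs (Fintype S)
  m := fun l => match l with
    | none => .load (fun _ => (none, none, none)) .halt
    | some l => p.code some none l

/-- A halting configuration is required to have the initial state; the additional step is the one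
that resets the state and halts. -/
theorem machine_outputs [Fintype S] (p : TProg S) (i : List S) (b : Bool) (v' n)
    (h : Leads p (none, none, none) (stk i (fun _ => []) [] []) v'
      (stk [] (fun j => if j = Val.a then [b] else []) [] []) n) :
    Nonempty (TM2OutputsInTime (machine p) i (some [b]) (n + 1)) := by
  obtain ⟨m, hm, e⟩ := h
  have h₁ := e.steps (machine p).m some none (fun _ => rfl)
  have h₂ := h₁.trans (e := ⟨none, (none, none, none),
    stk [] (fun j => if j = Val.a then [b] else []) [] []⟩) (Steps.single rfl)
  have e₁ : initList (machine p) i =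
      ⟨some (some p.entry), (none, none, none), stk i (fun _ => []) [] []⟩ := by
    unfold initList
    congr 1
    funext k
    rcases k with _ | _ | _ | _ <;> rfl
  have e₂ : haltList (machine p) [b] = ⟨none, (none, none, none),
      stk [] (fun j => if j = Val.a then [b] else []) [] []⟩ := by
    unfold haltList
    congr 1
    funext k
    rcases k with _ | _ | _ | _ | _ | _ <;> rfl
  refine ⟨⟨⟨m + 1, ?_⟩, Nat.add_le_add_right hm 1⟩⟩
  simp only [Option.map_some, e₁, e₂]
  exact h₂

end Machine

theorem esize_list_le {α : Type} [Enc α] (M : ℕ) (l : List α) (h : ∀ a ∈ l, esize a ≤ M) :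
    esize l ≤ l.length * (M + 1) + 1 := by
  induction l with
  | nil => simp
  | cons a l ih =>
    have h₁ := h a (by simp)
    have h₂ := ih fun b hb => h b (by simp [hb])
    simp only [esize_cons, List.length_cons]
    ring_nf at *
    omega

/-- A problem decided by a polynomial time function of the encoded instance is in `P`. -/
theorem PT.inP {α S : Type} [Finite S] [Enc S] {f : List S → Bool} (hf : PT f)
    (enc : α → List S) (p : α → Prop) (h : ∀ a, f (enc a) = true ↔ p a) : InP enc p := by
  classical
  have := Fintype.ofFinite S
  obtain ⟨q, t, hq⟩ := hf
  obtain ⟨M, hM⟩ : ∃ M, ∀ s : S, esize s ≤ M := by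
    obtain ⟨M, hM⟩ := (Set.finite_range (fun s : S => esize s)).bddAbove
    exact ⟨M, fun s => hM ⟨s, rfl⟩⟩
  let l : List S := Finset.univ.toList
  let prog : TProg S := .seq (readInput Enc.enc l) (.seq (q S) writeAnswer)
  -- `M` bounds the size of the symbols, so `B` bounds the size of the input as a tree in terms of
  -- the length of the word.
  let B : ℕ[X] := X * C (M + 1) + 1
  have key : ∀ a, Nonempty (TM2OutputsInTime (machine prog) (enc a)
      (some [decide (p a)]) (eval (enc a).length (C l.length * X + 8 * B + 10 + t.comp B + 11))) := by
    intro a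
    obtain ⟨v₁, h₁⟩ := leads_readInput Enc.enc l (fun s => by simp [l]) (enc a) (none, none, none)
      (fun _ => [])
    obtain ⟨v₂, h₂⟩ := hq S (enc a) v₁ (Function.update (fun _ => []) Val.w
      ((Enc.enc (enc a)).code ++ [])) [] (by simp)
    obtain ⟨v₃, h₃⟩ := leads_writeAnswer (f (enc a)) v₂ (Function.update (Function.update
      (fun _ => []) Val.w ((Enc.enc (enc a)).code ++ [])) Val.w (codes [Enc.enc (f (enc a))] ++ []))
      (by simp) (by simp) (by simp)
    have e : f (enc a) = decide (p a) := by rw [Bool.eq_iff_iff, h a]; simp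
    have hs : esize (enc a) ≤ eval (enc a).length B := by
      have := esize_list_le M (enc a) (fun s _ => hM s)
      simpa [B] using this
    have ht := eval_nat_mono t hs
    rw [← e]
    have hfin := machine_outputs prog (enc a) (f (enc a)) v₃ _ ((h₁.seq (h₂.seq h₃)).mono (n :=
      eval (enc a).length (C l.length * X + 8 * B + 10 + t.comp B + 10)) ?_)
    · simpa [add_assoc] using hfin
    · simp only [eval_add, eval_mul, eval_C, eval_X, eval_ofNat, eval_comp]
      have : (inputTree Enc.enc (enc a)).size = esize (enc a) := rfl
      rw [this]
      omega
  refine ⟨{ tm := machine prog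
            inputAlphabet := Equiv.refl _
            outputAlphabet := Equiv.refl _
            time := C l.length * X + 8 * B + 10 + t.comp B + 11
            outputsFun := fun a => ?_ }⟩
  have e₁ : List.map (Equiv.refl S).invFun (enc a) = enc a := List.map_id _
  have := (key a).some
  rw [← e₁] at this
  simp only [List.length_map] at this
  exact cast (by congr) this

end StackProg

namespace StackProg

open Polynomial

/-! ### A library of polynomial time functions on lists -/

theorem foldr_append_eq_flatten {α : Type} (l : List (List α)) :
    l.foldr (fun a acc => a ++ acc) [] = l.flatten := by
  induction l with
  | nil => rfl
  | cons a l ih => simp [ih]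

theorem foldr_ite_eq_filter {α : Type} (p : α → Bool) (l : List α) :
    l.foldr (fun a acc => if p a then a :: acc else acc) [] = l.filter p := by
  induction l with
  | nil => rfl
  | cons a l ih => by_cases h : p a <;> simp [ih, h]

/-- Compare one element of a list with the head of another one. -/
def listEqStep {α : Type} [DecidableEq α] (acc : Bool × List α) (a : α) : Bool × List α :=
  (acc.1 && listCases acc.2 false fun b _ => decide (a = b), acc.2.tail)

/-- The second list is consumed in parallel with the first. The flag detects a mismatch or a second
list that is too short, and the final emptiness test one that is too long. -/
theorem foldl_listEqStep {α : Type} [DecidableEq α] (l : List α) : ∀ (m : List α) (b : Bool),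
    ((l.foldl listEqStep (b, m)).1 && (l.foldl listEqStep (b, m)).2.isEmpty) =
      (b && decide (l = m)) := by
  induction l with
  | nil => intro m b; cases m <;> simp
  | cons a l ih =>
    intro m b
    rw [List.foldl_cons, listEqStep, ih]
    cases m with
    | nil => simp [listCases]
    | cons c m => by_cases h : a = c <;> by_cases h' : l = m <;> simp [listCases, h, h']

section Lib

variable {α β γ δ : Type} [Enc α] [Enc β] [Enc γ] [Enc δ]

theorem esize_append (l m : List α) : esize (l ++ m) + 1 = esize l + esize m := by
  induction l with
  | nil => simp [Nat.add_comm]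
  | cons a l ih => simp only [List.cons_append, esize_cons]; omega

theorem esize_reverse (l : List α) : esize l.reverse = esize l := by
  induction l with
  | nil => rfl
  | cons a l ih =>
    have := esize_append l.reverse [a]
    simp only [List.reverse_cons, esize_cons, esize_nil] at *
    omega

theorem esize_sublist {l m : List α} (h : l.Sublist m) : esize l ≤ esize m := by
  induction h with
  | slnil => exact le_rfl
  | cons a _ ih => simp only [esize_cons]; omega
  | cons_cons a _ ih => simp only [esize_cons]; omega

theorem esize_le_of_mem {a : α} {l : List α} (h : a ∈ l) : esize a ≤ esize l := by
  induction l with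
  | nil => simp at h
  | cons b l ih =>
    rcases List.mem_cons.1 h with rfl | h
    · simp only [esize_cons]; omega
    · have := ih h
      simp only [esize_cons]; omega

theorem esize_bool_le (b : Bool) : esize b ≤ 3 := by cases b <;> simp [esize, Enc.enc]

theorem PT.reverse : PT (fun l : List α => l.reverse) := by
  have := PT.foldl (f := fun (_ : List α) (acc : List α) (a : α) => a :: acc) (l := fun l => l)
    (b := fun _ => []) ?_ PT.id (PT.const []) ?_
  · exact this.congr fun l => by simp
  · exact (PT.snd.comp PT.snd).cons (PT.fst.comp PT.snd)
  · refine ⟨X, fun c l₁ h => ?_⟩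
    have h₁ := esize_sublist h.sublist
    have h₂ := esize_reverse l₁
    simp only [List.foldl_flip_cons_eq_append', List.append_nil, eval_X]
    omega

theorem PT.foldr {f : γ → α → β → β} (hf : PT fun x : γ × α × β => f x.1 x.2.1 x.2.2)
    {l : γ → List α} {b : γ → β} (hl : PT l) (hb : PT b)
    (hbound : ∃ q : ℕ[X], ∀ c l₁, l₁ <:+ l c → esize (l₁.foldr (f c) (b c)) ≤ q.eval (esize c)) :
    PT (fun c => (l c).foldr (f c) (b c)) := by
  have := PT.foldl (f := fun c y a => f c a y) (l := fun c => (l c).reverse) (b := b)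
    ((hf.comp (PT.fst.pair ((PT.snd.comp PT.snd).pair (PT.fst.comp PT.snd)))))
    (PT.reverse.comp hl) hb ?_
  · exact this.congr fun c => by simp
  · obtain ⟨q, hq⟩ := hbound
    refine ⟨q, fun c l₁ h => ?_⟩
    have := hq c l₁.reverse (by rw [← List.reverse_reverse (l c)]; exact List.reverse_suffix.2 h)
    simpa using this

theorem PT.append {f g : γ → List α} (hf : PT f) (hg : PT g) : PT (fun c => f c ++ g c) := by
  have := PT.foldr (f := fun _ a acc => a :: acc) (l := f) (b := g)
    ((PT.fst.comp PT.snd).cons (PT.snd.comp PT.snd)) hf hg ?_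
  · exact this.congr fun c => by simp
  · obtain ⟨q, hq⟩ := hf.esize_le
    obtain ⟨r, hr⟩ := hg.esize_le
    refine ⟨q + r, fun c l₁ h => ?_⟩
    have h₁ := esize_sublist h.sublist
    have h₂ := esize_append l₁ (g c)
    have h₃ := hq c
    have h₄ := hr c
    have h₅ : l₁.foldr (fun a acc => a :: acc) (g c) = l₁ ++ g c := by simp
    rw [h₅, eval_add]
    omega

theorem PT.map {f : γ → α → β} {l : γ → List α} (hf : PT fun x : γ × α => f x.1 x.2) (hl : PT l) :
    PT (fun c => (l c).map (f c)) := by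
  have := PT.foldr (f := fun c a acc => f c a :: acc) (l := l) (b := fun _ => [])
    ((hf.comp (PT.fst.pair (PT.fst.comp PT.snd))).cons (PT.snd.comp PT.snd)) hl (PT.const []) ?_
  · exact this.congr fun c => by rw [List.map_eq_foldr]
  · obtain ⟨q, hq⟩ := hf.esize_le
    obtain ⟨r, hr⟩ := hl.esize_le
    refine ⟨r * (q.comp (X + r + 1) + 1) + 1, fun c l₁ h => ?_⟩
    rw [← List.map_eq_foldr]
    refine (esize_list_le (q.eval (esize c + r.eval (esize c) + 1)) _ ?_).trans ?_
    · intro b hb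
      obtain ⟨a, ha, rfl⟩ := List.mem_map.1 hb
      refine (hq (c, a)).trans (eval_nat_mono _ ?_)
      have h₁ := esize_le_of_mem (h.subset ha)
      have h₂ := hr c
      simp only [esize_pair]
      omega
    · have h₁ := (h.length_le.trans (length_le_esize (l c))).trans (hr c)
      simp only [eval_add, eval_mul, eval_comp, eval_X, eval_one, List.length_map]
      gcongr

theorem esize_flatten (l : List (List α)) : esize l.flatten ≤ esize l := by
  induction l with
  | nil => simp
  | cons a l ih =>
    have := esize_append a l.flatten
    simp only [List.flatten_cons, esize_cons]
    omega

theorem PT.flatten {l : γ → List (List α)} (hl : PT l) : PT (fun c => (l c).flatten) := by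
  have := PT.foldr (f := fun _ a acc => a ++ acc) (l := l) (b := fun _ => [])
    ((PT.fst.comp PT.snd).append (PT.snd.comp PT.snd)) hl (PT.const []) ?_
  · exact this.congr fun c => by rw [foldr_append_eq_flatten]
  · obtain ⟨r, hr⟩ := hl.esize_le
    refine ⟨r, fun c l₁ h => ?_⟩
    rw [foldr_append_eq_flatten]
    exact ((esize_flatten l₁).trans (esize_sublist h.sublist)).trans (hr c)

theorem PT.flatMap {f : γ → α → List β} {l : γ → List α} (hf : PT fun x : γ × α => f x.1 x.2)
    (hl : PT l) : PT (fun c => (l c).flatMap (f c)) :=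
  (PT.flatten (hf.map hl)).congr fun c => by rw [List.flatMap_def]

theorem PT.filter {f : γ → α → Bool} {l : γ → List α} (hf : PT fun x : γ × α => f x.1 x.2)
    (hl : PT l) : PT (fun c => (l c).filter (f c)) := by
  have := PT.foldr (f := fun c a acc => if f c a then a :: acc else acc) (l := l)
    (b := fun _ => []) ((hf.comp (PT.fst.pair (PT.fst.comp PT.snd))).ite
      ((PT.fst.comp PT.snd).cons (PT.snd.comp PT.snd)) (PT.snd.comp PT.snd)) hl (PT.const []) ?_
  · exact this.congr fun c => by rw [foldr_ite_eq_filter]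
  · obtain ⟨r, hr⟩ := hl.esize_le
    refine ⟨r, fun c l₁ h => ?_⟩
    rw [foldr_ite_eq_filter]
    exact (esize_sublist (List.filter_sublist.trans h.sublist)).trans (hr c)

theorem PT.any {f : γ → α → Bool} {l : γ → List α} (hf : PT fun x : γ × α => f x.1 x.2)
    (hl : PT l) : PT (fun c => (l c).any (f c)) := by
  have := PT.foldr (f := fun c a acc => f c a || acc) (l := l) (b := fun _ => false)
    ((hf.comp (PT.fst.pair (PT.fst.comp PT.snd))).or (PT.snd.comp PT.snd)) hl (PT.const false)
    ⟨3, fun c l₁ _ => by simpa using esize_bool_le _⟩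
  refine this.congr fun c => ?_
  induction l c with
  | nil => rfl
  | cons a l ih => simp [ih]

theorem PT.all {f : γ → α → Bool} {l : γ → List α} (hf : PT fun x : γ × α => f x.1 x.2)
    (hl : PT l) : PT (fun c => (l c).all (f c)) :=
  (PT.not (PT.any hf.not hl)).congr fun c => by rw [List.all_eq_not_any_not]

theorem PT.product {l : γ → List α} {m : γ → List β} (hl : PT l) (hm : PT m) :
    PT (fun c => l c ×ˢ m c) :=
  (PT.flatMap (f := fun c a => (m c).map fun b => (a, b)) (PT.map ((PT.snd.comp PT.fst).pair PT.snd)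
    (hm.comp PT.fst)) hl).congr fun _ => rfl

theorem PT.tail {l : γ → List α} (hl : PT l) : PT (fun c => (l c).tail) :=
  (PT.listCases (x := fun _ => []) (f := fun _ _ t => t) hl (PT.const [])
    (PT.snd.comp PT.snd)).congr fun c => by cases l c <;> rfl

theorem PT.isEmpty {l : γ → List α} (hl : PT l) : PT (fun c => (l c).isEmpty) :=
  (PT.listCases (x := fun _ => true) (f := fun _ _ _ => false) hl (PT.const true)
    (PT.const false)).congr fun c => by cases l c <;> rfl

/-! ### Numbers in unary -/

instance : Enc Unit := ⟨fun _ => .nil⟩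

/-- A unary number and a list of units have the same tree, so passing between them is the empty
program, and arithmetic becomes list manipulation. -/
theorem PT.replicate {n : γ → ℕ} (hn : PT n) : PT (fun c => List.replicate (n c) ()) := by
  have : PT (fun n : ℕ => List.replicate n ()) :=
    ⟨fun _ => .skip, 1, fun S a => by
      simpa [Enc.enc, List.map_replicate] using tr_skip [Enc.enc a]⟩
  exact this.comp hn

theorem PT.length {l : γ → List α} (hl : PT l) : PT (fun c => (l c).length) := by
  have h : PT (fun l : List Unit => l.length) :=
    ⟨fun _ => .skip, 1, fun S a => by
      simpa [Enc.enc, List.map_const'] using tr_skip [Enc.enc a]⟩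
  exact (h.comp (PT.map (f := fun _ _ => ()) (PT.const ()) hl)).congr fun c => by simp

theorem PT.add {m n : γ → ℕ} (hm : PT m) (hn : PT n) : PT (fun c => m c + n c) :=
  (PT.length (hm.replicate.append hn.replicate)).congr fun c => by simp

theorem PT.sub {m n : γ → ℕ} (hm : PT m) (hn : PT n) : PT (fun c => m c - n c) := by
  have e : ∀ (k : List Unit) (l : List Unit), (k.foldl (fun acc _ => acc.tail) l) = l.drop k.length := by
    intro k
    induction k with
    | nil => simp
    | cons a k ih => intro l; simp [ih]
  have := PT.foldl (f := fun _ acc _ => acc.tail) (l := fun c => List.replicate (n c) ())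
    (b := fun c => List.replicate (m c) ()) (PT.tail (PT.fst.comp PT.snd)) hn.replicate
    hm.replicate ?_
  · exact this.length.congr fun c => by rw [e]; simp
  · obtain ⟨q, hq⟩ := hm.replicate.esize_le
    refine ⟨q, fun c l₁ _ => ?_⟩
    rw [e]
    exact (esize_sublist (List.drop_sublist _ _)).trans (hq c)

theorem PT.le {m n : γ → ℕ} (hm : PT m) (hn : PT n) : PT (fun c => decide (m c ≤ n c)) :=
  (PT.isEmpty (hm.sub hn).replicate).congr fun c => by
    rw [Bool.eq_iff_iff]; simp; omega

theorem PT.min {m n : γ → ℕ} (hm : PT m) (hn : PT n) : PT (fun c => min (m c) (n c)) :=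
  (hm.sub (hm.sub hn)).congr fun c => by omega

theorem PT.max {m n : γ → ℕ} (hm : PT m) (hn : PT n) : PT (fun c => max (m c) (n c)) :=
  (hm.add (hn.sub hm)).congr fun c => by omega

theorem PT.sum {l : γ → List ℕ} (hl : PT l) : PT (fun c => (l c).sum) := by
  have := PT.foldr (f := fun _ a acc => a + acc) (l := l) (b := fun _ => 0)
    ((PT.fst.comp PT.snd).add (PT.snd.comp PT.snd)) hl (PT.const 0) ?_
  · exact this.congr fun c => by rw [List.sum_eq_foldr]
  · obtain ⟨q, hq⟩ := hl.esize_le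
    refine ⟨q, fun c l₁ h => ?_⟩
    refine le_trans ?_ ((esize_sublist h.sublist).trans (hq c))
    rw [← List.sum_eq_foldr]
    clear h
    induction l₁ with
    | nil => simp
    | cons a l₁ ih =>
      simp only [List.sum_cons, esize_cons, esize_nat] at *
      omega

/-! ### Equality tests and finite types -/

theorem esize_foldl_listEqStep [DecidableEq α] (l : List α) : ∀ (m : List α) (b : Bool),
    esize (l.foldl listEqStep (b, m)) ≤ esize m + 4 := by
  induction l with
  | nil =>
    intro m b
    have := esize_bool_le b
    simp only [List.foldl_nil, esize_pair]
    omega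
  | cons a l ih =>
    intro m b
    rw [List.foldl_cons, listEqStep]
    exact (ih _ _).trans (Nat.add_le_add_right (esize_sublist (List.tail_sublist m)) 4)

theorem PT.list_eq [DecidableEq α] (he : PT fun x : α × α => decide (x.1 = x.2)) :
    PT (fun x : List α × List α => decide (x.1 = x.2)) := by
  have hstep : PT (fun y : (List α × List α) × (Bool × List α) × α =>
      listEqStep y.2.1 y.2.2) := by
    have h₁ : PT (fun y : (List α × List α) × (Bool × List α) × α =>
        StackProg.listCases y.2.1.2 false fun b _ => decide (y.2.2 = b)) :=
      PT.listCases (l := fun y : (List α × List α) × (Bool × List α) × α => y.2.1.2)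
        (x := fun _ => false) (f := fun y b _ => decide (y.2.2 = b))
        (PT.snd.comp (PT.fst.comp PT.snd)) (PT.const false)
        (he.comp ((PT.snd.comp (PT.snd.comp PT.fst)).pair (PT.fst.comp PT.snd)))
    exact ((PT.fst.comp (PT.fst.comp PT.snd)).and h₁).pair
      (PT.tail (PT.snd.comp (PT.fst.comp PT.snd)))
  have h : PT (fun x : List α × List α => x.1.foldl listEqStep (true, x.2)) :=
    PT.foldl (f := fun _ acc a => listEqStep acc a) hstep PT.fst ((PT.const true).pair PT.snd)
      ⟨X + 4, fun c l₁ _ => (esize_foldl_listEqStep l₁ c.2 true).trans (by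
        obtain ⟨c₁, c₂⟩ := c
        simp only [esize_pair, eval_add, eval_X, eval_ofNat]
        omega)⟩
  exact ((PT.fst.comp h).and (PT.snd.comp h).isEmpty).congr fun x => by
    simpa using foldl_listEqStep x.1 x.2 true

/-- Compare the top tree with a fixed one. -/
def testTree {S : Type} : Tree → TProg S
  | .nil => caseTree (pushTree (Enc.enc true)) (.seq drop (.seq drop (pushTree (Enc.enc false))))
  | .cons x y => caseTree (pushTree (Enc.enc false)) (.seq (testTree x)
      (caseTree (.seq drop (pushTree (Enc.enc false))) (.seq drop (.seq drop (testTree y)))))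

-- The fixed tree is compiled into nested case distinctions. The time is linear in `x`, as each
-- discarded part of `x` is read once.
open Classical in
theorem tr_testTree (c : Tree) : ∃ k : ℕ, ∀ (S : Type) (x : Tree),
    Tr (testTree c : TProg S) [x] [Enc.enc (decide (x = c))] (k * x.size) := by
  induction c with
  | nil =>
    refine ⟨30, fun S x => ?_⟩
    cases x with
    | nil =>
      rw [testTree, decide_eq_true rfl]
      exact (Tr.caseTree_nil (tr_pushTree _ _)).mono (by simp [Enc.enc])
    | cons x y =>
      rw [testTree, decide_eq_false (by simp)]
      refine (Tr.caseTree_cons (((tr_drop x).frame [y]).seq ((tr_drop y).seq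
        (tr_pushTree _ _)))).mono ?_
      simp [Enc.enc]
      omega
  | cons c d ihc ihd =>
    obtain ⟨k, hk⟩ := ihc
    obtain ⟨l, hl⟩ := ihd
    refine ⟨k + l + 60, fun S x => ?_⟩
    cases x with
    | nil =>
      rw [testTree, decide_eq_false (by simp)]
      exact (Tr.caseTree_nil (tr_pushTree _ _)).mono (by simp [Enc.enc])
    | cons x y =>
      by_cases h : x = c
      · have h₁ := (hk S x).frame [y]
        rw [decide_eq_true h] at h₁
        have h₂ := hl S y
        have h₃ : decide (Tree.cons x y = Tree.cons c d) = decide (y = d) := by simp [h]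
        rw [h₃]
        refine (Tr.caseTree_cons (h₁.seq (Tr.caseTree_cons (((tr_drop .nil).frame [.nil, y]).seq
          (((tr_drop .nil).frame [y]).seq h₂))))).mono ?_
        simp only [Tree.size_cons, Tree.size_nil]
        ring_nf
        have := Nat.zero_le (k * y.size)
        have := Nat.zero_le (l * x.size)
        omega
      · have h₁ := (hk S x).frame [y]
        rw [decide_eq_false h] at h₁
        have h₃ : decide (Tree.cons x y = Tree.cons c d) = false := by simp [h]
        rw [h₃]
        refine (Tr.caseTree_cons (h₁.seq (Tr.caseTree_nil ((tr_drop y).seq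
          (tr_pushTree _ _))))).mono ?_
        simp only [Tree.size_cons, Enc.enc, Bool.false_eq_true, if_false, Tree.size_nil]
        ring_nf
        have := Nat.zero_le (k * y.size)
        have := Nat.zero_le (l * y.size)
        have := Nat.zero_le (l * x.size)
        omega

open Classical in
theorem PT.eq_const (hα : Function.Injective (Enc.enc : α → Tree)) (c : α) :
    PT (fun a : α => decide (a = c)) := by
  obtain ⟨k, hk⟩ := tr_testTree (Enc.enc c)
  refine ⟨fun S => testTree (Enc.enc c), C k * X, fun S a => ?_⟩
  have := hk S (Enc.enc a)
  simpa [hα.eq_iff, esize] using this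

/-- Table lookup: a cascade of comparisons with the finitely many elements. -/
theorem PT.of_finite [Finite α] (hα : Function.Injective (Enc.enc : α → Tree)) (f : α → β) :
    PT f := by
  classical
  rcases isEmpty_or_nonempty α with h | ⟨⟨a₀⟩⟩
  · exact ⟨fun _ => .skip, 0, fun _ a => isEmptyElim a⟩
  have := Fintype.ofFinite α
  have key : ∀ l : List α, ∃ g : α → β, PT g ∧ ∀ a ∈ l, g a = f a := by
    intro l
    induction l with
    | nil => exact ⟨fun _ => f a₀, PT.const _, by simp⟩
    | cons c l ih =>
      obtain ⟨g, hg, h⟩ := ih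
      refine ⟨fun a => if decide (a = c) then f c else g a,
        (PT.eq_const hα c).ite (PT.const _) hg, fun a ha => ?_⟩
      by_cases hc : a = c
      · simp [hc]
      · simpa [hc] using h a (by simpa [hc] using ha)
  obtain ⟨g, hg, h⟩ := key Finset.univ.toList
  exact hg.congr fun a => h a (by simp)

/-- A representation of a finite type. -/
@[reducible]
noncomputable def finEnc (α : Type) [Finite α] : Enc α := ⟨fun a => Enc.enc (Finite.equivFin α a).val⟩

theorem finEnc_injective (α : Type) [Finite α] : Function.Injective (finEnc α).enc := by
  intro a b h
  have h' : (Enc.enc (Finite.equivFin α a).val).size = (Enc.enc (Finite.equivFin α b).val).size :=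
    congrArg Tree.size h
  have h₁ := esize_nat (Finite.equivFin α a).val
  have h₂ := esize_nat (Finite.equivFin α b).val
  simp only [esize] at h₁ h₂
  exact (Finite.equivFin α).injective (Fin.ext (by omega))

theorem enc_bool_injective : Function.Injective (Enc.enc : Bool → Tree) := by
  intro a b; cases a <;> cases b <;> simp [Enc.enc]

theorem PT.bool_eq : PT (fun x : Bool × Bool => decide (x.1 = x.2)) :=
  (PT.ite (c := fun x : Bool × Bool => x.1) PT.fst PT.snd PT.snd.not).congr fun x => by
    rcases x with ⟨_ | _, _ | _⟩ <;> rfl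

end Lib

end StackProg

namespace MinEquiv

/-! ### Binary constraints and two-literal implications -/

/-- The kinds of constraints: `unit s` is `x = s`, `or s` is `x = s ∨ y = s`, `par d` is
`x ⊕ y = d`. -/
inductive Kind : Type
  | top
  | unit (s : Bool)
  | or (s : Bool)
  | imp
  | par (d : Bool)
  deriving DecidableEq, Fintype

/-- The truth table of a kind. -/
def Kind.holds : Kind → Bool → Bool → Bool
  | .top, _, _ => true
  | .unit s, a, _ => a == s
  | .or s, a, b => a == s || b == s
  | .imp, a, b => !a || b
  | .par d, a, b => xor a b == d

/-- A constraint between two variables. -/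
abbrev Con (V : Type) : Type := Kind × V × V

/-- A literal `x = b`. -/
abbrev Lit (V : Type) : Type := V × Bool

section

variable {V : Type}

/-- The constraint `c` holds under `α`. -/
def Holds (c : Con V) (α : V → Bool) : Prop := c.1.holds (α c.2.1) (α c.2.2) = true

/-- `α` satisfies all constraints of `φ`. -/
def Sat (φ : List (Con V)) (α : V → Bool) : Prop := ∀ c ∈ φ, Holds c α

/-- The literal `u` is true under `α`. -/
def IsTrue (u : Lit V) (α : V → Bool) : Prop := α u.1 = u.2

/-- The complementary literal. -/
def neg (u : Lit V) : Lit V := (u.1, !u.2)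

@[simp] theorem neg_neg (u : Lit V) : neg (neg u) = u := by simp [neg]

theorem neg_ne (u : Lit V) : neg u ≠ u := by
  rcases u with ⟨x, _ | _⟩ <;> simp [neg]

@[simp] theorem isTrue_neg (u : Lit V) (α : V → Bool) : IsTrue (neg u) α ↔ ¬ IsTrue u α := by
  cases h : α u.1 <;> cases h' : u.2 <;> simp [IsTrue, neg, h, h']

theorem eq_or_eq_neg {u v : Lit V} (h : u.1 = v.1) : u = v ∨ u = neg v := by
  rcases u with ⟨x, _ | _⟩ <;> rcases v with ⟨y, _ | _⟩ <;> simp_all [neg]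

/-- The implications between literals expressed by a constraint. -/
def conEdges (c : Con V) : List (Lit V × Lit V) :=
  [(false, false), (false, true), (true, false), (true, true)].flatMap fun p =>
    if c.1.holds p.1 p.2 then [] else
      [((c.2.1, p.1), (c.2.2, !p.2)), ((c.2.2, p.2), (c.2.1, !p.1))]

theorem mem_conEdges {c : Con V} {u v : Lit V} : (u, v) ∈ conEdges c ↔
    ∃ a b, c.1.holds a b = false ∧
      ((u = (c.2.1, a) ∧ v = (c.2.2, !b)) ∨ (u = (c.2.2, b) ∧ v = (c.2.1, !a))) := by
  simp only [conEdges, List.mem_flatMap]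
  constructor
  · rintro ⟨⟨a, b⟩, _, h⟩
    refine ⟨a, b, ?_⟩
    cases hk : c.1.holds a b <;> simp_all
  · rintro ⟨a, b, hk, h⟩
    refine ⟨(a, b), by cases a <;> cases b <;> simp, ?_⟩
    simpa [hk] using h

theorem neg_mem_conEdges {c : Con V} {u v : Lit V} (h : (u, v) ∈ conEdges c) :
    (neg v, neg u) ∈ conEdges c := by
  rw [mem_conEdges] at h ⊢
  obtain ⟨a, b, hk, ⟨rfl, rfl⟩ | ⟨rfl, rfl⟩⟩ := h
  · exact ⟨a, b, hk, Or.inr (by simp [neg])⟩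
  · exact ⟨a, b, hk, Or.inl (by simp [neg])⟩

theorem fst_of_mem_conEdges {c : Con V} {u v : Lit V} (h : (u, v) ∈ conEdges c) :
    (u.1 = c.2.1 ∧ v.1 = c.2.2) ∨ (u.1 = c.2.2 ∧ v.1 = c.2.1) := by
  obtain ⟨a, b, _, ⟨rfl, rfl⟩ | ⟨rfl, rfl⟩⟩ := mem_conEdges.1 h <;> simp

/-- A constraint is the conjunction of the two-literal clauses which exclude its falsifying pairs of
values, and such a clause is an implication together with its contrapositive. Unit constraints need
no separate treatment: they appear as two clauses with a dummy second variable. -/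
theorem holds_iff_edges {c : Con V} {α : V → Bool} :
    Holds c α ↔ ∀ u v, (u, v) ∈ conEdges c → IsTrue u α → IsTrue v α := by
  constructor
  · intro h u v huv hu
    obtain ⟨a, b, hk, ⟨rfl, rfl⟩ | ⟨rfl, rfl⟩⟩ := mem_conEdges.1 huv
    · simp only [IsTrue] at *
      subst hu
      by_contra hb
      have : α c.2.2 = b := by simpa using hb
      rw [← this, Bool.eq_false_iff] at hk
      exact hk h
    · simp only [IsTrue] at *
      subst hu
      by_contra hb
      have : α c.2.1 = a := by simpa using hb
      rw [← this, Bool.eq_false_iff] at hk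
      exact hk h
  · intro h
    by_contra hc
    have hc' : c.1.holds (α c.2.1) (α c.2.2) = false := by simpa [Holds] using hc
    have := h _ _ (mem_conEdges.2 ⟨_, _, hc', Or.inl ⟨rfl, rfl⟩⟩) rfl
    simp [IsTrue] at this

/-- Some constraint of `φ` expresses the implication from `u` to `v`. -/
def Edge (φ : List (Con V)) (u v : Lit V) : Prop := ∃ c ∈ φ, (u, v) ∈ conEdges c

theorem Edge.neg {φ : List (Con V)} {u v : Lit V} (h : Edge φ u v) : Edge φ (neg v) (neg u) :=
  let ⟨c, hc, h⟩ := h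
  ⟨c, hc, neg_mem_conEdges h⟩

/-- Chains of implications. -/
def Reach (φ : List (Con V)) : Lit V → Lit V → Prop := Relation.ReflTransGen (Edge φ)

theorem Reach.trans {φ : List (Con V)} {u v w : Lit V} (h₁ : Reach φ u v) (h₂ : Reach φ v w) :
    Reach φ u w :=
  Relation.ReflTransGen.trans h₁ h₂

theorem Reach.neg {φ : List (Con V)} {u v : Lit V} (h : Reach φ u v) :
    Reach φ (neg v) (neg u) := by
  induction h with
  | refl => exact .refl
  | tail _ h ih => exact .head h.neg ih

theorem Sat.edge {φ : List (Con V)} {α : V → Bool} (h : Sat φ α) {u v : Lit V} (he : Edge φ u v)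
    (hu : IsTrue u α) : IsTrue v α :=
  let ⟨c, hc, hcuv⟩ := he
  holds_iff_edges.1 (h c hc) u v hcuv hu

theorem Sat.reach {φ : List (Con V)} {α : V → Bool} (h : Sat φ α) {u v : Lit V}
    (hr : Reach φ u v) (hu : IsTrue u α) : IsTrue v α := by
  induction hr with
  | refl => exact hu
  | tail _ he ih => exact h.edge he ih

open Classical in
/-- Make all literals of `S` true, and keep `α` elsewhere. -/
noncomputable def override (S : Lit V → Prop) (α : V → Bool) (x : V) : Bool :=
  if S (x, true) then true else if S (x, false) then false else α x

theorem isTrue_override {S : Lit V → Prop} (hS : ∀ u, S u → ¬ S (neg u)) (α : V → Bool) {u : Lit V}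
    (hu : S u) : IsTrue u (override S α) := by
  rcases u with ⟨x, _ | _⟩
  · have : ¬ S (x, true) := hS _ hu
    simp [IsTrue, override, hu, this]
  · simp [IsTrue, override, hu]

theorem override_of_not {S : Lit V → Prop} {α : V → Bool} {x : V}
    (hx : ∀ b, ¬ S (x, b)) : override S α x = α x := by
  simp [override, hx]

/-- A consistent set of literals closed under implications never harms a constraint that it touches:
a true premise in `S` has its conclusion in `S`, and a false conclusion puts the negated premise
into `S`. So only the constraints untouched by `S` must already hold under `α`. -/
theorem sat_override {φ : List (Con V)} {S : Lit V → Prop} (hS : ∀ u, S u → ¬ S (neg u))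
    (hc : ∀ u v, S u → Edge φ u v → S v) {α : V → Bool}
    (hα : ∀ c ∈ φ, (∀ b, ¬ S (c.2.1, b)) → (∀ b, ¬ S (c.2.2, b)) → Holds c α) :
    Sat φ (override S α) := by
  intro c hcφ
  rw [holds_iff_edges]
  intro u v huv hu
  by_contra hv
  have h₁ : ∀ b, ¬ S (u.1, b) := by
    intro b hb
    have e : (u.1, b) = u := by
      have := isTrue_override hS α hb
      exact Prod.ext rfl (this.symm.trans hu)
    rw [e] at hb
    exact hv (isTrue_override hS α (hc u v hb ⟨c, hcφ, huv⟩))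
  have h₂ : ∀ b, ¬ S (v.1, b) := by
    intro b hb
    have e : (v.1, b) = neg v := by
      have := isTrue_override hS α hb
      have hv' : IsTrue (neg v) (override S α) := (isTrue_neg _ _).2 hv
      exact Prod.ext rfl (this.symm.trans hv')
    rw [e] at hb
    have := isTrue_override hS α (hc _ _ hb ⟨c, hcφ, neg_mem_conEdges huv⟩)
    exact (isTrue_neg _ _).1 this hu
  have h₃ : Holds c α := by
    rcases fst_of_mem_conEdges huv with ⟨e₁, e₂⟩ | ⟨e₁, e₂⟩
    · exact hα c hcφ (e₁ ▸ h₁) (e₂ ▸ h₂)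
    · exact hα c hcφ (e₂ ▸ h₂) (e₁ ▸ h₁)
  refine hv ?_
  simp only [IsTrue, override_of_not h₂]
  refine holds_iff_edges.1 h₃ u v huv ?_
  simpa only [IsTrue, override_of_not h₁] using hu

/-- All models which make `u` true make `v` true. -/
def Le (φ : List (Con V)) (u v : Lit V) : Prop :=
  ∀ α, Sat φ α → IsTrue u α → IsTrue v α

theorem Reach.le {φ : List (Con V)} {u v : Lit V} (h : Reach φ u v) : Le φ u v :=
  fun _ hα hu => hα.reach h hu

theorem Edge.le {φ : List (Con V)} {u v : Lit V} (h : Edge φ u v) : Le φ u v :=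
  fun _ hα hu => hα.edge h hu

theorem Le.refl (φ : List (Con V)) (u : Lit V) : Le φ u u := fun _ _ h => h

theorem Le.trans {φ : List (Con V)} {u v w : Lit V} (h₁ : Le φ u v) (h₂ : Le φ v w) : Le φ u w :=
  fun α hα hu => h₂ α hα (h₁ α hα hu)

theorem Le.neg {φ : List (Con V)} {u v : Lit V} (h : Le φ u v) : Le φ (neg v) (neg u) :=
  fun α hα hv => by
    rw [isTrue_neg] at hv ⊢
    exact fun hu => hv (h α hα hu)

theorem le_neg_iff {φ : List (Con V)} {u v : Lit V} : Le φ (neg v) (neg u) ↔ Le φ u v :=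
  ⟨fun h => by simpa using h.neg, Le.neg⟩

/-- If all three paths are missing, the literals reachable from `u` or from `neg v` form a
consistent closed set, by contraposition of paths. Overriding any model with it makes `u` true and
`v` false. The last two alternatives are the degenerate entailments with `u` impossible or `v`
forced. -/
theorem le_iff_reach {φ : List (Con V)} (hφ : ∃ α, Sat φ α) {u v : Lit V} :
    Le φ u v ↔ Reach φ u v ∨ Reach φ u (neg u) ∨ Reach φ (neg v) v := by
  obtain ⟨α, hα⟩ := hφ
  constructor
  · intro h
    by_contra! hn
    obtain ⟨h₁, h₂, h₃⟩ := hn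
    let S : Lit V → Prop := fun w => Reach φ u w ∨ Reach φ (neg v) w
    have hS : ∀ w, S w → ¬ S (neg w) := by
      rintro w (hw | hw) (hw' | hw')
      · exact h₂ (hw.trans (by simpa using hw'.neg))
      · exact h₁ (hw.trans (by simpa using hw'.neg))
      · exact h₁ (hw'.trans (by simpa using hw.neg))
      · exact h₃ (hw.trans (by simpa using hw'.neg))
    have hc : ∀ w z, S w → Edge φ w z → S z := by
      rintro w z (hw | hw) he
      · exact Or.inl (hw.tail he)
      · exact Or.inr (hw.tail he)
    have hs := sat_override hS hc (α := α) fun c hc _ _ => hα c hc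
    have hu := isTrue_override hS α (u := u) (Or.inl .refl)
    have hv := isTrue_override hS α (u := neg v) (Or.inr .refl)
    exact (isTrue_neg _ _).1 hv (h _ hs hu)
  · rintro (h | h | h) β hβ hu
    · exact hβ.reach h hu
    · exact absurd hu ((isTrue_neg _ _).1 (hβ.reach h hu))
    · by_contra hv
      exact hv (hβ.reach h ((isTrue_neg _ _).2 hv))

/-- The greedy proof for 2-SAT: extend a consistent closed set variable by variable. An undecided
variable has a literal that does not reach its own negation, and everything reachable from that
literal is compatible with what has been decided before. -/
theorem satisfiable_iff {φ : List (Con V)} : (∃ α, Sat φ α) ↔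
    ∀ c ∈ φ, ∀ x, x = c.2.1 ∨ x = c.2.2 →
      ¬ (Reach φ (x, true) (x, false) ∧ Reach φ (x, false) (x, true)) := by
  constructor
  · rintro ⟨α, hα⟩ _ _ x _ ⟨h₁, h₂⟩
    have h₁' := hα.reach h₁
    have h₂' := hα.reach h₂
    simp only [IsTrue] at h₁' h₂'
    cases h : α x <;> simp_all
  · intro h
    have key : ∀ vs : List V, (∀ x ∈ vs,
        ¬ (Reach φ (x, true) (x, false) ∧ Reach φ (x, false) (x, true))) →
        ∃ S : Lit V → Prop, (∀ u, S u → ¬ S (neg u)) ∧ (∀ u v, S u → Edge φ u v → S v) ∧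
          ∀ x ∈ vs, ∃ b, S (x, b) := by
      intro vs
      induction vs with
      | nil => exact fun _ => ⟨fun _ => False, by simp⟩
      | cons x vs ih =>
        intro hx
        obtain ⟨S, hS, hc, hvs⟩ := ih fun y hy => hx y (by simp [hy])
        by_cases hxS : ∃ b, S (x, b)
        · exact ⟨S, hS, hc, by simpa using ⟨by simpa using hxS, by simpa using hvs⟩⟩
        push Not at hxS
        obtain ⟨b, hb⟩ : ∃ b, ¬ Reach φ (x, b) (neg (x, b)) := by
          by_contra! hn
          exact hx x (by simp) ⟨hn true, hn false⟩
        have hcr : ∀ u v, S u → Reach φ u v → S v := by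
          intro u v hu h
          induction h with
          | refl => exact hu
          | tail _ he ih => exact hc _ _ ih he
        refine ⟨fun w => S w ∨ Reach φ (x, b) w, ?_, ?_, ?_⟩
        · rintro w (hw | hw) (hw' | hw')
          · exact hS w hw hw'
          · exact hxS (!b) (hcr _ _ hw (by simpa [MinEquiv.neg] using hw'.neg))
          · exact hxS (!b) (hcr _ _ hw' (by simpa [MinEquiv.neg] using hw.neg))
          · exact hb (hw.trans (by simpa using hw'.neg))
        · rintro w z (hw | hw) he
          · exact Or.inl (hc _ _ hw he)
          · exact Or.inr (hw.tail he)
        · intro y hy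
          rcases List.mem_cons.1 hy with rfl | hy
          · exact ⟨b, Or.inr .refl⟩
          · obtain ⟨d, hd⟩ := hvs y hy
            exact ⟨d, Or.inl hd⟩
    obtain ⟨S, hS, hc, hvs⟩ := key (φ.flatMap fun c => [c.2.1, c.2.2]) fun x hx => by
      obtain ⟨c, hcφ, hxc⟩ := List.mem_flatMap.1 hx
      exact h c hcφ x (by simpa using hxc)
    refine ⟨override S fun _ => true, sat_override hS hc fun c hcφ h₁ => ?_⟩
    obtain ⟨b, hb⟩ := hvs c.2.1 (List.mem_flatMap.2 ⟨c, hcφ, by simp⟩)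
    exact absurd hb (h₁ b)

end

end MinEquiv

namespace MinEquiv

/-! ### Counting the constraints which force variables -/

section

variable {V : Type}

/-- `u` is true in all models. -/
def Forced (φ : List (Con V)) (u : Lit V) : Prop := ∀ α, Sat φ α → IsTrue u α

theorem forced_iff_le {φ : List (Con V)} {u : Lit V} : Forced φ u ↔ Le φ (neg u) u := by
  constructor
  · exact fun h α hα _ => h α hα
  · intro h α hα
    by_contra hu
    exact hu (h α hα ((isTrue_neg _ _).2 hu))

theorem Forced.le {φ : List (Con V)} {u v : Lit V} (h : Forced φ u) (huv : Le φ u v) : Forced φ v :=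
  fun α hα => huv α hα (h α hα)

theorem not_forced_neg {φ : List (Con V)} (hφ : ∃ α, Sat φ α) {u : Lit V} (h : Forced φ u) :
    ¬ Forced φ (neg u) := fun h' =>
  let ⟨α, hα⟩ := hφ
  (isTrue_neg _ _).1 (h' α hα) (h α hα)

theorem sat_perm {φ ψ : List (Con V)} (h : φ.Perm ψ) (α : V → Bool) : Sat φ α ↔ Sat ψ α := by
  simp only [Sat, h.mem_iff]

theorem sat_cons {c : Con V} {φ : List (Con V)} {α : V → Bool} :
    Sat (c :: φ) α ↔ Holds c α ∧ Sat φ α := by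
  simp [Sat]

variable [DecidableEq V]

/-- The variables on which a constraint depends. -/
def supp (c : Con V) : Finset V :=
  match c.1 with
  | .top => ∅
  | .unit _ => {c.2.1}
  | _ => {c.2.1, c.2.2}

theorem holds_congr {c : Con V} {α β : V → Bool} (h : ∀ x ∈ supp c, α x = β x) :
    Holds c α ↔ Holds c β := by
  rcases c with ⟨_ | _ | _ | _ | _, x, y⟩ <;> simp_all [Holds, supp, Kind.holds]

theorem card_supp_le (c : Con V) : (supp c).card ≤ 2 := by
  rcases c with ⟨_ | _ | _ | _ | _, x, y⟩ <;> simp [supp, Finset.card_le_two]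

/-- If `c` depends on `x` alone, the value from a model works. With two distinct variables, every
binary kind tolerates any value of the other variable once `x` is chosen suitably. -/
theorem exists_holds_update {c : Con V} {x : V} (hx : x ∈ supp c) (hc : ∃ α, Holds c α)
    (β : V → Bool) : ∃ a, Holds c (Function.update β x a) := by
  by_cases hs : supp c = {x}
  · obtain ⟨α, hα⟩ := hc
    exact ⟨α x, (holds_congr (by simp [hs])).1 hα⟩
  · rcases c with ⟨_ | s | s | _ | d, y, z⟩
    · simp [supp] at hx
    · simp only [supp, Finset.mem_singleton] at hx
      simp [supp, hx] at hs
    all_goals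
      simp only [supp, Finset.mem_insert, Finset.mem_singleton] at hx
      have hyz : y ≠ z := by
        rintro rfl
        simp only [or_self] at hx
        simp [supp, hx] at hs
    · refine ⟨s, ?_⟩
      rcases hx with rfl | rfl <;> simp [Holds, Kind.holds]
    · rcases hx with rfl | rfl
      · exact ⟨false, by simp [Holds, Kind.holds]⟩
      · exact ⟨true, by simp [Holds, Kind.holds]⟩
    · rcases hx with rfl | rfl
      · exact ⟨xor d (β z), by simp [Holds, Kind.holds, hyz.symm]⟩
      · refine ⟨xor d (β y), ?_⟩
        simp only [Holds, Kind.holds, Function.update_of_ne hyz, Function.update_self]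
        cases d <;> cases β y <;> rfl

/-- `F` is the set of the variables which are forced by `φ`. -/
def IsForcedSet (φ : List (Con V)) (F : Finset V) : Prop := ∀ x, x ∈ F ↔ ∃ b, Forced φ (x, b)

theorem sat_update {φ : List (Con V)} {x : V} (hx : ∀ c ∈ φ, x ∉ supp c) {α : V → Bool} (a : Bool)
    (h : Sat φ α) : Sat φ (Function.update α x a) := fun c hc =>
  (holds_congr fun y hy => by
    rw [Function.update_of_ne]
    rintro rfl
    exact hx c hc hy).1 (h c hc)

theorem exists_mem_supp {φ : List (Con V)} (hφ : ∃ α, Sat φ α) {x : V} {b : Bool}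
    (hx : Forced φ (x, b)) : ∃ c ∈ φ, x ∈ supp c := by
  by_contra! h
  obtain ⟨α, hα⟩ := hφ
  have := hx _ (sat_update h (!b) hα)
  simp [IsTrue] at this

theorem exists_peel {φ : List (Con V)} (hφ : ∃ α, Sat φ α) {F : Finset V} (hF : IsForcedSet φ F)
    {x : V} (hx : x ∈ F) (hd : φ.countP (fun c => x ∈ supp c) ≤ 1) :
    ∃ c ψ, φ.Perm (c :: ψ) ∧ x ∈ supp c ∧ (∀ c' ∈ ψ, x ∉ supp c') := by
  obtain ⟨b, hb⟩ := (hF x).1 hx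
  obtain ⟨c, hc, hxc⟩ := exists_mem_supp hφ hb
  have hp := List.perm_cons_erase hc
  refine ⟨c, φ.erase c, hp, hxc, ?_⟩
  rw [hp.countP_eq, List.countP_cons_of_pos (by simpa using hxc)] at hd
  have : (φ.erase c).countP (fun c => x ∈ supp c) = 0 := by omega
  simpa [List.countP_eq_zero] using this

/-- Since `x` occurs only in `c`, each model of `ψ` becomes a model of `φ` by changing `x` alone. So
`c` says nothing about the other variables and can be charged to `x`. -/
theorem forced_peel {φ ψ : List (Con V)} {c : Con V} {x : V}
    (hφ : ∃ α, Sat φ α) (hp : φ.Perm (c :: ψ)) (hxc : x ∈ supp c)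
    (hx : ∀ c' ∈ ψ, x ∉ supp c') {y : V} (hy : y ≠ x) (b : Bool) :
    Forced φ (y, b) ↔ Forced ψ (y, b) := by
  obtain ⟨α, hα⟩ := hφ
  have hα' := sat_cons.1 ((sat_perm hp α).1 hα)
  constructor
  · intro h β hβ
    obtain ⟨a, ha⟩ := exists_holds_update hxc ⟨α, hα'.1⟩ β
    have := h _ ((sat_perm hp _).2 (sat_cons.2 ⟨ha, sat_update hx a hβ⟩))
    simpa [IsTrue, hy] using this
  · intro h β hβ
    exact h β (sat_cons.1 ((sat_perm hp β).1 hβ)).2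

/-- The constraint `c` depends on a variable in `F`. -/
abbrev Touches (F : Finset V) (c : Con V) : Prop := (supp c ∩ F).Nonempty

theorem erase_isForcedSet {φ ψ : List (Con V)} {c : Con V} {x : V} {F : Finset V}
    (hφ : ∃ α, Sat φ α) (hF : IsForcedSet φ F) (hp : φ.Perm (c :: ψ)) (hxc : x ∈ supp c)
    (hx : ∀ c' ∈ ψ, x ∉ supp c') : (∃ α, Sat ψ α) ∧ IsForcedSet ψ (F.erase x) := by
  obtain ⟨α, hα⟩ := hφ
  have hψ : ∃ α, Sat ψ α := ⟨α, (sat_cons.1 ((sat_perm hp α).1 hα)).2⟩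
  refine ⟨hψ, fun y => ?_⟩
  rw [Finset.mem_erase]
  by_cases hy : y = x
  · subst hy
    simp only [ne_eq, not_true_eq_false, false_and, false_iff, not_exists]
    intro b hb
    obtain ⟨c', hc', hyc⟩ := exists_mem_supp hψ hb
    exact hx c' hc' hyc
  · simp only [ne_eq, hy, not_false_eq_true, true_and, hF y]
    exact exists_congr fun b => forced_peel ⟨α, hα⟩ hp hxc hx hy b

theorem countP_touches_peel {φ ψ : List (Con V)} {c : Con V} {x : V} {F : Finset V} (hxF : x ∈ F)
    (hp : φ.Perm (c :: ψ)) (hxc : x ∈ supp c) (hx : ∀ c' ∈ ψ, x ∉ supp c') :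
    φ.countP (fun c => Touches F c) = ψ.countP (fun c => Touches (F.erase x) c) + 1 := by
  rw [hp.countP_eq, List.countP_cons_of_pos (by
    exact decide_eq_true (⟨x, Finset.mem_inter.2 ⟨hxc, hxF⟩⟩ : Touches F c))]
  congr 1
  refine List.countP_congr fun c' hc' => ?_
  have : supp c' ∩ F = supp c' ∩ F.erase x := by
    ext y
    simp only [Finset.mem_inter, Finset.mem_erase]
    refine and_congr_right fun hy => ⟨fun h => ⟨?_, h⟩, fun h => h.2⟩
    rintro rfl
    exact hx c' hc' hy
  simp [Touches, this]

theorem sum_degrees (φ : List (Con V)) (F : Finset V) :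
    ∑ x ∈ F, φ.countP (fun c => x ∈ supp c) = (φ.map fun c => (supp c ∩ F).card).sum := by
  induction φ with
  | nil => simp
  | cons c φ ih =>
    simp only [List.countP_cons, Finset.sum_add_distrib, ih, List.map_cons, List.sum_cons]
    rw [Nat.add_comm]
    congr 1
    simp [Finset.inter_comm]

theorem countP_eq_sum {α : Type} (p : α → Bool) (l : List α) :
    l.countP p = (l.map fun a => if p a then 1 else 0).sum := by
  induction l with
  | nil => rfl
  | cons a l ih => simp [List.countP_cons, ih, Nat.add_comm]

theorem two_mul_countP_touches (φ : List (Con V)) (F : Finset V) :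
    2 * φ.countP (fun c => Touches F c) =
      (φ.map fun c => if Touches F c then 2 else 0).sum := by
  rw [countP_eq_sum, ← List.sum_map_mul_left]
  simp

theorem card_inter_le (F : Finset V) (c : Con V) :
    (supp c ∩ F).card ≤ if Touches F c then 2 else 0 := by
  split_ifs with h
  · exact (Finset.card_le_card Finset.inter_subset_left).trans (card_supp_le c)
  · simpa [Touches, Finset.not_nonempty_iff_eq_empty] using h

theorem two_mul_card_le_sum {φ : List (Con V)} {F : Finset V}
    (h : ∀ x ∈ F, 2 ≤ φ.countP (fun c => x ∈ supp c)) :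
    2 * F.card ≤ (φ.map fun c => (supp c ∩ F).card).sum := by
  rw [← sum_degrees, Nat.mul_comm]
  simpa using Finset.card_nsmul_le_sum F _ 2 h

/-- At least one constraint is needed for each forced variable. -/
theorem card_forced_le (n : ℕ) : ∀ {φ : List (Con V)} {F : Finset V}, φ.length = n →
    (∃ α, Sat φ α) → IsForcedSet φ F → F.card ≤ φ.countP (fun c => Touches F c) := by
  induction n with
  | zero =>
    intro φ F hn hφ hF
    have : F = ∅ := by
      rw [Finset.eq_empty_iff_forall_notMem]
      intro x hx
      obtain ⟨b, hb⟩ := (hF x).1 hx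
      obtain ⟨c, hc, -⟩ := exists_mem_supp hφ hb
      rw [List.length_eq_zero_iff.1 hn] at hc
      simp at hc
    simp [this]
  | succ n ih =>
    intro φ F hn hφ hF
    -- Either some forced variable has degree one and is removed together with its constraint, or
    -- all have degree at least two. In the second case incidences decide: each forced variable has
    -- at least two, and each constraint contributes at most two.
    by_cases h : ∃ x ∈ F, φ.countP (fun c => x ∈ supp c) ≤ 1
    · obtain ⟨x, hx, hd⟩ := h
      obtain ⟨c, ψ, hp, hxc, hxψ⟩ := exists_peel hφ hF hx hd
      obtain ⟨hψ, hF'⟩ := erase_isForcedSet hφ hF hp hxc hxψ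
      have := ih (by have := hp.length_eq; simp at this; omega) hψ hF'
      rw [Finset.card_erase_of_mem hx] at this
      rw [countP_touches_peel hx hp hxc hxψ]
      omega
    · push Not at h
      have h₁ := two_mul_card_le_sum fun x hx => h x hx
      have h₂ := List.sum_le_sum fun c (_ : c ∈ φ) => card_inter_le F c
      rw [← two_mul_countP_touches] at h₂
      omega

/-- One more constraint is needed if all forced variables have the value `s`, and no constraint can
force a single variable to `s`. -/
theorem card_forced_lt (s : Bool) (n : ℕ) : ∀ {φ : List (Con V)} {F : Finset V}, φ.length = n →
    (∃ α, Sat φ α) → IsForcedSet φ F → F.Nonempty → (∀ x ∈ F, Forced φ (x, s)) →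
    (∀ c ∈ φ, c.1 ≠ .unit s ∧ c.1 ≠ .or s) → F.card + 1 ≤ φ.countP (fun c => Touches F c) := by
  induction n with
  | zero =>
    rintro φ F hn hφ hF ⟨x, hx⟩ - -
    obtain ⟨b, hb⟩ := (hF x).1 hx
    obtain ⟨c, hc, -⟩ := exists_mem_supp hφ hb
    rw [List.length_eq_zero_iff.1 hn] at hc
    simp at hc
  | succ n ih =>
    intro φ F hn hφ hF hne hs hk
    by_cases h : ∃ x ∈ F, φ.countP (fun c => x ∈ supp c) ≤ 1
    · obtain ⟨x, hx, hd⟩ := h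
      obtain ⟨c, ψ, hp, hxc, hxψ⟩ := exists_peel hφ hF hx hd
      obtain ⟨hψ, hF'⟩ := erase_isForcedSet hφ hF hp hxc hxψ
      have hcφ : c ∈ φ := hp.mem_iff.2 (by simp)
      -- The induction must not end with an empty set. If `x` were the only forced variable, the
      -- other variable of `c` would take both values in models. One of the values makes `c`
      -- compatible with `x = !s`, because `c` is neither `unit s` nor `or s`; this contradicts that
      -- `x` is forced.
      have hne' : (F.erase x).Nonempty := by
        by_contra hemp
        have hzF : ∀ z, z ≠ x → z ∉ F := fun z hz hzF =>
          hemp ⟨z, Finset.mem_erase.2 ⟨hz, hzF⟩⟩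
        have hcontra : ∀ β, Sat φ β → ¬ Holds c (Function.update β x !s) := by
          intro β hβ hc
          have h₁ := (sat_cons.1 ((sat_perm hp β).1 hβ)).2
          have := hs x hx _ ((sat_perm hp _).2 (sat_cons.2 ⟨hc, sat_update hxψ (!s) h₁⟩))
          simp [IsTrue] at this
        have hfree : ∀ z, z ≠ x → ∀ a, ∃ β, Sat φ β ∧ β z = a := by
          intro z hz a
          by_contra! hn
          refine hzF z hz ((hF z).2 ⟨!a, fun β hβ => ?_⟩)
          exact Bool.eq_not.2 (hn β hβ)
        obtain ⟨α, hα⟩ := hφ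
        have hαx : α x = s := hs x hx α hα
        have hαc := hα c hcφ
        have hkc := hk c hcφ
        rcases c with ⟨_ | t | t | _ | d, y, z⟩
        · simp [supp] at hxc
        · simp only [supp, Finset.mem_singleton] at hxc
          subst hxc
          simp only [Holds, Kind.holds, hαx, beq_iff_eq] at hαc
          exact hkc.1 (by rw [hαc])
        all_goals
          simp only [supp, Finset.mem_insert, Finset.mem_singleton] at hxc
        · have hts : t = !s := Bool.eq_not.2 fun e => hkc.2 (by rw [e])
          refine hcontra α hα ?_
          rcases hxc with rfl | rfl <;> simp [Holds, Kind.holds, hts]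
        · rcases eq_or_ne y z with rfl | hyz
          · refine hcontra α hα ?_
            simp [Holds, Kind.holds]
          · rcases hxc with rfl | rfl
            · obtain ⟨β, hβ, hz⟩ := hfree z hyz.symm true
              exact hcontra β hβ (by simp [Holds, Kind.holds, hyz.symm, hz])
            · obtain ⟨β, hβ, hz⟩ := hfree y hyz false
              exact hcontra β hβ (by simp [Holds, Kind.holds, hyz, hz])
        · rcases eq_or_ne y z with rfl | hyz
          · refine hcontra α hα ?_
            simpa [Holds, Kind.holds] using hαc
          · rcases hxc with rfl | rfl
            · obtain ⟨β, hβ, hz⟩ := hfree z hyz.symm (xor d !s)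
              refine hcontra β hβ ?_
              simp only [Holds, Kind.holds, Function.update_self, Function.update_of_ne hyz.symm, hz]
              cases d <;> cases s <;> rfl
            · obtain ⟨β, hβ, hz⟩ := hfree y hyz (xor d !s)
              refine hcontra β hβ ?_
              simp only [Holds, Kind.holds, Function.update_self, Function.update_of_ne hyz, hz]
              cases d <;> cases s <;> rfl
      have := ih (by have := hp.length_eq; simp at this; omega) hψ hF' hne'
        (fun y hy => (forced_peel hφ hp hxc hxψ (Finset.ne_of_mem_erase hy) s).1
          (hs y (Finset.mem_of_mem_erase hy)))
        (fun c' hc' => hk c' (hp.mem_iff.2 (by simp [hc'])))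
      rw [Finset.card_erase_of_mem hx] at this
      rw [countP_touches_peel hx hp hxc hxψ]
      have := Finset.card_pos.2 hne
      omega
    · push Not at h
      by_contra hlt
      have h₁ := two_mul_card_le_sum fun x hx => h x hx
      have h₂ := fun c (_ : c ∈ φ) => card_inter_le F c
      -- If the bound failed, the double count would be tight, so every constraint that touches `F`
      -- would have two distinct variables, both in `F`.
      have h₃ : ∀ c ∈ φ, Touches F c → (supp c ∩ F).card = 2 := by
        intro c hc ht
        by_contra hne2
        have h₄ := List.sum_lt_sum (l := φ) _ _ h₂ ⟨c, hc, by
          have := h₂ c hc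
          simp only [ht, if_true] at this ⊢
          omega⟩
        rw [← two_mul_countP_touches] at h₄
        omega
      obtain ⟨α, hα⟩ := hφ
      obtain ⟨x, hx⟩ := hne
      -- Then all of `F` can be flipped from `s` to `!s`: implications and equations between equal
      -- values survive, and `or` constraints have sign `!s`.
      have hflip : Sat φ fun y => if y ∈ F then !s else α y := by
        intro c hc
        by_cases ht : Touches F c
        · have hcard := h₃ c hc ht
          have hsub : supp c ⊆ F := by
            have := Finset.eq_of_subset_of_card_le (Finset.inter_subset_left (s₁ := supp c) (s₂ := F))
              (by rw [hcard]; exact card_supp_le c)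
            rw [← this]
            exact Finset.inter_subset_right
          have hαs : ∀ y ∈ supp c, α y = s := fun y hy => hs y (hsub hy) α hα
          have hαc := hα c hc
          have hkc := hk c hc
          rcases c with ⟨_ | t | t | _ | d, y, z⟩
          · simp [Holds, Kind.holds]
          · have : (supp ((Kind.unit t, y, z) : Con V) ∩ F).card ≤ 1 :=
              (Finset.card_le_card Finset.inter_subset_left).trans (by simp [supp])
            omega
          all_goals
            have hyF := hsub (show y ∈ _ by simp [supp])
            have hzF := hsub (show z ∈ _ by simp [supp])
            have hy := hαs y (by simp [supp])
            have hz := hαs z (by simp [supp])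
            simp only [Holds, Kind.holds, hyF, hzF, if_true, hy, hz] at hαc ⊢
          · have hts : t = !s := Bool.eq_not.2 fun e => hkc.2 (by rw [e])
            simp [hts]
          · cases s <;> rfl
          · simpa using hαc
        · refine (holds_congr fun y hy => ?_).1 (hα c hc)
          have : y ∉ F := fun hyF => ht ⟨y, Finset.mem_inter.2 ⟨hy, hyF⟩⟩
          simp [this]
      have := hs x hx _ hflip
      simp [IsTrue, hx] at this

end

end MinEquiv

namespace MinEquiv

/-! ### Counting the constraints within classes of equivalent literals -/

section

variable {V : Type}

/-- The literals `u` and `v` agree in all models. -/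
def Eqv (φ : List (Con V)) (u v : Lit V) : Prop := Le φ u v ∧ Le φ v u

theorem Eqv.refl (φ : List (Con V)) (u : Lit V) : Eqv φ u u := ⟨Le.refl φ u, Le.refl φ u⟩

theorem Eqv.symm {φ : List (Con V)} {u v : Lit V} (h : Eqv φ u v) : Eqv φ v u := ⟨h.2, h.1⟩

theorem Eqv.trans {φ : List (Con V)} {u v w : Lit V} (h₁ : Eqv φ u v) (h₂ : Eqv φ v w) :
    Eqv φ u w := ⟨h₁.1.trans h₂.1, h₂.2.trans h₁.2⟩

theorem Eqv.neg {φ : List (Con V)} {u v : Lit V} (h : Eqv φ u v) : Eqv φ (neg u) (neg v) :=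
  ⟨h.2.neg, h.1.neg⟩

/-- The variable `x` has different values in two models. -/
def Free (φ : List (Con V)) (x : V) : Prop := ∀ b, ¬ Forced φ (x, b)

theorem Free.not_forced {φ : List (Con V)} {u : Lit V} (h : Free φ u.1) : ¬ Forced φ u := h u.2

theorem Free.of_eqv {φ : List (Con V)} {u v : Lit V} (h : Free φ u.1) (huv : Eqv φ u v) :
    Free φ v.1 := by
  intro b hb
  rcases eq_or_eq_neg (u := (v.1, b)) (v := v) rfl with e | e <;> rw [e] at hb
  · exact h.not_forced (hb.le huv.2)
  · exact Free.not_forced (u := MinEquiv.neg u) h (hb.le huv.1.neg)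

/-- The variables `x` and `y` are equal in all models, or different in all models. -/
def Same (φ : List (Con V)) (x y : V) : Prop := ∃ a b, Eqv φ (x, a) (y, b)

theorem Eqv.same {φ : List (Con V)} {u v : Lit V} (h : Eqv φ u v) : Same φ u.1 v.1 := ⟨_, _, h⟩

theorem Same.symm {φ : List (Con V)} {x y : V} (h : Same φ x y) : Same φ y x :=
  let ⟨a, b, h⟩ := h
  ⟨b, a, h.symm⟩

theorem Same.exists_right {φ : List (Con V)} {x y : V} (h : Same φ x y) (b : Bool) :
    ∃ a, Eqv φ (x, a) (y, b) := by
  obtain ⟨a, b', h⟩ := h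
  rcases eq_or_eq_neg (u := (y, b)) (v := (y, b')) rfl with e | e
  · exact ⟨a, e ▸ h⟩
  · exact ⟨!a, by rw [e]; exact h.neg⟩

theorem Same.trans {φ : List (Con V)} {x y z : V} (h₁ : Same φ x y) (h₂ : Same φ y z) :
    Same φ x z := by
  obtain ⟨a, b, h⟩ := h₂
  obtain ⟨d, h'⟩ := h₁.exists_right a
  exact ⟨d, b, h'.trans h⟩

theorem Same.free {φ : List (Con V)} {x y : V} (h : Same φ x y) (hx : Free φ x) : Free φ y := by
  obtain ⟨a, b, h⟩ := h
  exact Free.of_eqv (u := (x, a)) hx h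

/-- For free variables the two degenerate alternatives of `le_iff_reach` would force a literal, so
every entailment is witnessed by a path. -/
theorem reach_of_le {φ : List (Con V)} (hφ : ∃ α, Sat φ α) {u v : Lit V} (hu : Free φ u.1)
    (hv : Free φ v.1) (h : Le φ u v) : Reach φ u v := by
  rcases (le_iff_reach hφ).1 h with h | h | h
  · exact h
  · exact absurd (forced_iff_le.2 (by simpa using h.le)) (Free.not_forced (u := neg u) hu)
  · exact absurd (forced_iff_le.2 h.le) hv.not_forced

/-- Along a chain between equivalent literals, all constraints are between literals equivalent to
them. -/
theorem reach_within {φ : List (Con V)} {r u v : Lit V} (hu : Eqv φ u r) (hv : Eqv φ v r)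
    (h : Reach φ u v) :
    Relation.ReflTransGen (fun a b => Eqv φ a r ∧ Eqv φ b r ∧ Edge φ a b) u v := by
  induction h using Relation.ReflTransGen.head_induction_on with
  | refl => exact .refl
  | @head a b hab hbv ih =>
    -- A literal on the path is squeezed between two literals of the class.
    have hb : Eqv φ b r := ⟨(Reach.le hbv).trans hv.1, hu.2.trans hab.le⟩
    exact .head ⟨hu, hb, hab⟩ (ih hb)

theorem forced_of_unit {φ : List (Con V)} {c : Con V} (hc : c ∈ φ) {s : Bool}
    (hk : c.1 = .unit s) : Forced φ (c.2.1, s) := fun α hα => by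
  have := hα c hc
  simpa [Holds, hk, Kind.holds, IsTrue] using this

theorem same_of_par {φ : List (Con V)} {c : Con V} (hc : c ∈ φ) {d : Bool}
    (hk : c.1 = .par d) : Same φ c.2.1 c.2.2 := by
  refine ⟨true, !d, fun α hα => ?_, fun α hα => ?_⟩ <;>
  · have := hα c hc
    simp only [Holds, hk, Kind.holds, IsTrue] at this ⊢
    revert this; clear hk
    generalize α c.2.1 = a
    generalize α c.2.2 = b
    revert a b d
    decide

/-- A constraint with edges between free variables that is not `par` is a two-literal clause. -/
theorem conEdges_eq {φ : List (Con V)} {c : Con V} (hc : c ∈ φ) {u v : Lit V}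
    (huv : (u, v) ∈ conEdges c) (hu : Free φ u.1) (hv : Free φ v.1) (hk : ∀ d, c.1 ≠ .par d) :
    (conEdges c).length = 2 ∧ ∀ a b, (a, b) ∈ conEdges c → (a = u ∧ b = v) ∨ (a = neg v ∧ b = neg u) := by
  have hx : Free φ c.2.1 := by
    rcases fst_of_mem_conEdges huv with ⟨e₁, e₂⟩ | ⟨e₁, e₂⟩
    · exact e₁ ▸ hu
    · exact e₂ ▸ hv
  rcases c with ⟨_ | s | s | _ | d, x, y⟩
  · simp [conEdges, Kind.holds] at huv
  · exact absurd (forced_of_unit hc rfl) (hx s)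
  · refine ⟨by cases s <;> simp [conEdges, Kind.holds], fun a b hab => ?_⟩
    cases s <;> simp [conEdges, Kind.holds] at huv hab <;>
    · rcases huv with ⟨rfl, rfl⟩ | ⟨rfl, rfl⟩ <;> rcases hab with ⟨rfl, rfl⟩ | ⟨rfl, rfl⟩ <;>
      simp [neg]
  · refine ⟨by simp [conEdges, Kind.holds], fun a b hab => ?_⟩
    simp [conEdges, Kind.holds] at huv hab
    rcases huv with ⟨rfl, rfl⟩ | ⟨rfl, rfl⟩ <;> rcases hab with ⟨rfl, rfl⟩ | ⟨rfl, rfl⟩ <;>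
      simp [neg]
  · exact absurd rfl (hk d)

/-- A list of pairs which connects all elements of `C` has at least `|C| - 1` elements. -/
theorem card_le_of_connected {N M : Type} [DecidableEq N] (C : Finset N) (I : List M)
    (f : M → N × N) (r : N)
    (h : ∀ g : N → N, (∀ c ∈ I, g (f c).1 = g (f c).2) → ∀ w ∈ C, g w = g r) :
    C.card ≤ I.length + 1 := by
  -- `g` labels connected components. Another edge merges at most two labels, so the number of
  -- labels on `C` decreases by at most one.
  have key : ∀ I : List M, ∃ g : N → N, (∀ c ∈ I, g (f c).1 = g (f c).2) ∧
      C.card ≤ (C.image g).card + I.length := by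
    intro I
    induction I with
    | nil => exact ⟨id, by simp, by simp⟩
    | cons c I ih =>
      obtain ⟨g, hg, hc⟩ := ih
      refine ⟨fun x => if g x = g (f c).1 then g (f c).2 else g x, ?_, ?_⟩
      · intro c' hc'
        rcases List.mem_cons.1 hc' with rfl | hc'
        · simp
        · simp only [hg c' hc']
      · have hsub : (C.image g).erase (g (f c).1) ⊆
            C.image fun x => if g x = g (f c).1 then g (f c).2 else g x := by
          intro y hy
          obtain ⟨hne, hy⟩ := Finset.mem_erase.1 hy
          obtain ⟨x, hx, rfl⟩ := Finset.mem_image.1 hy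
          exact Finset.mem_image.2 ⟨x, hx, by simp [hne]⟩
        have h₁ := Finset.card_le_card hsub
        have h₂ := Finset.pred_card_le_card_erase (s := C.image g) (a := g (f c).1)
        simp only [List.length_cons]
        omega
  obtain ⟨g, hg, hc⟩ := key I
  have : (C.image g).card ≤ 1 := by
    refine Finset.card_le_one.2 fun a ha b hb => ?_
    obtain ⟨x, hx, rfl⟩ := Finset.mem_image.1 ha
    obtain ⟨y, hy, rfl⟩ := Finset.mem_image.1 hb
    rw [h g hg x hx, h g hg y hy]
  omega

/-- Cut the path at its first visit to `u`; no edge of what remains starts at `u`. -/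
theorem reflTransGen_source_ne {N : Type} {R : N → N → Prop} {u v : N}
    (h : Relation.ReflTransGen R v u) : Relation.ReflTransGen (fun a b => a ≠ u ∧ R a b) v u := by
  induction h using Relation.ReflTransGen.head_induction_on with
  | refl => exact .refl
  | @head a b hab _ ih =>
    by_cases e : a = u
    · rw [e]
    · exact .head ⟨e, hab⟩ ih

open Classical in
/-- Both variables of `c` belong to the class of `r`. -/
noncomputable def intra (φ : List (Con V)) (r : V) (c : Con V) : Bool :=
  decide (Same φ c.2.1 r ∧ Same φ c.2.2 r)

theorem intra_of_edge {φ : List (Con V)} {r : V} {b : Bool} {c : Con V} {u v : Lit V}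
    (h : (u, v) ∈ conEdges c) (hu : Eqv φ u (r, b)) (hv : Eqv φ v (r, b)) : intra φ r c = true := by
  simp only [intra, decide_eq_true_eq]
  rcases fst_of_mem_conEdges h with ⟨e₁, e₂⟩ | ⟨e₁, e₂⟩
  · exact ⟨e₁ ▸ hu.same, e₂ ▸ hv.same⟩
  · exact ⟨e₂ ▸ hv.same, e₁ ▸ hu.same⟩

/-! ### Spanning trees and closed walks in a single class -/

section Class

variable {φ : List (Con V)} {r : V} {C : Finset (Lit V)}

theorem neg_notMem_class (hr : Free φ r)
    (hC : ∀ u, u ∈ C ↔ Eqv φ u (r, true)) {u : Lit V} (hu : u ∈ C) : neg u ∉ C := by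
  intro hn
  rw [hC] at hu hn
  have h := hu.trans hn.symm
  have : Free φ u.1 := Free.of_eqv (u := (r, true)) hr hu.symm
  exact this.not_forced (forced_iff_le.2 h.2)

/-- The class is connected by its internal implications, because paths between equivalent literals
do not leave it. This is the hypothesis of `card_le_of_connected`. -/
theorem const_on_class (hφ : ∃ α, Sat φ α) (hr : Free φ r) (hC : ∀ u, u ∈ C ↔ Eqv φ u (r, true))
    (g : Lit V → Lit V) (hg : ∀ c ∈ φ, ∀ u v, u ∈ C → v ∈ C → (u, v) ∈ conEdges c → g u = g v)
    {w : Lit V} (hw : w ∈ C) : g w = g (r, true) := by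
  rw [hC] at hw
  have hfw : Free φ w.1 := Free.of_eqv (u := (r, true)) hr hw.symm
  have := reach_within (Eqv.refl φ (r, true)) hw (reach_of_le hφ hr hfw hw.2)
  induction this with
  | refl => rfl
  | tail _ hab ih =>
    obtain ⟨ha, hb, c, hc, hcab⟩ := hab
    have hfa := Free.of_eqv (u := (r, true)) hr ha.symm
    rw [← ih ha hfa]
    exact (hg c hc _ _ ((hC _).2 ha) ((hC _).2 hb) hcab).symm

variable [DecidableEq V]

/-- The literal of `x` in `C`. -/
def litIn (C : Finset (Lit V)) (x : V) : Lit V := if (x, true) ∈ C then (x, true) else (x, false)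

theorem litIn_eq (hr : Free φ r) (hC : ∀ u, u ∈ C ↔ Eqv φ u (r, true))
    {u : Lit V} (hu : u ∈ C) : litIn C u.1 = u := by
  rcases u with ⟨x, _ | _⟩
  · have := neg_notMem_class hr hC hu
    simp only [neg, Bool.not_false] at this
    simp [litIn, this]
  · simp [litIn, hu]

/-- A class of `m` literals needs at least `m - 1` constraints. -/
theorem card_class_le (hφ : ∃ α, Sat φ α) (hr : Free φ r) (hC : ∀ u, u ∈ C ↔ Eqv φ u (r, true)) :
    C.card ≤ φ.countP (intra φ r) + 1 := by
  rw [List.countP_eq_length_filter]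
  refine card_le_of_connected C _ (fun c => (litIn C c.2.1, litIn C c.2.2)) (r, true)
    fun g hg w hw => const_on_class hφ hr hC g (fun c hc u v hu hv huv => ?_) hw
  have := hg c (List.mem_filter.2 ⟨hc, intra_of_edge huv ((hC u).1 hu) ((hC v).1 hv)⟩)
  rcases fst_of_mem_conEdges huv with ⟨e₁, e₂⟩ | ⟨e₁, e₂⟩
  · simpa only [← e₁, ← e₂, litIn_eq hr hC hu, litIn_eq hr hC hv] using this
  · simpa only [← e₁, ← e₂, litIn_eq hr hC hu, litIn_eq hr hC hv] using this.symm

/-- A class of `m` literals needs at least `m` constraints if one of them is a clause. -/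
theorem card_class_lt (hφ : ∃ α, Sat φ α) (hr : Free φ r) (hC : ∀ u, u ∈ C ↔ Eqv φ u (r, true))
    {c₀ : Con V} (hc₀ : c₀ ∈ φ) (hk : ∀ d, c₀.1 ≠ .par d) {u v : Lit V} (hu : u ∈ C) (hv : v ∈ C)
    (huv : (u, v) ∈ conEdges c₀) : C.card ≤ φ.countP (intra φ r) := by
  have hfree : ∀ w ∈ C, Free φ w.1 := fun w hw =>
    Free.of_eqv (u := (r, true)) hr ((hC w).1 hw).symm
  -- Within the class the clause acts only as the edge from `u` to `v`; its contrapositive lies in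
  -- the complementary class.
  have hone : ∀ a b, a ∈ C → (a, b) ∈ conEdges c₀ → a = u ∧ b = v := by
    intro a b ha hab
    rcases (conEdges_eq hc₀ huv (hfree u hu) (hfree v hv) hk).2 a b hab with h | ⟨rfl, rfl⟩
    · exact h
    · exact absurd ha (neg_notMem_class hr hC hv)
  have hc₀I : c₀ ∈ φ.filter (intra φ r) :=
    List.mem_filter.2 ⟨hc₀, intra_of_edge huv ((hC u).1 hu) ((hC v).1 hv)⟩
  rw [List.countP_eq_length_filter, ← Nat.sub_add_cancel (List.length_pos_of_mem hc₀I),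
    ← List.length_erase_of_mem hc₀I]
  refine card_le_of_connected C _ (fun c => (litIn C c.2.1, litIn C c.2.2)) (r, true)
    fun g hg w hw => ?_
  have hother : ∀ c ∈ φ, c ≠ c₀ → ∀ a b, a ∈ C → b ∈ C → (a, b) ∈ conEdges c → g a = g b := by
    intro c hc hne a b ha hb hab
    have := hg c ((List.mem_erase_of_ne hne).2
      (List.mem_filter.2 ⟨hc, intra_of_edge hab ((hC a).1 ha) ((hC b).1 hb)⟩))
    rcases fst_of_mem_conEdges hab with ⟨e₁, e₂⟩ | ⟨e₁, e₂⟩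
    · simpa only [← e₁, ← e₂, litIn_eq hr hC ha, litIn_eq hr hC hb] using this
    · simpa only [← e₁, ← e₂, litIn_eq hr hC ha, litIn_eq hr hC hb] using this.symm
  -- The class stays connected without `c₀`: a path back from `v` to `u`, stopped on arrival at `u`,
  -- never uses the edge that leaves `u`. This saves one constraint over the spanning tree bound.
  have hvu : g v = g u := by
    have hu' := (hC u).1 hu
    have hv' := (hC v).1 hv
    have h := reflTransGen_source_ne (reach_within hv' hu' (reach_of_le hφ (hfree v hv) (hfree u hu)
      (hv'.trans hu'.symm).1))
    have key : ∀ x, Relation.ReflTransGen (fun a b => a ≠ u ∧ Eqv φ a (r, true) ∧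
        Eqv φ b (r, true) ∧ Edge φ a b) x u → g x = g u := by
      intro x h
      induction h using Relation.ReflTransGen.head_induction_on with
      | refl => rfl
      | @head a b hab _ ih =>
        obtain ⟨hne, ha, hb, c, hc, hcab⟩ := hab
        rw [← ih]
        refine hother c hc ?_ a b ((hC a).2 ha) ((hC b).2 hb) hcab
        rintro rfl
        exact hne (hone a b ((hC a).2 ha) hcab).1
    exact key v h
  refine const_on_class hφ hr hC g (fun c hc a b ha hb hab => ?_) hw
  by_cases hne : c = c₀
  · subst hne
    obtain ⟨rfl, rfl⟩ := hone a b ha hab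
    exact hvu.symm
  · exact hother c hc hne a b ha hb hab

end Class

end

end MinEquiv

namespace MinEquiv

/-! ### The cost of a class -/

/-- The number of constraints with kinds in `A` which are needed for a class of `p` equivalent
variables and `q` variables opposite to them. -/
def cost (A : Kind → Bool) (p q : ℕ) : ℕ :=
  if q = 0 then (if A (.par false) = true ∨ p ≤ 1 then p - 1 else p)
  else if A (.par true) = true then p + q - 1
  else if A .imp = true ∨ A (.par false) = true then p + q
  else 2 * max p q

section

variable {V : Type}

theorem snd_of_par {c : Con V} {d : Bool} (hk : c.1 = .par d) {u v : Lit V}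
    (h : (u, v) ∈ conEdges c) : v.2 = xor u.2 d := by
  obtain ⟨a, b, hab, h⟩ := mem_conEdges.1 h
  rw [hk] at hab
  clear hk
  rcases h with ⟨rfl, rfl⟩ | ⟨rfl, rfl⟩ <;> dsimp only <;> clear h <;> revert a b d <;> decide

theorem snd_of_or {c : Con V} {s : Bool} (hk : c.1 = .or s) {u v : Lit V}
    (h : (u, v) ∈ conEdges c) : u.2 = !s ∧ v.2 = s := by
  obtain ⟨a, b, hab, h⟩ := mem_conEdges.1 h
  rw [hk] at hab
  clear hk
  rcases h with ⟨rfl, rfl⟩ | ⟨rfl, rfl⟩ <;> dsimp only <;> clear h <;> revert a b s <;> decide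

/-- A two-coloured path whose ends have different colours has a step that changes colour in the same
direction. -/
theorem exists_step_of_ne {N : Type} {R : N → N → Prop} {f : N → Bool} {u v : N}
    (h : Relation.ReflTransGen R u v) (hf : f u ≠ f v) : ∃ a b, R a b ∧ f a = f u ∧ f b = f v := by
  induction h with
  | refl => exact absurd rfl hf
  | @tail b c hb hbc ih =>
    by_cases e : f b = f c
    · obtain ⟨a', b', h₁, h₂, h₃⟩ := ih (by rwa [e])
      exact ⟨a', b', h₁, h₂, h₃.trans e⟩
    · refine ⟨b, c, hbc, ?_, rfl⟩
      revert hf e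
      cases f u <;> cases f b <;> cases f c <;> simp

theorem card_le_countP [DecidableEq V] {M : Type} {l : List M} {p : M → Bool} (S : Finset V)
    (g : M → V) (h : ∀ x ∈ S, ∃ c ∈ l, p c = true ∧ g c = x) : S.card ≤ l.countP p := by
  rw [List.countP_eq_length_filter, ← List.length_map (f := g)]
  refine (Finset.card_le_card fun x hx => ?_).trans (List.toFinset_card_le _)
  obtain ⟨c, hc, hp, rfl⟩ := h x hx
  simp only [List.mem_toFinset, List.mem_map, List.mem_filter]
  exact ⟨c, ⟨hc, hp⟩, rfl⟩

variable [DecidableEq V]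

/-- The literals equivalent to `r`, from the variables with a given value of `r`. -/
def classLits (S : Bool → Finset V) : Finset (Lit V) :=
  (S true).image (fun x => (x, true)) ∪ (S false).image (fun x => (x, false))

theorem mem_classLits {S : Bool → Finset V} {u : Lit V} : u ∈ classLits S ↔ u.1 ∈ S u.2 := by
  rcases u with ⟨x, _ | _⟩ <;> simp [classLits]

theorem card_classLits (S : Bool → Finset V) :
    (classLits S).card = (S true).card + (S false).card := by
  rw [classLits, Finset.card_union_of_disjoint, Finset.card_image_of_injective _ (Prod.mk_left_injective _),
    Finset.card_image_of_injective _ (Prod.mk_left_injective _)]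
  rw [Finset.disjoint_left]
  simp

variable {φ : List (Con V)} {r : V} {S : Bool → Finset V}

theorem mem_classLits_iff (hS : ∀ t x, x ∈ S t ↔ Eqv φ (x, true) (r, t)) (u : Lit V) :
    u ∈ classLits S ↔ Eqv φ u (r, true) := by
  rw [mem_classLits, hS]
  rcases u with ⟨x, _ | _⟩
  · exact ⟨fun h => h.neg, fun h => h.neg⟩
  · exact Iff.rfl

/-- Without implications, equations and XOR, every edge inside the class is an `or` and changes the
sign of the literal. Each literal needs an incoming and an outgoing edge, and these have different
kinds. A constraint of either kind has one variable on each side, so each kind occurs at least as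
often as the larger side has elements. -/
theorem two_mul_max_le (hφ : ∃ α, Sat φ α) (hr : Free φ r)
    (hS : ∀ t x, x ∈ S t ↔ Eqv φ (x, true) (r, t)) (hne : (S false).Nonempty)
    (hk : ∀ c ∈ φ, c.1 ≠ .imp ∧ ∀ d, c.1 ≠ .par d) :
    2 * max (S true).card (S false).card ≤ φ.countP (intra φ r) := by
  have hC := mem_classLits_iff hS
  have hfree : ∀ w ∈ classLits S, Free φ w.1 := fun w hw =>
    Free.of_eqv (u := (r, true)) hr ((hC w).1 hw).symm
  have hr' : r ∈ S true := (hS true r).2 (Eqv.refl _ _)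
  have hex : ∀ t, ∃ y, y ∈ S t := by
    rintro (_ | _)
    · exact hne
    · exact ⟨r, hr'⟩
  have hor : ∀ a b, a ∈ classLits S → b ∈ classLits S → Edge φ a b →
      ∃ c ∈ φ, (a, b) ∈ conEdges c ∧ intra φ r c = true ∧ ∃ s, c.1 = .or s ∧ a.2 = !s ∧ b.2 = s := by
    rintro a b ha hb ⟨c, hc, hab⟩
    have hx : Free φ c.2.1 := by
      rcases fst_of_mem_conEdges hab with ⟨e₁, e₂⟩ | ⟨e₁, e₂⟩
      · exact e₁ ▸ hfree a ha
      · exact e₂ ▸ hfree b hb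
    refine ⟨c, hc, hab, intra_of_edge hab ((hC a).1 ha) ((hC b).1 hb), ?_⟩
    obtain ⟨h₁, h₂⟩ := hk c hc
    rcases hcc : c.1 with _ | s | s | _ | d
    · obtain ⟨a', b', h, -⟩ := mem_conEdges.1 hab
      simp [hcc, Kind.holds] at h
    · exact absurd (forced_of_unit hc hcc) (hx s)
    · exact ⟨s, rfl, snd_of_or hcc hab⟩
    · exact absurd hcc h₁
    · exact absurd hcc (h₂ d)
  have hdisj : ∀ t x, x ∈ S t → x ∉ S (!t) := by
    intro t x hx hx'
    have h₁ : (x, t) ∈ classLits S := mem_classLits.2 hx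
    have h₂ : (x, !t) ∈ classLits S := mem_classLits.2 hx'
    exact neg_notMem_class hr hC h₁ h₂
  -- A variable `x` on side `t` is recovered from its constraint as the unique variable on that
  -- side. For `s = t` the last edge of a path into `(x, t)` is used, for `s ≠ t` the first edge of
  -- a path out of it.
  have key : ∀ t s, (S t).card ≤ φ.countP fun c => intra φ r c && decide (c.1 = .or s) := by
    intro t s
    refine card_le_countP (S t) (fun c => if c.2.1 ∈ S t then c.2.1 else c.2.2) fun x hx => ?_
    obtain ⟨y, hy⟩ := hex !t
    have h₁ : (x, t) ∈ classLits S := mem_classLits.2 hx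
    have h₂ : (y, !t) ∈ classLits S := mem_classLits.2 hy
    have hwrap : ∀ a b, a ∈ classLits S → b ∈ classLits S → Edge φ a b → b.2 = s →
        (a = (x, t) ∨ b = (x, t)) →
        ∃ c ∈ φ, (intra φ r c && decide (c.1 = .or s)) = true ∧
          (if c.2.1 ∈ S t then c.2.1 else c.2.2) = x := by
      intro a b ha hb hab hbs h
      obtain ⟨c, hc, hab, hi, s', hcs, h₃, h₄⟩ := hor a b ha hb hab
      obtain rfl : s' = s := h₄.symm.trans hbs
      refine ⟨c, hc, by simp [hi, hcs], ?_⟩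
      have ha' := mem_classLits.1 ha
      have hb' := mem_classLits.1 hb
      rw [h₃] at ha'
      rw [h₄] at hb'
      rcases h with rfl | rfl
      · simp only at h₃
        subst h₃
        have hb'' : b.1 ∉ S (!s') := by simpa using hdisj _ _ hb'
        rcases fst_of_mem_conEdges hab with ⟨e₁, e₂⟩ | ⟨e₁, e₂⟩ <;> simp only at e₁
        · rw [← e₁, if_pos hx]
        · rw [← e₂, if_neg hb'', e₁]
      · simp only at h₄
        subst h₄
        have ha'' : a.1 ∉ S t := by simpa using hdisj _ _ ha'
        rcases fst_of_mem_conEdges hab with ⟨e₁, e₂⟩ | ⟨e₁, e₂⟩ <;> simp only at e₂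
        · rw [← e₁, if_neg ha'', e₂]
        · rw [← e₂, if_pos hx]
    have hxy := ((hC _).1 h₁).trans ((hC _).1 h₂).symm
    have hne : ((x, t) : Lit V) ≠ (y, !t) := by simp
    by_cases hst : s = t
    · have hw := reach_within ((hC _).1 h₂) ((hC _).1 h₁)
        (reach_of_le hφ (hfree _ h₂) (hfree _ h₁) hxy.2)
      rcases Relation.ReflTransGen.cases_tail hw with e | ⟨b, -, hb, hxb, he⟩
      · exact absurd e hne
      · exact hwrap b (x, t) ((hC _).2 hb) ((hC _).2 hxb) he hst.symm (Or.inr rfl)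
    · have hw := reach_within ((hC _).1 h₁) ((hC _).1 h₂)
        (reach_of_le hφ (hfree _ h₁) (hfree _ h₂) hxy.1)
      rcases Relation.ReflTransGen.cases_head hw with e | ⟨b, ⟨hxb, hb, he⟩, -⟩
      · exact absurd e hne
      · obtain ⟨c, hc, hab, -, s', hcs, h₃, h₄⟩ := hor _ _ h₁ ((hC _).2 hb) he
        refine hwrap (x, t) b h₁ ((hC _).2 hb) he ?_ (Or.inl rfl)
        rw [h₄]
        simp only at h₃
        revert hst
        rw [h₃]
        cases s <;> cases s' <;> simp
  have hsum : φ.countP (fun c => intra φ r c && decide (c.1 = .or true)) +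
      φ.countP (fun c => intra φ r c && decide (c.1 = .or false)) ≤ φ.countP (intra φ r) := by
    generalize intra φ r = f
    clear key hor hk hS hC hfree hr hφ
    induction φ with
    | nil => simp
    | cons c φ ih =>
      simp only [List.countP_cons]
      rcases hc : c.1 with _ | s | s | _ | d <;> try cases s
      all_goals cases f c <;> simp <;> omega
  have h₁ := key true true
  have h₂ := key true false
  have h₃ := key false true
  have h₄ := key false false
  omega

/-- The spanning tree bound always holds. It improves by one as soon as the class must contain an
edge that no available equation can provide: an edge between literals of equal sign without
equality, or of opposite sign without XOR. -/
theorem cost_le_countP {A : Kind → Bool} (hA : ∀ c ∈ φ, A c.1 = true) (hφ : ∃ α, Sat φ α)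
    (hr : Free φ r) (hS : ∀ t x, x ∈ S t ↔ Eqv φ (x, true) (r, t)) :
    cost A (S true).card (S false).card ≤ φ.countP (intra φ r) := by
  have hC := mem_classLits_iff hS
  have hfree : ∀ w ∈ classLits S, Free φ w.1 := fun w hw =>
    Free.of_eqv (u := (r, true)) hr ((hC w).1 hw).symm
  have hle := card_class_le hφ hr hC
  rw [card_classLits] at hle
  have hrS : (r, true) ∈ classLits S := (hC _).2 (Eqv.refl _ _)
  have hlt : ∀ a b, a ∈ classLits S → b ∈ classLits S → Edge φ a b →
      A (.par (xor a.2 b.2)) = false → (S true).card + (S false).card ≤ φ.countP (intra φ r) := by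
    rintro a b ha hb ⟨c, hc, hab⟩ hAp
    rw [← card_classLits]
    refine card_class_lt hφ hr hC hc ?_ ha hb hab
    intro d hd
    have := hA c hc
    rw [hd] at this
    have hab' := snd_of_par hd hab
    rw [hab', ← Bool.xor_assoc, Bool.xor_self, Bool.false_xor, this] at hAp
    simp at hAp
  by_cases hq : (S false).card = 0
  · have hall : ∀ u ∈ classLits S, u.2 = true := by
      rintro ⟨x, _ | _⟩ hu
      · rw [mem_classLits, Finset.card_eq_zero.1 hq] at hu
        simp at hu
      · rfl
    simp only [cost, hq, if_true]
    split_ifs with h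
    · omega
    · simp only [not_or, Bool.not_eq_true, not_le] at h
      obtain ⟨w, hw, hwr⟩ := Finset.exists_mem_ne h.2 r
      have hw' : (w, true) ∈ classLits S := mem_classLits.2 hw
      have := reach_within ((hC _).1 hw') (Eqv.refl _ _) (reach_of_le hφ (hfree _ hw') hr
        ((hC _).1 hw').1)
      rcases Relation.ReflTransGen.cases_head this with e | ⟨b, ⟨h₁, h₂, he⟩, -⟩
      · exact absurd (Prod.ext_iff.1 e).1 hwr
      · have := hlt _ _ hw' ((hC _).2 h₂) he (by simpa [hall b ((hC _).2 h₂)] using h.1)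
        omega
  · have hne : (S false).Nonempty := Finset.card_pos.1 (Nat.pos_of_ne_zero hq)
    simp only [cost, hq, if_false]
    split_ifs with h₁ h₂
    · omega
    · obtain ⟨y, hy⟩ := hne
      have hy' : (y, false) ∈ classLits S := mem_classLits.2 hy
      have := reach_within (Eqv.refl _ _) ((hC _).1 hy') (reach_of_le hφ hr (hfree _ hy')
        ((hC _).1 hy').2)
      obtain ⟨a, b, ⟨ha, hb, he⟩, h₃, h₄⟩ := exists_step_of_ne (f := Prod.snd) this (by simp)
      exact hlt a b ((hC _).2 ha) ((hC _).2 hb) he (by simpa [h₃, h₄] using h₁)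
    · refine two_mul_max_le hφ hr hS hne fun c hc => ⟨fun e => ?_, fun d e => ?_⟩
      · exact h₂ (Or.inl (e ▸ hA c hc))
      · cases d
        · exact h₂ (Or.inr (e ▸ hA c hc))
        · exact h₁ (e ▸ hA c hc)

end

end MinEquiv

namespace MinEquiv

/-! ### The number of constraints of an optimal formula -/

/-- Keep one element of each class. -/
def distinct {α : Type} (s : α → α → Bool) (l : List α) : List α :=
  l.foldr (fun x acc => if acc.any fun y => s x y then acc else x :: acc) []

section

variable {α : Type} {s : α → α → Bool}

theorem distinct_cons (x : α) (l : List α) : distinct s (x :: l) =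
    if (distinct s l).any fun y => s x y then distinct s l else x :: distinct s l := rfl

theorem distinct_sublist (s : α → α → Bool) (l : List α) : (distinct s l).Sublist l := by
  induction l with
  | nil => exact .slnil
  | cons x l ih =>
    rw [distinct_cons]
    split_ifs
    · exact ih.cons _
    · exact ih.cons_cons _

theorem mem_of_mem_distinct {l : List α} {x : α} (h : x ∈ distinct s l) : x ∈ l := by
  induction l with
  | nil => exact h
  | cons y l ih =>
    rw [distinct_cons] at h
    split_ifs at h with hy
    · exact List.mem_cons_of_mem _ (ih h)
    · rcases List.mem_cons.1 h with rfl | h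
      · exact List.mem_cons_self
      · exact List.mem_cons_of_mem _ (ih h)

theorem pairwise_distinct (l : List α) : (distinct s l).Pairwise fun x y => s x y = false := by
  induction l with
  | nil => exact .nil
  | cons y l ih =>
    rw [distinct_cons]
    split_ifs with hy
    · exact ih
    · refine List.pairwise_cons.2 ⟨fun z hz => ?_, ih⟩
      simp only [List.any_eq_true, not_exists, not_and, Bool.not_eq_true] at hy
      exact hy z hz

theorem exists_mem_distinct {l : List α} {x : α} (h : x ∈ l) (hx : s x x = true) :
    ∃ y ∈ distinct s l, s x y = true := by
  induction l with
  | nil => simp at h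
  | cons z l ih =>
    rw [distinct_cons]
    rcases List.mem_cons.1 h with rfl | h
    · split_ifs with hy
      · simpa using hy
      · exact ⟨x, List.mem_cons_self, hx⟩
    · obtain ⟨y, hy, hxy⟩ := ih h
      split_ifs
      · exact ⟨y, hy, hxy⟩
      · exact ⟨y, List.mem_cons_of_mem _ hy, hxy⟩

end

section

variable {V : Type} (le : Lit V → Lit V → Bool) (vs : List V)

/-- The variables forced to `s`. -/
def forcedVars (s : Bool) : List V := vs.filter fun x => le (x, !s) (x, s)

/-- The variables which are not forced. -/
def freeVars : List V :=
  vs.filter fun x => !(le (x, true) (x, false) || le (x, false) (x, true))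

/-- Equivalence of literals. -/
def eqvLit (u v : Lit V) : Bool := le u v && le v u

/-- Equality of variables up to a negation. -/
def sameVar (x y : V) : Bool :=
  eqvLit le (x, true) (y, true) || eqvLit le (x, true) (y, false)

/-- Representatives of the classes of free variables. -/
def reps : List V := distinct (sameVar le) (freeVars le vs)

/-- The variables of the class of `r` which are equal to `r`, or opposite to it. -/
def side (r : V) (t : Bool) : List V :=
  (freeVars le vs).filter fun x => eqvLit le (x, true) (r, t)

/-- The strict order of literals. -/
def ltLit (u v : Lit V) : Bool := le u v && !le v u

/-- The literals of the representatives. -/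
def repLits : List (Lit V) := (reps le vs).product [true, false]

/-- The pairs of neighbours in the order of the literals of the representatives. -/
def covers : List (Lit V × Lit V) :=
  ((repLits le vs).product (repLits le vs)).filter fun p =>
    ltLit le p.1 p.2 && !(repLits le vs).any fun z => ltLit le p.1 z && ltLit le z p.2

/-- One constraint more than the number of forced variables is needed. -/
def needsExtra (A : Kind → Bool) : Bool :=
  [true, false].any fun s => (forcedVars le vs !s).isEmpty && !(forcedVars le vs s).isEmpty &&
    !(A (.unit s) || A (.or s))

/-- Twice the number of constraints of an optimal formula. -/
def twiceOpt (A : Kind → Bool) : ℕ :=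
  2 * ((forcedVars le vs true).length + (forcedVars le vs false).length +
    (if needsExtra le vs A then 1 else 0) +
    ((reps le vs).map fun r =>
      cost A (side le vs r true).length (side le vs r false).length).sum) +
    (covers le vs).length

end

/-- `le` decides the order of the literals of `φ`, and `vs` has all variables on which `φ`
depends. -/
structure Decides {V : Type} (φ : List (Con V)) (le : Lit V → Lit V → Bool) (vs : List V) :
    Prop where
  sat : ∃ α, Sat φ α
  le_iff : ∀ u v, le u v = true ↔ Le φ u v
  nodup : vs.Nodup
  mem_of_forced : ∀ x b, Forced φ (x, b) → x ∈ vs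
  mem_of_le : ∀ u v, Free φ u.1 → Free φ v.1 → Le φ u v → u ≠ v → u.1 ∈ vs ∧ v.1 ∈ vs

/-! ### Representatives of the classes and neighbours in their order -/

namespace Decides

variable {V : Type} {φ : List (Con V)} {le : Lit V → Lit V → Bool} {vs : List V}

theorem mem_forcedVars (h : Decides φ le vs) {s : Bool} {x : V} :
    x ∈ forcedVars le vs s ↔ Forced φ (x, s) := by
  simp only [forcedVars, List.mem_filter, h.le_iff, forced_iff_le, neg]
  exact ⟨fun h => h.2, fun h' => ⟨h.mem_of_forced x s (forced_iff_le.2 h'), h'⟩⟩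

theorem mem_freeVars (h : Decides φ le vs) {x : V} : x ∈ freeVars le vs ↔ x ∈ vs ∧ Free φ x := by
  simp only [freeVars, List.mem_filter, Free, forced_iff_le, neg, Bool.forall_bool]
  refine and_congr_right fun _ => ?_
  simp only [← h.le_iff, Bool.not_false, Bool.not_true]
  cases le (x, true) (x, false) <;> cases le (x, false) (x, true) <;> simp

theorem eqvLit_iff (h : Decides φ le vs) {u v : Lit V} : eqvLit le u v = true ↔ Eqv φ u v := by
  simp [eqvLit, Eqv, h.le_iff]

theorem ltLit_iff (h : Decides φ le vs) {u v : Lit V} :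
    ltLit le u v = true ↔ Le φ u v ∧ ¬ Le φ v u := by
  rw [ltLit, Bool.and_eq_true, Bool.not_eq_true', h.le_iff, ← h.le_iff v u, Bool.not_eq_true]

theorem sameVar_iff (h : Decides φ le vs) {x y : V} : sameVar le x y = true ↔ Same φ x y := by
  simp only [sameVar, Bool.or_eq_true, h.eqvLit_iff]
  constructor
  · rintro (h | h)
    · exact ⟨_, _, h⟩
    · exact ⟨_, _, h⟩
  · intro h
    obtain ⟨_ | _, h⟩ := h.symm.exists_right true
    · exact Or.inr h.symm
    · exact Or.inl h.symm

theorem mem_reps (h : Decides φ le vs) {r : V} (hr : r ∈ reps le vs) : r ∈ vs ∧ Free φ r :=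
  h.mem_freeVars.1 (mem_of_mem_distinct hr)

theorem pairwise_reps (h : Decides φ le vs) : (reps le vs).Pairwise fun x y => ¬ Same φ x y :=
  (pairwise_distinct _).imp fun {x y} hxy hs => by
    rw [h.sameVar_iff.2 hs] at hxy
    simp at hxy

theorem eq_of_same (h : Decides φ le vs) {r r' : V} (hr : r ∈ reps le vs) (hr' : r' ∈ reps le vs)
    (hs : Same φ r r') : r = r' := by
  by_contra hne
  have : Std.Symm fun x y => ¬ Same φ x y := ⟨fun x y hxy hyx => hxy hyx.symm⟩
  exact h.pairwise_reps.forall hr hr' hne hs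

theorem exists_rep (h : Decides φ le vs) {x : V} (hx : x ∈ vs) (hf : Free φ x) :
    ∃ r ∈ reps le vs, Same φ x r := by
  obtain ⟨r, hr, hs⟩ := exists_mem_distinct (s := sameVar le) (h.mem_freeVars.2 ⟨hx, hf⟩)
    (h.sameVar_iff.2 ⟨true, true, Eqv.refl _ _⟩)
  exact ⟨r, hr, h.sameVar_iff.1 hs⟩

theorem exists_repLit (h : Decides φ le vs) {u : Lit V} (hx : u.1 ∈ vs) (hf : Free φ u.1) :
    ∃ v, v.1 ∈ reps le vs ∧ Eqv φ u v := by
  obtain ⟨r, hr, hs⟩ := h.exists_rep hx hf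
  obtain ⟨t, ht⟩ := hs.symm.exists_right u.2
  exact ⟨(r, t), hr, ht.symm⟩

/-- Distinct representatives lie in different classes, and a literal equivalent to its own negation
would be forced. So on literals of representatives the order is antisymmetric. -/
theorem eq_of_eqv (h : Decides φ le vs) {u v : Lit V} (hu : u.1 ∈ reps le vs)
    (hv : v.1 ∈ reps le vs) (he : Eqv φ u v) : u = v := by
  rcases eq_or_eq_neg (h.eq_of_same hu hv he.same) with e | e
  · exact e
  · subst e
    exact absurd (forced_iff_le.2 he.1) (h.mem_reps hv).2.not_forced

theorem mem_side (h : Decides φ le vs) {r : V} (hr : r ∈ reps le vs) {t : Bool} {x : V} :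
    x ∈ side le vs r t ↔ Eqv φ (x, true) (r, t) := by
  obtain ⟨hr, hf⟩ := h.mem_reps hr
  simp only [side, List.mem_filter, h.eqvLit_iff, and_iff_right_iff_imp, h.mem_freeVars]
  intro hx
  have hfx : Free φ x := Free.of_eqv (u := (r, t)) hf hx.symm
  refine ⟨?_, hfx⟩
  by_cases e : ((x, true) : Lit V) = (r, t)
  · obtain rfl : x = r := (Prod.ext_iff.1 e).1
    exact hr
  · exact (h.mem_of_le (x, true) (r, t) hfx hf hx.1 e).1

theorem mem_repLits {u : Lit V} : u ∈ repLits le vs ↔ u.1 ∈ reps le vs := by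
  rcases u with ⟨x, _ | _⟩ <;> simp [repLits]

theorem mem_covers (h : Decides φ le vs) {a b : Lit V} : (a, b) ∈ covers le vs ↔
    a.1 ∈ reps le vs ∧ b.1 ∈ reps le vs ∧ (Le φ a b ∧ ¬ Le φ b a) ∧
      ∀ z : Lit V, z.1 ∈ reps le vs → ¬ ((Le φ a z ∧ ¬ Le φ z a) ∧ Le φ z b ∧ ¬ Le φ b z) := by
  simp only [covers, List.mem_filter, List.pair_mem_product, mem_repLits, Bool.and_eq_true,
    Bool.not_eq_true', List.any_eq_false, h.ltLit_iff, and_assoc]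

/-- There is no literal strictly between two neighbours. -/
theorem between_covers (h : Decides φ le vs) {a b : Lit V} (hab : (a, b) ∈ covers le vs)
    {z : Lit V} (h₁ : Le φ a z) (h₂ : Le φ z b) : Eqv φ z a ∨ Eqv φ z b := by
  obtain ⟨ha, hb, hlt, hz⟩ := h.mem_covers.1 hab
  have hfa := (h.mem_reps ha).2
  have hfb := (h.mem_reps hb).2
  by_contra! hn
  have h₃ : ¬ Le φ z a := fun h' => hn.1 ⟨h', h₁⟩
  have h₄ : ¬ Le φ b z := fun h' => hn.2 ⟨h₂, h'⟩
  -- A forced literal entails only forced ones and its negation entails everything, so it would not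
  -- be strictly between `a` and `b`.
  have hfz : Free φ z.1 := by
    intro b' hb'
    rcases eq_or_eq_neg (u := (z.1, b')) (v := z) rfl with e | e <;> rw [e] at hb'
    · exact h₄ fun α hα _ => hb' α hα
    · exact h₃ fun α hα hz => absurd hz ((isTrue_neg _ _).1 (hb' α hα))
  have hzv := (h.mem_of_le a z hfa hfz h₁ (by rintro rfl; exact h₃ h₁)).2
  obtain ⟨v, hv, hzv⟩ := h.exists_repLit hzv hfz
  exact hz v hv ⟨⟨h₁.trans hzv.1, fun h' => h₃ (hzv.1.trans h')⟩, hzv.2.trans h₂,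
    fun h' => h₄ (h'.trans hzv.2)⟩

theorem not_same_of_covers (h : Decides φ le vs) {a b : Lit V} (hab : (a, b) ∈ covers le vs) :
    ¬ Same φ a.1 b.1 := by
  obtain ⟨ha, hb, hlt, -⟩ := h.mem_covers.1 hab
  intro hs
  rcases eq_or_eq_neg (h.eq_of_same ha hb hs) with rfl | rfl
  · exact hlt.2 hlt.1
  · exact (h.mem_reps hb).2.not_forced (forced_iff_le.2 hlt.1)

theorem nodup_reps (h : Decides φ le vs) : (reps le vs).Nodup :=
  h.pairwise_reps.imp fun {x y} hxy (e : x = y) => hxy (e ▸ ⟨true, true, Eqv.refl _ _⟩)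

theorem nodup_covers (h : Decides φ le vs) : (covers le vs).Nodup := by
  have : (repLits le vs).Nodup := h.nodup_reps.product (by simp)
  exact (this.product this).filter _

/-- For neighbours, some constraint expresses the implication between literals equivalent to
them. -/
theorem exists_edge (h : Decides φ le vs) {a b : Lit V} (hab : (a, b) ∈ covers le vs) :
    ∃ a' b', Edge φ a' b' ∧ Eqv φ a' a ∧ Eqv φ b' b := by
  classical
  obtain ⟨ha, hb, hlt, -⟩ := h.mem_covers.1 hab
  have hr := reach_of_le h.sat (h.mem_reps ha).2 (h.mem_reps hb).2 hlt.1
  -- All literals of a path from `a` to `b` lie between them.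
  have hr' : Relation.ReflTransGen (fun z w => Le φ a z ∧ Le φ z b ∧ Le φ a w ∧ Le φ w b ∧ Edge φ z w)
      a b := by
    have key : ∀ z, Reach φ z b → Le φ a z → Relation.ReflTransGen
        (fun z w => Le φ a z ∧ Le φ z b ∧ Le φ a w ∧ Le φ w b ∧ Edge φ z w) z b := by
      intro z hz
      induction hz using Relation.ReflTransGen.head_induction_on with
      | refl => exact fun _ => .refl
      | @head z w hzw hwb ih =>
        intro haz
        have haw := haz.trans hzw.le
        have hwb := Reach.le hwb
        exact .head ⟨haz, hzw.le.trans hwb, haw, hwb, hzw⟩ (ih haw)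
    exact key a hr (Le.refl _ _)
  -- Colour the path by membership in the class of `a`. Beyond the step that leaves this class there
  -- is only the class of `b`.
  obtain ⟨z, w, ⟨h₁, h₂, h₃, h₄, he⟩, hz, hw⟩ := exists_step_of_ne (f := fun z => decide (Eqv φ z a)) hr'
    (by simp [Eqv, hlt.2, Le.refl])
  refine ⟨z, w, he, ?_, ?_⟩
  · simpa [Eqv.refl] using hz
  · rcases h.between_covers hab h₃ h₄ with h' | h'
    · have hba : ¬ Eqv φ b a := fun h' => hlt.2 h'.1
      rw [decide_eq_true h', decide_eq_false hba] at hw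
      simp at hw
    · exact h'

end Decides

end MinEquiv

namespace MinEquiv

/-! ### The lower bound -/

section

variable {V : Type} {φ : List (Con V)} {le : Lit V → Lit V → Bool} {vs : List V}

open Classical in
/-- The variables of `c` belong to different classes of free variables. -/
noncomputable def inter (φ : List (Con V)) (c : Con V) : Bool :=
  decide (Free φ c.2.1 ∧ Free φ c.2.2 ∧ ¬ Same φ c.2.1 c.2.2)

/-- A constraint between different classes is not an equation, so it has at most two edges. Each
pair of neighbours owns an edge between literals equivalent to its members, and different pairs own
different edges. -/
theorem length_covers_le (h : Decides φ le vs) :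
    (covers le vs).length ≤ 2 * φ.countP (inter φ) := by
  classical
  have hlen : ((φ.filter (inter φ)).flatMap conEdges).length ≤ 2 * φ.countP (inter φ) := by
    rw [List.length_flatMap, List.countP_eq_length_filter, Nat.mul_comm, ← smul_eq_mul,
      ← List.length_map (f := fun c => (conEdges c).length)]
    refine List.sum_le_card_nsmul _ 2 fun n hn => ?_
    obtain ⟨c, hc, rfl⟩ := List.mem_map.1 hn
    obtain ⟨hc, hi⟩ := List.mem_filter.1 hc
    simp only [inter, decide_eq_true_eq] at hi
    rcases he : conEdges c with _ | ⟨⟨u, v⟩, l⟩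
    · simp
    · have huv : (u, v) ∈ conEdges c := by simp [he]
      rw [← he]
      refine (conEdges_eq hc huv ?_ ?_ fun d hd => hi.2.2 (same_of_par hc hd)).1.le
      · rcases fst_of_mem_conEdges huv with e | e
        · exact e.1 ▸ hi.1
        · exact e.1 ▸ hi.2.1
      · rcases fst_of_mem_conEdges huv with e | e
        · exact e.2 ▸ hi.2.1
        · exact e.2 ▸ hi.1
  refine le_trans ?_ hlen
  have hex : ∀ p ∈ covers le vs, ∃ q ∈ (φ.filter (inter φ)).flatMap conEdges,
      Eqv φ q.1 p.1 ∧ Eqv φ q.2 p.2 := by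
    rintro ⟨a, b⟩ hab
    obtain ⟨a', b', ⟨c, hc, he⟩, h₁, h₂⟩ := h.exists_edge hab
    refine ⟨(a', b'), List.mem_flatMap.2 ⟨c, List.mem_filter.2 ⟨hc, ?_⟩, he⟩, h₁, h₂⟩
    obtain ⟨ha, hb, -, -⟩ := h.mem_covers.1 hab
    have hfa := Free.of_eqv (h.mem_reps ha).2 h₁.symm
    have hfb := Free.of_eqv (h.mem_reps hb).2 h₂.symm
    have hs : ¬ Same φ a'.1 b'.1 := fun hs =>
      h.not_same_of_covers hab ((h₁.symm.same.trans hs).trans h₂.same)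
    simp only [inter, decide_eq_true_eq]
    rcases fst_of_mem_conEdges he with ⟨e₁, e₂⟩ | ⟨e₁, e₂⟩
    · rw [← e₁, ← e₂]
      exact ⟨hfa, hfb, hs⟩
    · rw [← e₁, ← e₂]
      exact ⟨hfb, hfa, fun h => hs h.symm⟩
  choose! f hf₁ hf₂ hf₃ using hex
  rw [← List.toFinset_card_of_nodup h.nodup_covers]
  refine (Finset.card_le_card_of_injOn f (t := ((φ.filter (inter φ)).flatMap conEdges).toFinset)
    ?_ ?_).trans (List.toFinset_card_le _)
  · intro p hp
    simpa using hf₁ p (by simpa using hp)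
  · rintro ⟨a, b⟩ hp ⟨a', b'⟩ hq hpq
    have hp : (a, b) ∈ covers le vs := by simpa using hp
    have hq : (a', b') ∈ covers le vs := by simpa using hq
    have h₁ := hf₂ _ hp
    have h₂ := hf₃ _ hp
    rw [hpq] at h₁ h₂
    obtain ⟨ha, hb, -, -⟩ := h.mem_covers.1 hp
    obtain ⟨ha', hb', -, -⟩ := h.mem_covers.1 hq
    exact Prod.ext (h.eq_of_eqv ha ha' (h₁.symm.trans (hf₂ _ hq)))
      (h.eq_of_eqv hb hb' (h₂.symm.trans (hf₃ _ hq)))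

/-- Each element is counted at most once on the left: the properties `f`, `h` and the members of the
family `g` are mutually exclusive. -/
theorem countP_add_sum_add_countP_le {M R : Type} (l : List M) (rs : List R) (f h : M → Bool)
    (g : R → M → Bool) (hfh : ∀ c ∈ l, f c = true → h c = false)
    (hfg : ∀ c ∈ l, ∀ r ∈ rs, g r c = true → f c = false ∧ h c = false)
    (hg : ∀ c ∈ l, rs.Pairwise fun r r' => ¬ (g r c = true ∧ g r' c = true)) :
    l.countP f + (rs.map fun r => l.countP (g r)).sum + l.countP h ≤ l.length := by
  induction l with
  | nil => simp
  | cons c l ih =>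
    have h₁ := ih (fun c hc => hfh c (by simp [hc])) (fun c hc => hfg c (by simp [hc]))
      fun c hc => hg c (by simp [hc])
    have h₂ : (rs.map fun r => (c :: l).countP (g r)).sum =
        (rs.map fun r => l.countP (g r)).sum + rs.countP fun r => g r c := by
      simp only [List.countP_cons, List.sum_map_add, countP_eq_sum (fun r => g r c)]
    have h₃ : rs.countP (fun r => g r c) ≤ 1 := by
      have := hg c (by simp)
      clear ih h₁ h₂ hg hfg
      induction rs with
      | nil => simp
      | cons r rs ih =>
        rw [List.pairwise_cons] at this
        rw [List.countP_cons]
        split_ifs with hr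
        · have : rs.countP (fun r => g r c) = 0 :=
            List.countP_eq_zero.2 fun r' hr' h' => this.1 r' hr' ⟨hr, h'⟩
          omega
        · exact ih this.2
    have h₄ : 0 < rs.countP (fun r => g r c) → f c = false ∧ h c = false := by
      intro hpos
      obtain ⟨r, hr, hgr⟩ := List.countP_pos_iff.1 hpos
      exact hfg c (by simp) r hr hgr
    have h₅ := hfh c (by simp)
    rw [h₂]
    generalize rs.countP (fun r => g r c) = i at h₃ h₄ ⊢
    simp only [List.countP_cons, List.length_cons]
    cases hfc : f c <;> cases hhc : h c <;> simp [hfc, hhc] at h₄ h₅ ⊢ <;> omega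

/-- A formula with kinds in `A` has at least the optimal number of constraints. -/
theorem twiceOpt_le [DecidableEq V] (h : Decides φ le vs) {A : Kind → Bool}
    (hA : ∀ c ∈ φ, A c.1 = true) : twiceOpt le vs A ≤ 2 * φ.length := by
  have hnd : (forcedVars le vs true ++ forcedVars le vs false).Nodup := by
    refine List.nodup_append'.2 ⟨h.nodup.filter _, h.nodup.filter _, fun x hx hx' => ?_⟩
    exact not_forced_neg h.sat (h.mem_forcedVars.1 hx) (h.mem_forcedVars.1 hx')
  set F := (forcedVars le vs true ++ forcedVars le vs false).toFinset with hFdef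
  have hF : IsForcedSet φ F := by
    intro x
    simp [hFdef, h.mem_forcedVars, or_comm]
  have hcard : F.card = (forcedVars le vs true).length + (forcedVars le vs false).length := by
    rw [List.toFinset_card_of_nodup hnd, List.length_append]
  have h₁ : (forcedVars le vs true).length + (forcedVars le vs false).length +
      (if needsExtra le vs A then 1 else 0) ≤ φ.countP (fun c => Touches F c) := by
    rw [← hcard]
    split_ifs with hE
    · simp only [needsExtra, List.any_eq_true, Bool.and_eq_true, List.isEmpty_iff,
        Bool.not_eq_true', Bool.or_eq_false_iff] at hE
      obtain ⟨s, -, ⟨h₁, h₂⟩, h₃, h₄⟩ := hE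
      rw [← Bool.not_eq_true, List.isEmpty_iff] at h₂
      obtain ⟨x, hx⟩ := List.exists_mem_of_ne_nil _ h₂
      refine card_forced_lt s _ rfl h.sat hF ⟨x, (hF x).2 ⟨s, h.mem_forcedVars.1 hx⟩⟩ ?_ ?_
      · intro y hy
        obtain ⟨b, hb⟩ := (hF y).1 hy
        obtain rfl : b = s := by
          by_contra hbs
          have : b = !s := Bool.eq_not.2 hbs
          rw [this, ← h.mem_forcedVars, h₁] at hb
          simp at hb
        exact hb
      · intro c hc
        have hc := hA c hc
        constructor <;> intro e <;> simp_all
    · exact card_forced_le _ rfl h.sat hF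
  have h₂ : ((reps le vs).map fun r =>
      cost A (side le vs r true).length (side le vs r false).length).sum ≤
      ((reps le vs).map fun r => φ.countP (intra φ r)).sum := by
    refine List.sum_le_sum fun r hr => ?_
    have := cost_le_countP hA h.sat (h.mem_reps hr).2 (S := fun t => (side le vs r t).toFinset)
      fun t x => by rw [List.mem_toFinset, h.mem_side hr]
    have hs : ∀ t, (side le vs r t).Nodup := fun t => (h.nodup.filter _).filter _
    rwa [List.toFinset_card_of_nodup (hs true), List.toFinset_card_of_nodup (hs false)] at this
  have h₃ := length_covers_le h
  have hsupp : ∀ c : Con V, ∀ x ∈ supp c, x = c.2.1 ∨ x = c.2.2 := by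
    rintro ⟨_ | s | s | _ | d, y, z⟩ x hx <;> simp_all [supp]
  have htouch : ∀ c : Con V, Free φ c.2.1 → Free φ c.2.2 → ¬ Touches F c := by
    rintro c h₁ h₂ ⟨x, hx⟩
    rw [Finset.mem_inter, hF] at hx
    obtain ⟨b, hb⟩ := hx.2
    rcases hsupp c x hx.1 with rfl | rfl
    · exact h₁ b hb
    · exact h₂ b hb
  -- The three lower bounds concern disjoint sets of constraints: those that depend on a forced
  -- variable, those inside a single class and those between classes.
  have h₄ := countP_add_sum_add_countP_le φ (reps le vs) (fun c => decide (Touches F c)) (inter φ)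
    (intra φ) ?_ ?_ ?_
  · rw [twiceOpt]
    omega
  · intro c hc ht
    by_contra hi
    simp only [inter, Bool.not_eq_false, decide_eq_true_eq] at hi ht
    exact htouch c hi.1 hi.2.1 ht
  · intro c hc r hr hi
    simp only [intra, decide_eq_true_eq] at hi
    refine ⟨decide_eq_false (htouch c ?_ ?_), ?_⟩
    rotate_left 2
    · by_contra hi'
      simp only [inter, Bool.not_eq_false, decide_eq_true_eq] at hi'
      exact hi'.2.2 (hi.1.trans hi.2.symm)
    · exact hi.1.symm.free (h.mem_reps hr).2
    · exact hi.2.symm.free (h.mem_reps hr).2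
  · intro c hc
    refine h.pairwise_reps.imp fun {r r'} hrr hh => hrr ?_
    simp only [intra, decide_eq_true_eq] at hh
    exact hh.1.1.symm.trans hh.2.1

end

end MinEquiv

namespace MinEquiv

/-! ### Optimal formulas: the forced variables -/

section

variable {V : Type} {φ : List (Con V)} {le : Lit V → Lit V → Bool} {vs : List V}

/-- `α` does not separate equivalent literals of free variables. -/
def Respects (φ : List (Con V)) (α : V → Bool) : Prop :=
  ∀ u v, Free φ u.1 → Eqv φ u v → (IsTrue u α ↔ IsTrue v α)

/-- `c` has a kind in `A` and is a consequence of `φ`. -/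
def Allowed (A : Kind → Bool) (φ : List (Con V)) (c : Con V) : Prop :=
  A c.1 = true ∧ ∀ α, Sat φ α → Holds c α

/-- Otherwise the constant assignment `!s` would be a model. -/
theorem exists_xor_of_forced {s : Bool} {x : V} (hx : Forced φ (x, s))
    (hk : ∀ c ∈ φ, c.1 ≠ .unit s ∧ c.1 ≠ .or s) : ∃ c ∈ φ, c.1 = .par true := by
  by_contra! hn
  have : Sat φ fun _ => !s := by
    intro c hc
    have h₁ := hn c hc
    have h₂ := hk c hc
    rcases c with ⟨_ | t | t | _ | d, y, z⟩
    · rfl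
    · have : t = !s := Bool.eq_not.2 fun e => h₂.1 (by rw [e])
      simp [Holds, Kind.holds, this]
    · have : t = !s := Bool.eq_not.2 fun e => h₂.2 (by rw [e])
      simp [Holds, Kind.holds, this]
    · simp [Holds, Kind.holds]
    · cases d
      · simp [Holds, Kind.holds]
      · exact absurd rfl h₁
  have := hx _ this
  simp [IsTrue] at this

/-- Without implications a model could be changed at `x`. If nothing is forced to `!s`, flip exactly
the variables forced to `s`: equality links only variables that are both forced or both free, and
XOR only free ones. If there are no unit and `or` constraints at all, only equations remain, and
they are invariant under complement. -/
theorem exists_imp_of_forced {s : Bool} {x : V} (hφ : ∃ α, Sat φ α) (hx : Forced φ (x, s))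
    (hk : ∀ c ∈ φ, c.1 ≠ .unit s ∧ c.1 ≠ .or s)
    (hk' : (∀ y, ¬ Forced φ (y, !s)) ∨ ∀ c ∈ φ, c.1 ≠ .unit (!s) ∧ c.1 ≠ .or (!s)) :
    ∃ c ∈ φ, c.1 = .imp := by
  classical
  obtain ⟨α, hα⟩ := hφ
  by_contra! hn
  rcases hk' with hk' | hk'
  · have : Sat φ fun y => if Forced φ (y, s) then !s else α y := by
      intro c hc
      have h₁ := hn c hc
      have h₂ := hk c hc
      have h₃ := hα c hc
      rcases hcc : c with ⟨_ | t | t | _ | d, y, z⟩ <;> subst hcc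
      · rfl
      · have : t = !s := Bool.eq_not.2 fun e => h₂.1 (by rw [e])
        subst this
        exact absurd (forced_of_unit hc rfl) (hk' y)
      · have : t = !s := Bool.eq_not.2 fun e => h₂.2 (by rw [e])
        simp only [Holds, Kind.holds, this] at h₃ ⊢
        split_ifs <;> simp_all
      · exact absurd rfl h₁
      · have hyz : ∀ e, Eqv φ (y, e) (z, xor e d) := by
          intro e
          constructor <;> intro β hβ hu <;> have := hβ _ hc <;>
            simp only [IsTrue, Holds, Kind.holds] at * <;>
            cases e <;> cases d <;> cases hy : β y <;> cases hz : β z <;> simp_all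
        have hyz' : Forced φ (y, s) ↔ Forced φ (z, xor s d) :=
          ⟨fun h => h.le (hyz s).1, fun h => h.le (hyz s).2⟩
        have hyz'' : Forced φ (y, xor s d) ↔ Forced φ (z, s) := by
          have := hyz (xor s d)
          rw [Bool.xor_assoc, Bool.xor_self, Bool.xor_false] at this
          exact ⟨fun h => h.le this.1, fun h => h.le this.2⟩
        cases d
        · rw [Bool.xor_false] at hyz'
          simp only [Holds, Kind.holds, hyz'] at h₃ ⊢
          split_ifs <;> simp_all
        · rw [Bool.xor_true] at hyz' hyz''
          have h₄ : ¬ Forced φ (y, s) := fun h => hk' z (hyz'.1 h)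
          have h₅ : ¬ Forced φ (z, s) := fun h => hk' y (hyz''.2 h)
          simpa [Holds, Kind.holds, h₄, h₅] using h₃
    have := hx _ this
    simp [IsTrue, hx] at this
  · have : Sat φ fun y => !α y := by
      intro c hc
      have h₁ := hn c hc
      have h₂ := hk c hc
      have h₃ := hα c hc
      have h₄ := hk' c hc
      rcases c with ⟨_ | t | t | _ | d, y, z⟩
      · rfl
      · cases s <;> cases t <;> simp_all
      · cases s <;> cases t <;> simp_all
      · exact absurd rfl h₁
      · simpa [Holds, Kind.holds] using h₃
    have := hx _ this
    have := hx α hα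
    simp_all [IsTrue]

/-- Constraints for the forced variables, together with those for the free variables. -/
theorem exists_forcing (h : Decides φ le vs) {A : Kind → Bool} (hA : ∀ c ∈ φ, A c.1 = true) :
    ∃ ψ : List (Con V), (∀ c ∈ ψ, Allowed A φ c) ∧
      (∀ α, Sat ψ α → Respects φ α → ∀ x b, Forced φ (x, b) → α x = b) ∧
      ψ.length ≤ (forcedVars le vs true).length + (forcedVars le vs false).length +
        if needsExtra le vs A then 1 else 0 := by
  set F := forcedVars le vs with hFdef
  have hF : ∀ s x, x ∈ F s ↔ Forced φ (x, s) := fun s x => h.mem_forcedVars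
  have hval : ∀ {s x}, x ∈ F s → ∀ α, Sat φ α → α x = s := fun hx => (hF _ _).1 hx
  let U : Bool → Prop := fun s => A (.unit s) = true ∨ A (.or s) = true
  have hunit : ∀ s, U s → ∀ x, ∃ c : Con V, A c.1 = true ∧ ∀ α, Holds c α ↔ α x = s := by
    rintro s (hs | hs) x
    · exact ⟨(.unit s, x, x), hs, fun α => by simp [Holds, Kind.holds]⟩
    · exact ⟨(.or s, x, x), hs, fun α => by simp [Holds, Kind.holds]⟩
  have hnotU : ∀ s, ¬ U s → ∀ c ∈ φ, c.1 ≠ .unit s ∧ c.1 ≠ .or s := by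
    intro s hs c hc
    have := hA c hc
    constructor <;> intro e <;> rw [e] at this
    · exact hs (Or.inl this)
    · exact hs (Or.inr this)
  have hlen : ∀ s, (F true).length + (F false).length = (F s).length + (F !s).length := by
    rintro (_ | _)
    · exact Nat.add_comm _ _
    · rfl
  have hboth : ∀ (s : Bool) {α : V → Bool}, (∀ x ∈ F s, α x = s) → (∀ x ∈ F !s, α x = !s) →
      ∀ x b, Forced φ (x, b) → α x = b := by
    intro s α h₁ h₂ x b hxb
    rw [← hF] at hxb
    rcases Bool.eq_or_eq_not b s with rfl | rfl
    · exact h₁ x hxb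
    · exact h₂ x hxb
  -- One constraint per forced variable, provided that literals of the required signs are available;
  -- an `or` with a repeated variable is as good as a unit constraint.
  by_cases hU : ∀ s, F s ≠ [] → U s
  · have : ∀ s x, ∃ c : Con V, x ∈ F s → A c.1 = true ∧ ∀ α, Holds c α ↔ α x = s := by
      intro s x
      by_cases hx : x ∈ F s
      · obtain ⟨c, hc⟩ := hunit s (hU s (List.ne_nil_of_mem hx)) x
        exact ⟨c, fun _ => hc⟩
      · exact ⟨(.top, x, x), fun h' => absurd h' hx⟩
    choose f hf using this
    refine ⟨(F true).map (f true) ++ (F false).map (f false), ?_, ?_, by simp⟩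
    · intro c hc
      obtain ⟨s, x, hx, rfl⟩ : ∃ s x, x ∈ F s ∧ f s x = c := by
        rcases List.mem_append.1 hc with hc | hc
        · exact ⟨true, List.mem_map.1 hc⟩
        · exact ⟨false, List.mem_map.1 hc⟩
      exact ⟨(hf s x hx).1, fun α hα => ((hf s x hx).2 α).2 (hval hx α hα)⟩
    · intro α hα _
      refine hboth true ?_ ?_ <;> intro x hx
      · exact ((hf true x hx).2 α).1 (hα _ (List.mem_append_left _ (List.mem_map_of_mem hx)))
      · exact ((hf false x hx).2 α).1 (hα _ (List.mem_append_right _ (List.mem_map_of_mem hx)))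
  push Not at hU
  obtain ⟨s, hne, hs⟩ := hU
  obtain ⟨y, hy⟩ := List.exists_mem_of_ne_nil _ hne
  obtain ⟨c₁, hc₁, hx₁⟩ := exists_xor_of_forced ((hF s y).1 hy) (hnotU s hs)
  have hX : A (.par true) = true := hx₁ ▸ hA c₁ hc₁
  have hxor : ∀ x z (α : V → Bool), Holds ((.par true, x, z) : Con V) α ↔ α x = !α z := by
    intro x z α
    simp only [Holds, Kind.holds]
    cases α x <;> cases α z <;> simp
  have himp : ∀ x z (α : V → Bool), Holds ((.imp, x, z) : Con V) α ↔ (α x = true → α z = true) := by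
    intro x z α
    simp only [Holds, Kind.holds]
    cases α x <;> cases α z <;> simp
  rcases hFs : F s with _ | ⟨y, t⟩
  · exact absurd hFs hne
  rw [hlen s, hFs, List.length_cons]
  have hyF : y ∈ F s := by simp [hFs]
  have htF : ∀ x ∈ t, x ∈ F s := fun x hx => by simp [hFs, hx]
  rcases hFn : F (!s) with _ | ⟨z, t'⟩
  -- All forced values equal `s` and no literal with value `s` is available: this is the case with
  -- one additional constraint.
  · have hI : A .imp = true := by
      obtain ⟨c, hc, hck⟩ := exists_imp_of_forced h.sat ((hF s y).1 hyF) (hnotU s hs)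
        (Or.inl fun x hx => by rw [← hF, hFn] at hx; simp at hx)
      exact hck ▸ hA c hc
    have hE : needsExtra le vs A = true := by
      have h₁ : A (.unit s) = false := Bool.eq_false_iff.2 fun e => hs (Or.inl e)
      have h₂ : A (.or s) = false := Bool.eq_false_iff.2 fun e => hs (Or.inr e)
      simp only [needsExtra, List.any_eq_true]
      refine ⟨s, by cases s <;> simp, ?_⟩
      rw [← hFdef, hFs, hFn, h₁, h₂]
      rfl
    rw [if_pos hE]
    have hopp : ∀ b, Eqv φ (c₁.2.1, b) (c₁.2.2, !b) := by
      intro b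
      constructor <;> intro β hβ hu <;> have := hβ _ hc₁ <;>
        simp only [Holds, hx₁, Kind.holds, IsTrue] at * <;> rw [hu] at this <;>
        revert this
      · cases b <;> cases β c₁.2.2 <;> simp
      · cases b <;> cases β c₁.2.1 <;> simp
    have hfree : Free φ c₁.2.1 := by
      intro b hb
      rcases Bool.eq_or_eq_not b s with rfl | rfl
      · have := hb.le (hopp b).1
        rw [← hF, hFn] at this
        simp at this
      · rw [← hF, hFn] at hb
        simp at hb
    let f : V → V → Con V := fun u x => if s then (.imp, u, x) else (.imp, x, u)
    have hf : ∀ u x α, Holds (f u x) α ↔ (α u = s → α x = s) := by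
      intro u x α
      cases s <;> simp only [f, if_true, if_false, himp, Bool.false_eq_true]
      cases α u <;> cases α x <;> simp
    have hfk : ∀ u x, A (f u x).1 = true := by
      intro u x
      cases s <;> simp [f, hI]
    -- The variables of the XOR constraint `c₁` are free and opposite. Whichever of them has the
    -- value `s` passes it to `y`, and `y` passes it to the rest. That they are opposite under `α`
    -- is not imposed here again: it comes from `Respects`, which the constraints of the classes
    -- ensure.
    refine ⟨f c₁.2.1 y :: f c₁.2.2 y :: t.map (f y), ?_, ?_, by simp⟩
    · intro c hc
      obtain ⟨u, x, hx, rfl⟩ : ∃ u x, x ∈ F s ∧ f u x = c := by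
        simp only [List.mem_cons, List.mem_map] at hc
        rcases hc with rfl | rfl | ⟨x, hx, rfl⟩
        · exact ⟨_, _, hyF, rfl⟩
        · exact ⟨_, _, hyF, rfl⟩
        · exact ⟨_, _, htF x hx, rfl⟩
      exact ⟨hfk u x, fun α hα => (hf u x α).2 fun _ => hval hx α hα⟩
    · intro α hα hR
      have h₁ := (hf _ _ _).1 (hα (f c₁.2.1 y) (by simp))
      have h₂ := (hf _ _ _).1 (hα (f c₁.2.2 y) (by simp))
      have h₃ := hR _ _ hfree (hopp !s)
      have hys : α y = s := by
        by_cases e : α c₁.2.1 = s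
        · exact h₁ e
        · exact h₂ (by simpa [IsTrue] using h₃.1 (Bool.eq_not.2 e))
      refine hboth s ?_ ?_ <;> intro x hx
      · rw [hFs, List.mem_cons] at hx
        rcases hx with rfl | hx
        · exact hys
        · exact (hf _ _ _).1 (hα (f y x)
            (List.mem_cons_of_mem _ (List.mem_cons_of_mem _ (List.mem_map_of_mem hx)))) hys
      · rw [hFn] at hx
        simp at hx
  have hzF : z ∈ F !s := by simp [hFn]
  have htF' : ∀ x ∈ t', x ∈ F !s := fun x hx => by simp [hFn, hx]
  by_cases hs' : U (!s)
  · choose f hf₁ hf₂ using hunit (!s) hs'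
    -- The variables with value `!s` are fixed directly, and those with value `s` are declared
    -- opposite to one of them.
    refine ⟨(y :: t).map (fun x => (.par true, x, z)) ++ (z :: t').map f, ?_, ?_, by simp; omega⟩
    · intro c hc
      rcases List.mem_append.1 hc with hc | hc <;> obtain ⟨x, hx, rfl⟩ := List.mem_map.1 hc
      · refine ⟨hX, fun α hα => (hxor _ _ _).2 ?_⟩
        rw [hval (hFs ▸ hx) α hα, hval hzF α hα, Bool.not_not]
      · exact ⟨hf₁ x, fun α hα => (hf₂ x α).2 (hval (hFn ▸ hx) α hα)⟩
    · intro α hα _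
      have h₁ : ∀ x ∈ F !s, α x = !s := fun x hx => (hf₂ x α).1
        (hα _ (List.mem_append_right _ (List.mem_map_of_mem (hFn ▸ hx))))
      refine hboth s (fun x hx => ?_) h₁
      have := (hxor _ _ _).1 (hα (.par true, x, z)
        (List.mem_append_left _ (List.mem_map.2 ⟨x, hFs ▸ hx, rfl⟩)))
      rw [this, h₁ z hzF, Bool.not_not]
  · have hI : A .imp = true := by
      obtain ⟨c, hc, hck⟩ := exists_imp_of_forced h.sat ((hF s y).1 hyF) (hnotU s hs)
        (Or.inr (hnotU _ hs'))
      exact hck ▸ hA c hc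
    let c₀ : Con V := if s then (.imp, z, y) else (.imp, y, z)
    have hc₀ : ∀ α : V → Bool, α y = !α z → (Holds c₀ α ↔ α y = s ∧ α z = !s) := by
      intro α e
      cases s <;> simp only [c₀, if_true, if_false, himp, Bool.false_eq_true, e] <;>
        cases α z <;> simp
    have hc₀k : A c₀.1 = true := by
      simp only [c₀]
      split_ifs <;> exact hI
    -- XOR leaves two possibilities for the opposite pair `y`, `z`, and the implication `c₀`
    -- excludes the wrong one. No constraint is spent on `z` otherwise, so the total is the number
    -- of forced variables.
    refine ⟨c₀ :: (y :: t).map (fun x => (.par true, x, z)) ++ t'.map fun x => (.par true, x, y),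
      ?_, ?_, by simp; omega⟩
    · intro c hc
      rcases List.mem_append.1 hc with hc | hc
      · rcases List.mem_cons.1 hc with rfl | hc
        · refine ⟨hc₀k, fun α hα => (hc₀ α ?_).2 ⟨hval hyF α hα, hval hzF α hα⟩⟩
          rw [hval hyF α hα, hval hzF α hα, Bool.not_not]
        · obtain ⟨x, hx, rfl⟩ := List.mem_map.1 hc
          refine ⟨hX, fun α hα => (hxor _ _ _).2 ?_⟩
          rw [hval (hFs ▸ hx) α hα, hval hzF α hα, Bool.not_not]
      · obtain ⟨x, hx, rfl⟩ := List.mem_map.1 hc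
        refine ⟨hX, fun α hα => (hxor _ _ _).2 ?_⟩
        rw [hval (htF' x hx) α hα, hval hyF α hα]
    · intro α hα _
      have h₁ : ∀ x ∈ F s, α x = !α z := fun x hx => (hxor _ _ _).1 (hα (.par true, x, z)
        (List.mem_append_left _ (List.mem_cons_of_mem _ (List.mem_map.2 ⟨x, hFs ▸ hx, rfl⟩))))
      obtain ⟨hys, hzs⟩ := (hc₀ α (h₁ y hyF)).1 (hα c₀ (by simp))
      refine hboth s (fun x hx => by rw [h₁ x hx, hzs, Bool.not_not]) fun x hx => ?_
      rw [hFn, List.mem_cons] at hx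
      rcases hx with rfl | hx
      · exact hzs
      · rw [(hxor _ _ _).1 (hα (.par true, x, y)
          (List.mem_append_right _ (List.mem_map.2 ⟨x, hx, rfl⟩))), hys]

end

end MinEquiv

namespace MinEquiv

/-! ### Optimal formulas: the classes -/

section

variable {V : Type}

/-- The constraint which says that `u` implies `v`. -/
def impl (u v : Lit V) : Con V :=
  match u.2, v.2 with
  | true, true => (.imp, u.1, v.1)
  | false, false => (.imp, v.1, u.1)
  | true, false => (.or false, u.1, v.1)
  | false, true => (.or true, u.1, v.1)

theorem holds_impl {u v : Lit V} {α : V → Bool} :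
    Holds (impl u v) α ↔ (IsTrue u α → IsTrue v α) := by
  rcases u with ⟨x, _ | _⟩ <;> rcases v with ⟨y, _ | _⟩ <;>
    simp only [impl, Holds, Kind.holds, IsTrue] <;> cases α x <;> cases α y <;> simp

theorem impl_kind_of_eq {u v : Lit V} (h : u.2 = v.2) : (impl u v).1 = .imp := by
  rcases u with ⟨x, _ | _⟩ <;> rcases v with ⟨y, _ | _⟩ <;> simp_all [impl]

theorem impl_kind_of_ne {u v : Lit V} (h : u.2 ≠ v.2) : (impl u v).1 = .or v.2 := by
  rcases u with ⟨x, _ | _⟩ <;> rcases v with ⟨y, _ | _⟩ <;> simp_all [impl]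

/-- The constraint which says that `u` and `v` are equal. -/
def eqCon (u v : Lit V) : Con V := (.par (xor u.2 v.2), u.1, v.1)

theorem holds_eqCon {u v : Lit V} {α : V → Bool} :
    Holds (eqCon u v) α ↔ (IsTrue u α ↔ IsTrue v α) := by
  rcases u with ⟨x, _ | _⟩ <;> rcases v with ⟨y, _ | _⟩ <;>
    simp only [eqCon, Holds, Kind.holds, IsTrue] <;> cases α x <;> cases α y <;> simp

/-- The implications along a list of literals. -/
def links : Lit V → List (Lit V) → List (Con V)
  | _, [] => []
  | u, v :: l => impl u v :: links v l

theorem length_links (u : Lit V) (l : List (Lit V)) : (links u l).length = l.length := by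
  induction l generalizing u with
  | nil => rfl
  | cons v l ih => simp [links, ih]

theorem sat_links {u w : Lit V} {l : List (Lit V)} {α : V → Bool}
    (h : Sat (links u (l ++ [w])) α) :
    (IsTrue u α → IsTrue w α) ∧
      ∀ v ∈ l, (IsTrue u α → IsTrue v α) ∧ (IsTrue v α → IsTrue w α) := by
  induction l generalizing u with
  | nil => exact ⟨holds_impl.1 (h (impl u w) (by simp [links])), by simp⟩
  | cons v l ih =>
    have h₁ := holds_impl.1 (h (impl u v) (by simp [links]))
    obtain ⟨h₂, h₃⟩ := ih (u := v) fun c hc => h c (by simp [links, hc])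
    refine ⟨fun hu => h₂ (h₁ hu), fun z hz => ?_⟩
    rcases List.mem_cons.1 hz with rfl | hz
    · exact ⟨h₁, h₂⟩
    · exact ⟨fun hu => (h₃ z hz).1 (h₁ hu), (h₃ z hz).2⟩

/-- A closed walk of implications makes all its literals equal, at the price of one constraint per
step. -/
theorem sat_cycle {u : Lit V} {l : List (Lit V)} {α : V → Bool}
    (h : Sat (links u (l ++ [u])) α) {v : Lit V} (hv : v ∈ u :: l) : IsTrue v α ↔ IsTrue u α := by
  rcases List.mem_cons.1 hv with rfl | hv
  · rfl
  · have := (sat_links h).2 v hv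
    exact ⟨this.2, this.1⟩

theorem exists_of_mem_links {c : Con V} {R : Lit V → Lit V → Prop} {u : Lit V} {l : List (Lit V)}
    (hR : (u :: l).IsChain R) (hc : c ∈ links u l) :
    ∃ a b, R a b ∧ a ∈ u :: l ∧ b ∈ l ∧ c = impl a b := by
  induction l generalizing u with
  | nil => simp [links] at hc
  | cons v l ih =>
    rw [List.isChain_cons_cons] at hR
    rcases List.mem_cons.1 hc with rfl | hc
    · exact ⟨u, v, hR.1, by simp, by simp, rfl⟩
    · obtain ⟨a, b, h₁, h₂, h₃, h₄⟩ := ih hR.2 hc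
      exact ⟨a, b, h₁, List.mem_cons_of_mem _ h₂, List.mem_cons_of_mem _ h₃, h₄⟩

/-- The literals `x₁, ¬y₁, x₂, ¬y₂, …`. -/
def alternate (l : List (V × V)) : List (Lit V) := l.flatMap fun p => [(p.1, true), (p.2, false)]

theorem length_alternate (l : List (V × V)) : (alternate l).length = 2 * l.length := by
  induction l with
  | nil => rfl
  | cons p l ih => simp_all [alternate]; omega

theorem isChain_alternate {w w' : Lit V} (hw : w.2 = false) (hw' : w'.2 = true) (l : List (V × V)) :
    (w :: (alternate l ++ [w'])).IsChain fun a b => a.2 ≠ b.2 := by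
  induction l generalizing w with
  | nil => simp [alternate, hw, hw']
  | cons p l ih =>
    have := ih (w := (p.2, false)) rfl
    simp_all [alternate]

/-- The shorter list is padded with its extra element `x` or `y`. The pairs form an alternating walk
that visits both sides completely, possibly with repetitions. -/
theorem exists_zip (x y : V) (P Q : List V) : ∃ l : List (V × V),
    l.length = max P.length Q.length ∧ (∀ p ∈ l, p.1 ∈ x :: P ∧ p.2 ∈ y :: Q) ∧
      (∀ a ∈ P, ∃ b, (a, b) ∈ l) ∧ ∀ b ∈ Q, ∃ a, (a, b) ∈ l := by
  induction P generalizing Q with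
  | nil => exact ⟨Q.map fun b => (x, b), by simp, by simp +contextual, by simp, by simp⟩
  | cons a P ih =>
    cases Q with
    | nil =>
      refine ⟨(a :: P).map fun b => (b, y), by simp, ?_, fun c hc => ⟨y, ?_⟩, by simp⟩
      · rintro p hp
        obtain ⟨c, hc, rfl⟩ := List.mem_map.1 hp
        exact ⟨List.mem_cons_of_mem _ hc, List.mem_cons_self⟩
      · exact List.mem_map.2 ⟨c, hc, rfl⟩
    | cons b Q =>
      obtain ⟨l, h₁, h₂, h₃, h₄⟩ := ih Q
      refine ⟨(a, b) :: l, by simp [h₁], ?_, ?_, ?_⟩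
      · intro p hp
        rcases List.mem_cons.1 hp with rfl | hp
        · simp
        · have := h₂ p hp
          simp only [List.mem_cons] at this ⊢
          tauto
      · intro c hc
        rcases List.mem_cons.1 hc with rfl | hc
        · exact ⟨b, by simp⟩
        · obtain ⟨d, hd⟩ := h₃ c hc
          exact ⟨d, by simp [hd]⟩
      · intro c hc
        rcases List.mem_cons.1 hc with rfl | hc
        · exact ⟨a, by simp⟩
        · obtain ⟨d, hd⟩ := h₄ c hc
          exact ⟨d, by simp [hd]⟩

variable {φ : List (Con V)} {le : Lit V → Lit V → Bool} {vs : List V}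

/-- Edges between free literals reveal which kinds the given formula has, and hence which are
available for the optimal one. -/
theorem kind_of_edge {c : Con V} (hc : c ∈ φ) {u v : Lit V} (h : (u, v) ∈ conEdges c)
    (hu : Free φ u.1) (hv : Free φ v.1) :
    (u.2 ≠ v.2 → c.1 = .par true ∨ c.1 = .or v.2) ∧
      (u.2 = v.2 → c.1 = .imp ∨ c.1 = .par false) := by
  have hx : Free φ c.2.1 := by
    rcases fst_of_mem_conEdges h with ⟨e₁, e₂⟩ | ⟨e₁, e₂⟩
    · exact e₁ ▸ hu
    · exact e₂ ▸ hv
  rcases hk : c.1 with _ | s | s | _ | d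
  · obtain ⟨a, b, hab, -⟩ := mem_conEdges.1 h
    simp [hk, Kind.holds] at hab
  · exact absurd (forced_of_unit hc hk) (hx s)
  · have := snd_of_or hk h
    simp [this]
  · obtain ⟨a, b, hab, he⟩ := mem_conEdges.1 h
    rw [hk] at hab
    have : a = true ∧ b = false := by
      revert hab
      cases a <;> cases b <;> simp [Kind.holds]
    rcases he with ⟨rfl, rfl⟩ | ⟨rfl, rfl⟩ <;> simp [this]
  · have := snd_of_par hk h
    cases d <;> simp [this]

/-- Constraints for one class of equivalent variables. -/
theorem exists_class (h : Decides φ le vs) {A : Kind → Bool} (hA : ∀ c ∈ φ, A c.1 = true)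
    {r : V} (hr : r ∈ reps le vs) :
    ∃ ψ : List (Con V), (∀ c ∈ ψ, Allowed A φ c) ∧
      (∀ α, Sat ψ α → ∀ u, Eqv φ u (r, true) → (IsTrue u α ↔ IsTrue (r, true) α)) ∧
      ψ.length ≤ cost A (side le vs r true).length (side le vs r false).length := by
  have hfr := (h.mem_reps hr).2
  have hP : ∀ x, x ∈ side le vs r true ↔ Eqv φ (x, true) (r, true) := fun x => h.mem_side hr
  have hQ : ∀ x, x ∈ side le vs r false ↔ Eqv φ (x, false) (r, true) := fun x =>
    (h.mem_side hr).trans ⟨fun h => h.neg, fun h => h.neg⟩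
  have hnd : (side le vs r true).Nodup := (h.nodup.filter _).filter _
  generalize side le vs r true = P at hP hnd ⊢
  generalize side le vs r false = Q at hQ ⊢
  -- It is enough to build implications and equations between members of the class which make all of
  -- them equal to some common literal `w`; that they are consequences of `φ` is then automatic.
  suffices H : ∃ ψ : List (Con V), (∀ c ∈ ψ, A c.1 = true ∧ ∃ u v, Eqv φ u (r, true) ∧
      Eqv φ v (r, true) ∧ (c = impl u v ∨ c = eqCon u v)) ∧
      (∀ α, Sat ψ α → ∃ w, (∀ x ∈ P, IsTrue (x, true) α ↔ IsTrue w α) ∧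
        ∀ x ∈ Q, IsTrue (x, false) α ↔ IsTrue w α) ∧
      ψ.length ≤ cost A P.length Q.length by
    obtain ⟨ψ, h₁, h₂, h₃⟩ := H
    refine ⟨ψ, fun c hc => ⟨(h₁ c hc).1, fun α hα => ?_⟩, fun α hα u hu => ?_, h₃⟩
    · obtain ⟨-, u, v, hu, hv, rfl | rfl⟩ := h₁ c hc
      · exact holds_impl.2 ((hu.trans hv.symm).1 α hα)
      · exact holds_eqCon.2 ⟨(hu.trans hv.symm).1 α hα, (hu.trans hv.symm).2 α hα⟩
    · obtain ⟨w, h₄, h₅⟩ := h₂ α hα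
      rw [h₄ r ((hP r).2 (Eqv.refl _ _))]
      rcases u with ⟨x, _ | _⟩
      · exact h₅ x ((hQ x).2 hu)
      · exact h₄ x ((hP x).2 hu)
  have hcycle : ∀ u l, (∀ v ∈ u :: l, Eqv φ v (r, true)) →
      (u :: (l ++ [u])).IsChain (fun a b => A (impl a b).1 = true) →
      (∀ x ∈ P, (x, true) ∈ u :: l) → (∀ x ∈ Q, (x, false) ∈ u :: l) →
      l.length + 1 ≤ cost A P.length Q.length →
      ∃ ψ : List (Con V), (∀ c ∈ ψ, A c.1 = true ∧ ∃ u v, Eqv φ u (r, true) ∧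
        Eqv φ v (r, true) ∧ (c = impl u v ∨ c = eqCon u v)) ∧
        (∀ α, Sat ψ α → ∃ w, (∀ x ∈ P, IsTrue (x, true) α ↔ IsTrue w α) ∧
          ∀ x ∈ Q, IsTrue (x, false) α ↔ IsTrue w α) ∧
        ψ.length ≤ cost A P.length Q.length := by
    intro u l hl hR hlP hlQ hlen
    refine ⟨links u (l ++ [u]), fun c hc => ?_, fun α hα => ⟨u, fun x hx => ?_, fun x hx => ?_⟩, ?_⟩
    · obtain ⟨a, b, h₁, h₂, h₃, rfl⟩ := exists_of_mem_links hR hc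
      refine ⟨h₁, a, b, hl a ?_, hl b ?_, Or.inl rfl⟩
      · simp only [List.mem_cons, List.mem_append, List.not_mem_nil, or_false] at h₂ ⊢
        tauto
      · simp only [List.mem_append, List.mem_singleton] at h₃
        rcases h₃ with h₃ | rfl
        · exact List.mem_cons_of_mem _ h₃
        · exact List.mem_cons_self
    · exact sat_cycle hα (hlP x hx)
    · exact sat_cycle hα (hlQ x hx)
    · simpa [length_links] using hlen
  have hfree : ∀ u, Eqv φ u (r, true) → Free φ u.1 := fun u hu =>
    Free.of_eqv (u := (r, true)) hfr hu.symm
  have hpath : ∀ u v, Eqv φ u (r, true) → Eqv φ v (r, true) → Relation.ReflTransGen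
      (fun a b => Eqv φ a (r, true) ∧ Eqv φ b (r, true) ∧ Edge φ a b) u v := fun u v hu hv =>
    reach_within hu hv (reach_of_le h.sat (hfree u hu) (hfree v hv) (hu.trans hv.symm).1)
  rcases P with _ | ⟨x₀, P⟩
  · have := (hP r).2 (Eqv.refl _ _)
    simp at this
  have hx₀ := (hP x₀).1 (by simp)
  rcases Q with _ | ⟨y₀, Q⟩
  · by_cases hE : A (.par false) = true
    · refine ⟨P.map fun x => eqCon (x, true) (x₀, true), ?_, ?_, by simp [cost, hE]⟩
      · intro c hc
        obtain ⟨x, hx, rfl⟩ := List.mem_map.1 hc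
        exact ⟨hE, _, _, (hP x).1 (by simp [hx]), hx₀, Or.inr rfl⟩
      · refine fun α hα => ⟨(x₀, true), fun x hx => ?_, by simp⟩
        rcases List.mem_cons.1 hx with rfl | hx
        · rfl
        · exact holds_eqCon.1 (hα _ (List.mem_map_of_mem hx))
    rcases P with _ | ⟨x₁, P⟩
    · exact ⟨[], by simp, fun α _ => ⟨(x₀, true), by simp, by simp⟩, by simp⟩
    -- With equality unavailable and all signs equal, an edge inside the class can only be an
    -- implication.
    have hI : A .imp = true := by
      have hx₁ := (hP x₁).1 (by simp)
      have hne : x₀ ≠ x₁ := fun e => by simp [e] at hnd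
      rcases Relation.ReflTransGen.cases_head (hpath _ _ hx₀ hx₁) with e | ⟨b, ⟨-, hb, c, hc, he⟩, -⟩
      · exact absurd (Prod.ext_iff.1 e).1 hne
      · have hb' : b.2 = true := by
          rcases b with ⟨x, _ | _⟩
          · have := (hQ x).2 hb
            simp at this
          · rfl
        rcases (kind_of_edge hc he (hfree _ hx₀) (hfree _ hb)).2 hb'.symm with e | e
        · exact e ▸ hA c hc
        · exact absurd (e ▸ hA c hc) hE
    refine hcycle (x₀, true) ((x₁ :: P).map fun x => (x, true)) ?_ ?_ ?_ (by simp) (by simp [cost, hE])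
    · intro v hv
      rw [← List.map_cons (f := fun x => ((x, true) : Lit V))] at hv
      obtain ⟨x, hx, rfl⟩ := List.mem_map.1 hv
      exact (hP x).1 hx
    · refine List.Pairwise.isChain (List.Pairwise.imp_of_mem (R := fun _ _ => True) ?_
        (List.pairwise_of_forall fun _ _ => trivial))
      intro a b ha hb _
      have hall : ∀ u ∈ (x₀, true) :: ((x₁ :: P).map (fun x => (x, true)) ++ [(x₀, true)]),
          u.2 = true := by
        simp only [List.mem_cons, List.mem_append, List.mem_map]
        rintro u (rfl | ⟨x, -, rfl⟩ | rfl | hu)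
        · rfl
        · rfl
        · rfl
        · simp at hu
      rw [impl_kind_of_eq ((hall a ha).trans (hall b hb).symm), hI]
    · intro x hx
      rw [← List.map_cons (f := fun x => ((x, true) : Lit V))]
      exact List.mem_map_of_mem hx
  · have hy₀ := (hQ y₀).1 (by simp)
    by_cases hX : A (.par true) = true
    · refine ⟨(x₀ :: P).map (fun x => eqCon (x, true) (y₀, false)) ++
        Q.map fun y => eqCon (y, false) (x₀, true), ?_, ?_, by simp [cost, hX]⟩
      · intro c hc
        rcases List.mem_append.1 hc with hc | hc <;> obtain ⟨x, hx, rfl⟩ := List.mem_map.1 hc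
        · exact ⟨hX, _, _, (hP x).1 hx, hy₀, Or.inr rfl⟩
        · exact ⟨hX, _, _, (hQ x).1 (by simp [hx]), hx₀, Or.inr rfl⟩
      · intro α hα
        have h₁ : ∀ x ∈ x₀ :: P, IsTrue (x, true) α ↔ IsTrue (y₀, false) α := fun x hx =>
          holds_eqCon.1 (hα _ (List.mem_append_left _ (List.mem_map.2 ⟨x, hx, rfl⟩)))
        refine ⟨(y₀, false), h₁, fun x hx => ?_⟩
        rcases List.mem_cons.1 hx with rfl | hx
        · rfl
        · rw [← h₁ x₀ (by simp)]
          exact holds_eqCon.1 (hα _ (List.mem_append_right _ (List.mem_map.2 ⟨x, hx, rfl⟩)))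
    -- Both signs occur in the class, and paths lead from either to the other. Without XOR, a sign
    -- can change only along a clause of the corresponding `or` kind.
    have hOr : ∀ s, A (.or s) = true := by
      intro s
      obtain ⟨u, v, hu, hv, hus, hvs⟩ : ∃ u v : Lit V, Eqv φ u (r, true) ∧ Eqv φ v (r, true) ∧
          u.2 = !s ∧ v.2 = s := by
        cases s
        · exact ⟨_, _, hx₀, hy₀, rfl, rfl⟩
        · exact ⟨_, _, hy₀, hx₀, rfl, rfl⟩
      obtain ⟨a, b, ⟨ha, hb, c, hc, he⟩, h₁, h₂⟩ := exists_step_of_ne (f := Prod.snd) (hpath u v hu hv)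
        (by rw [hus, hvs]; simp)
      rw [hus] at h₁
      rw [hvs] at h₂
      rcases (kind_of_edge hc he (hfree _ ha) (hfree _ hb)).1 (by rw [h₁, h₂]; simp) with e | e
      · exact absurd (e ▸ hA c hc) hX
      · rw [h₂] at e
        exact e ▸ hA c hc
    by_cases hI : A .imp = true
    · refine hcycle (x₀, true) (P.map (fun x => (x, true)) ++ (y₀ :: Q).map fun x => (x, false))
        ?_ ?_ ?_ ?_ (by simp [cost, hX, hI])
      · simp only [List.mem_cons, List.mem_append, List.mem_map]
        rintro v (rfl | ⟨x, hx, rfl⟩ | ⟨x, hx, rfl⟩)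
        · exact hx₀
        · exact (hP x).1 (by simp [hx])
        · exact (hQ x).1 (by simpa using hx)
      · refine List.Pairwise.isChain (List.pairwise_of_forall fun a b => ?_)
        by_cases hab : a.2 = b.2
        · rw [impl_kind_of_eq hab, hI]
        · rw [impl_kind_of_ne hab, hOr]
      · intro x hx
        rcases List.mem_cons.1 hx with rfl | hx
        · simp
        · simp [hx]
      · intro x hx
        exact List.mem_cons_of_mem _ (List.mem_append_right _ (List.mem_map.2 ⟨x, hx, rfl⟩))
    by_cases hE : A (.par false) = true
    -- A star of equations on each side, and a two-cycle of clauses between the centres.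
    · refine ⟨impl (x₀, true) (y₀, false) :: impl (y₀, false) (x₀, true) ::
        (P.map (fun x => eqCon (x, true) (x₀, true)) ++ Q.map fun y => eqCon (y, false) (y₀, false)),
        ?_, ?_, by simp [cost, hX, hE]; omega⟩
      · intro c hc
        simp only [List.mem_cons, List.mem_append, List.mem_map] at hc
        rcases hc with rfl | rfl | ⟨x, hx, rfl⟩ | ⟨x, hx, rfl⟩
        · exact ⟨hOr _, _, _, hx₀, hy₀, Or.inl rfl⟩
        · exact ⟨hOr _, _, _, hy₀, hx₀, Or.inl rfl⟩
        · exact ⟨hE, _, _, (hP x).1 (by simp [hx]), hx₀, Or.inr rfl⟩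
        · exact ⟨hE, _, _, (hQ x).1 (by simp [hx]), hy₀, Or.inr rfl⟩
      · intro α hα
        have h₁ := holds_impl.1 (hα (impl (x₀, true) (y₀, false)) (by simp))
        have h₂ := holds_impl.1 (hα (impl (y₀, false) (x₀, true)) (by simp))
        refine ⟨(x₀, true), fun x hx => ?_, fun x hx => ?_⟩ <;> rcases List.mem_cons.1 hx with rfl | hx
        · rfl
        · exact holds_eqCon.1 (hα _ (List.mem_cons_of_mem _ (List.mem_cons_of_mem _
            (List.mem_append_left _ (List.mem_map.2 ⟨x, hx, rfl⟩)))))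
        · exact ⟨h₂, h₁⟩
        · refine Iff.trans ?_ ⟨h₂, h₁⟩
          exact holds_eqCon.1 (hα _ (List.mem_cons_of_mem _ (List.mem_cons_of_mem _
            (List.mem_append_right _ (List.mem_map.2 ⟨x, hx, rfl⟩)))))
    -- Only `or` kinds are left, so the closed walk must alternate between the sides; its length is
    -- twice the size of the larger one.
    · obtain ⟨l, h₁, h₂, h₃, h₄⟩ := exists_zip x₀ y₀ P Q
      have hmem : ∀ v ∈ alternate l, Eqv φ v (r, true) := by
        intro v hv
        obtain ⟨p, hp, hv⟩ := List.mem_flatMap.1 hv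
        have := h₂ p hp
        simp only [List.mem_cons, List.not_mem_nil, or_false] at hv
        rcases hv with rfl | rfl
        · exact (hP _).1 this.1
        · exact (hQ _).1 this.2
      refine hcycle (x₀, true) ((y₀, false) :: alternate l) ?_ ?_ ?_ ?_ ?_
      · intro v hv
        simp only [List.mem_cons] at hv
        rcases hv with rfl | rfl | hv
        · exact hx₀
        · exact hy₀
        · exact hmem v hv
      · rw [List.cons_append, List.isChain_cons_cons]
        refine ⟨hOr _, (isChain_alternate rfl rfl l).imp fun a b hab => ?_⟩
        rw [impl_kind_of_ne hab, hOr]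
      · intro x hx
        rcases List.mem_cons.1 hx with rfl | hx
        · simp
        · obtain ⟨b, hb⟩ := h₃ x hx
          exact List.mem_cons_of_mem _ (List.mem_cons_of_mem _
            (List.mem_flatMap.2 ⟨_, hb, by simp⟩))
      · intro x hx
        rcases List.mem_cons.1 hx with rfl | hx
        · simp
        · obtain ⟨b, hb⟩ := h₄ x hx
          exact List.mem_cons_of_mem _ (List.mem_cons_of_mem _
            (List.mem_flatMap.2 ⟨_, hb, by simp⟩))
      · simp [cost, hX, hE, hI, length_alternate, h₁]
        omega

end

end MinEquiv

namespace MinEquiv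

/-! ### Optimal formulas -/

/-- Choose one element from each orbit of a fixed-point-free involution. It is applied to
contraposition of neighbouring pairs. -/
theorem exists_half {M : Type} [DecidableEq M] (m : M → M) (hm : ∀ p, m (m p) = p) (n : ℕ) :
    ∀ K : Finset M, K.card = n → (∀ p ∈ K, m p ∈ K ∧ m p ≠ p) →
    ∃ T : List M, (∀ p ∈ T, p ∈ K) ∧ (∀ p ∈ K, p ∈ T ∨ m p ∈ T) ∧ 2 * T.length ≤ K.card := by
  induction n using Nat.strong_induction_on with
  | _ n ih =>
    intro K hn hK
    rcases K.eq_empty_or_nonempty with rfl | ⟨p, hp⟩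
    · exact ⟨[], by simp, by simp, by simp⟩
    · obtain ⟨hmp, hne⟩ := hK p hp
      have hmp' : m p ∈ K.erase p := Finset.mem_erase.2 ⟨hne, hmp⟩
      have hc : ((K.erase p).erase (m p)).card + 2 = K.card := by
        have h₁ := Finset.card_erase_add_one hmp'
        have h₂ := Finset.card_erase_add_one hp
        omega
      obtain ⟨T, h₁, h₂, h₃⟩ := ih _ (by omega) ((K.erase p).erase (m p)) rfl fun q hq => by
        simp only [Finset.mem_erase] at hq ⊢
        refine ⟨⟨fun e => hq.2.1 ?_, fun e => hq.1 ?_, (hK q hq.2.2).1⟩, (hK q hq.2.2).2⟩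
        · rw [← hm q, e, hm]
        · rw [← hm q, e]
      refine ⟨p :: T, ?_, ?_, by simp; omega⟩
      · intro q hq
        rcases List.mem_cons.1 hq with rfl | hq
        · exact hp
        · exact Finset.mem_of_mem_erase (Finset.mem_of_mem_erase (h₁ q hq))
      · intro q hq
        by_cases e₁ : q = p
        · simp [e₁]
        by_cases e₂ : q = m p
        · right
          rw [e₂, hm]
          simp
        rcases h₂ q (by simp [e₁, e₂, hq]) with h | h
        · simp [h]
        · simp [h]

section

variable {V : Type} {φ : List (Con V)} {le : Lit V → Lit V → Bool} {vs : List V}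

theorem neg_mem_covers (h : Decides φ le vs) {a b : Lit V} (hab : (a, b) ∈ covers le vs) :
    (neg b, neg a) ∈ covers le vs := by
  rw [h.mem_covers] at hab ⊢
  obtain ⟨ha, hb, hlt, hz⟩ := hab
  refine ⟨hb, ha, by rwa [le_neg_iff, le_neg_iff], fun z hzr hzz => hz (neg z) hzr ?_⟩
  rw [← le_neg_iff (v := neg z), ← le_neg_iff (u := neg z), ← le_neg_iff (v := b),
    ← le_neg_iff (u := b), neg_neg]
  exact ⟨hzz.2, hzz.1⟩

/-- Constraints for the order of the classes. -/
theorem exists_order (h : Decides φ le vs) {A : Kind → Bool} (hA : ∀ c ∈ φ, A c.1 = true) :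
    ∃ ψ : List (Con V), (∀ c ∈ ψ, Allowed A φ c) ∧
      (∀ α, Sat ψ α → Respects φ α →
        ∀ p ∈ covers le vs, IsTrue p.1 α → IsTrue p.2 α) ∧
      2 * ψ.length ≤ (covers le vs).length := by
  classical
  obtain ⟨T, h₁, h₂, h₃⟩ := exists_half (fun p : Lit V × Lit V => (neg p.2, neg p.1))
    (by simp) _ (covers le vs).toFinset rfl fun p hp => by
      rw [List.mem_toFinset] at hp ⊢
      refine ⟨neg_mem_covers h hp, fun e => h.not_same_of_covers hp ?_⟩
      have : p.2.1 = p.1.1 := congrArg (fun q => q.1.1) e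
      rw [this]
      exact ⟨true, true, Eqv.refl _ _⟩
  rw [List.toFinset_card_of_nodup h.nodup_covers] at h₃
  -- The constraints are taken from `φ` itself, so their kinds are available. They link literals
  -- that are only equivalent to the pair, which is harmless for assignments that respect the
  -- classes.
  have hex : ∀ p ∈ covers le vs, ∃ c ∈ φ, ∀ α, Holds c α → Respects φ α →
      IsTrue p.1 α → IsTrue p.2 α := by
    rintro ⟨a, b⟩ hp
    obtain ⟨a', b', ⟨c, hc, he⟩, ha, hb⟩ := h.exists_edge hp
    obtain ⟨har, hbr, -, -⟩ := h.mem_covers.1 hp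
    refine ⟨c, hc, fun α hα hR hat => ?_⟩
    rw [hR b b' (h.mem_reps hbr).2 hb.symm]
    exact holds_iff_edges.1 hα _ _ he ((hR a a' (h.mem_reps har).2 ha.symm).1 hat)
  have : ∀ p, ∃ c, p ∈ covers le vs → c ∈ φ ∧ ∀ α, Holds c α → Respects φ α →
      IsTrue p.1 α → IsTrue p.2 α := by
    intro p
    by_cases hp : p ∈ covers le vs
    · obtain ⟨c, hc⟩ := hex p hp
      exact ⟨c, fun _ => hc⟩
    · exact ⟨(.top, p.1.1, p.1.1), fun h' => absurd h' hp⟩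
  choose f hf using this
  refine ⟨T.map f, fun c hc => ?_, fun α hα hR p hp => ?_, by simpa using h₃⟩
  · obtain ⟨p, hp, rfl⟩ := List.mem_map.1 hc
    have := hf p (List.mem_toFinset.1 (h₁ p hp))
    exact ⟨hA _ this.1, fun α hα => hα _ this.1⟩
  · rcases h₂ p (List.mem_toFinset.2 hp) with hT | hT
    · exact (hf p hp).2 α (hα _ (List.mem_map_of_mem hT)) hR
    · have := (hf _ (neg_mem_covers h hp)).2 α (hα _ (List.mem_map_of_mem hT)) hR
      simp only [isTrue_neg] at this
      tauto

/-- The order of the representatives is generated by pairs of neighbours. -/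
theorem isTrue_of_covers (h : Decides φ le vs) {α : V → Bool}
    (hα : ∀ p ∈ covers le vs, IsTrue p.1 α → IsTrue p.2 α) (n : ℕ) : ∀ a b : Lit V,
    (repLits le vs).countP (fun z => le a z && le z b) = n → a.1 ∈ reps le vs → b.1 ∈ reps le vs →
    Le φ a b → IsTrue a α → IsTrue b α := by
  induction n using Nat.strong_induction_on with
  | _ n ih =>
    intro a b hn ha hb hab hat
    by_cases hba : Le φ b a
    · rwa [← h.eq_of_eqv ha hb ⟨hab, hba⟩]
    by_cases hc : (a, b) ∈ covers le vs
    · exact hα _ hc hat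
    rw [h.mem_covers] at hc
    push Not at hc
    obtain ⟨z, hz, ⟨h₁, h₂⟩, h₃, h₄⟩ := hc ha hb ⟨hab, hba⟩
    -- A subinterval which misses a literal `w` of the interval contains fewer literals. Below, `w`
    -- is the end of the interval that is replaced by `z`.
    have hlt : ∀ a' b' w, w.1 ∈ reps le vs → Le φ a a' → Le φ b' b → Le φ a w → Le φ w b →
        ¬ (Le φ a' w ∧ Le φ w b') →
        (repLits le vs).countP (fun z => le a' z && le z b') < n := by
      intro a' b' w hw h₁ h₂ h₃ h₄ h₅
      rw [← hn, List.countP_eq_length_filter, List.countP_eq_length_filter]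
      have hsub : (repLits le vs).filter (fun z => le a' z && le z b') =
          ((repLits le vs).filter (fun z => le a z && le z b)).filter
            fun z => le a' z && le z b' := by
        rw [List.filter_filter]
        refine List.filter_congr fun z _ => ?_
        rw [Bool.eq_iff_iff]
        simp only [Bool.and_eq_true, h.le_iff]
        exact ⟨fun hz => ⟨hz, h₁.trans hz.1, hz.2.trans h₂⟩, fun hz => hz.1⟩
      rw [hsub]
      refine List.length_filter_lt_length_iff_exists.2 ⟨w, ?_, ?_⟩
      · simp [List.mem_filter, Decides.mem_repLits, hw, h.le_iff, h₃, h₄]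
      · simpa [h.le_iff] using h₅
    have hzt := ih _ (hlt a z b hb (Le.refl _ _) h₃ hab (Le.refl _ _) fun h' => h₄ h'.2) a z rfl ha hz
      h₁ hat
    exact ih _ (hlt z b a ha h₁ (Le.refl _ _) (Le.refl _ _) hab fun h' => h₂ h'.1) z b rfl hz hb
      h₃ hzt

/-- Each implication of `φ` is recovered from the parts. If one of its literals is forced, forcing
alone decides it; between free literals it is carried over to the representatives, where it follows
from chains of neighbours. -/
theorem sat_of_parts (h : Decides φ le vs) {α : V → Bool} (hR : Respects φ α)
    (hF : ∀ x b, Forced φ (x, b) → α x = b)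
    (hα : ∀ p ∈ covers le vs, IsTrue p.1 α → IsTrue p.2 α) : Sat φ α := by
  intro c hc
  rw [holds_iff_edges]
  intro u v huv hu
  have hle : Le φ u v := Edge.le ⟨c, hc, huv⟩
  have hF' : ∀ w : Lit V, Forced φ w → IsTrue w α := fun w hw => hF w.1 w.2 hw
  have hcases : ∀ w : Lit V, Free φ w.1 ∨ Forced φ w ∨ Forced φ (neg w) := by
    intro w
    by_contra! hn
    refine hn.1 fun b hb => ?_
    rcases eq_or_eq_neg (u := (w.1, b)) (v := w) rfl with e | e <;> rw [e] at hb
    · exact hn.2.1 hb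
    · exact hn.2.2 hb
  rcases hcases u with hfu | hfu | hfu
  · rcases hcases v with hfv | hfv | hfv
    · by_cases e : u = v
      · exact e ▸ hu
      obtain ⟨hu', hv'⟩ := h.mem_of_le u v hfu hfv hle e
      obtain ⟨a, ha, hua⟩ := h.exists_repLit hu' hfu
      obtain ⟨b, hb, hvb⟩ := h.exists_repLit hv' hfv
      rw [hR v b hfv hvb]
      exact isTrue_of_covers h hα _ a b rfl ha hb (hua.2.trans (hle.trans hvb.1))
        ((hR u a hfu hua).1 hu)
    · exact hF' _ hfv
    · exact absurd (hfv.le hle.neg) (Free.not_forced (u := neg u) hfu)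
  · exact hF' _ (hfu.le hle)
  · exact absurd hu ((isTrue_neg _ _).1 (hF' _ hfu))

/-- There is an equivalent formula with the optimal number of constraints. -/
theorem exists_optimal (h : Decides φ le vs) {A : Kind → Bool} (hA : ∀ c ∈ φ, A c.1 = true) :
    ∃ ψ : List (Con V), (∀ c ∈ ψ, A c.1 = true) ∧ (∀ α, Sat ψ α ↔ Sat φ α) ∧
      2 * ψ.length ≤ twiceOpt le vs A := by
  obtain ⟨ψ₁, h₁, h₁', h₁''⟩ := exists_forcing h hA
  have : ∀ r, ∃ ψ : List (Con V), r ∈ reps le vs → (∀ c ∈ ψ, Allowed A φ c) ∧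
      (∀ α, Sat ψ α → ∀ u, Eqv φ u (r, true) → (IsTrue u α ↔ IsTrue (r, true) α)) ∧
      ψ.length ≤ cost A (side le vs r true).length (side le vs r false).length := by
    intro r
    by_cases hr : r ∈ reps le vs
    · obtain ⟨ψ, hψ⟩ := exists_class h hA hr
      exact ⟨ψ, fun _ => hψ⟩
    · exact ⟨[], fun h' => absurd h' hr⟩
  choose f hf using this
  obtain ⟨ψ₃, h₃, h₃', h₃''⟩ := exists_order h hA
  have hall : ∀ c ∈ ψ₁ ++ (reps le vs).flatMap f ++ ψ₃, Allowed A φ c := by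
    intro c hc
    simp only [List.mem_append, List.mem_flatMap] at hc
    rcases hc with (hc | ⟨r, hr, hc⟩) | hc
    · exact h₁ c hc
    · exact (hf r hr).1 c hc
    · exact h₃ c hc
  refine ⟨ψ₁ ++ (reps le vs).flatMap f ++ ψ₃, fun c hc => (hall c hc).1,
    fun α => ⟨fun hα => ?_, fun hα c hc => (hall c hc).2 α hα⟩, ?_⟩
  · have hα₁ : Sat ψ₁ α := fun c hc => hα c (by simp [hc])
    have hα₂ : ∀ r ∈ reps le vs, Sat (f r) α := fun r hr c hc => hα c
      (List.mem_append_left _ (List.mem_append_right _ (List.mem_flatMap.2 ⟨r, hr, hc⟩)))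
    have hα₃ : Sat ψ₃ α := fun c hc => hα c (by simp [hc])
    -- The constraints of the classes must be evaluated before the others, since the forcing and the
    -- order parts are correct only for assignments which respect the classes.
    have hR : Respects φ α := by
      intro u v hu huv
      have hv := Free.of_eqv hu huv
      by_cases e : u = v
      · rw [e]
      obtain ⟨hu', -⟩ := h.mem_of_le u v hu hv huv.1 e
      obtain ⟨⟨r, t⟩, hr, hur⟩ := h.exists_repLit hu' hu
      have key : ∀ w, Eqv φ w (r, t) → (IsTrue w α ↔ IsTrue (r, t) α) := by
        intro w hw
        have := (hf r hr).2.1 α (hα₂ r hr)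
        cases t
        · have := this (neg w) hw.neg
          rw [isTrue_neg] at this
          rw [← not_iff_not, this, ← isTrue_neg]
          rfl
        · exact this w hw
      rw [key u hur, key v (huv.symm.trans hur)]
    exact sat_of_parts h hR (h₁' α hα₁ hR) (h₃' α hα₃ hR)
  · have h₂ : ((reps le vs).flatMap f).length ≤ ((reps le vs).map fun r =>
        cost A (side le vs r true).length (side le vs r false).length).sum := by
      rw [List.length_flatMap]
      exact List.sum_le_sum fun r hr => (hf r hr).2.2
    simp only [List.length_append, twiceOpt]
    omega

end

end MinEquiv

namespace MinEquiv

/-! ### Computing the optimum -/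

/-- Membership in a list. -/
def has {M : Type} [DecidableEq M] (E : List M) (p : M) : Bool := E.any fun q => decide (q = p)

theorem has_iff {M : Type} [DecidableEq M] {E : List M} {p : M} : has E p = true ↔ p ∈ E := by
  simp [has]

section

variable {V : Type}

/-- Every single constraint other than XOR is satisfied by a constant assignment. -/
theorem two_le_of_unsat {A : Kind → Bool} (hX : A (.par true) = false) {ψ : List (Con V)}
    (hA : ∀ c ∈ ψ, A c.1 = true) (h : ¬ ∃ α, Sat ψ α) : 2 ≤ ψ.length := by
  by_contra hlt
  rcases ψ with _ | ⟨c, _ | ⟨d, ψ⟩⟩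
  · exact h ⟨fun _ => true, by simp [Sat]⟩
  · have hc := hA c (by simp)
    refine h ⟨fun _ => if c.1 = .unit false ∨ c.1 = .or false then false else true, fun c' hc' => ?_⟩
    rw [List.mem_singleton] at hc'
    subst hc'
    rcases c' with ⟨_ | s | s | _ | d, y, z⟩
    · rfl
    · cases s <;> rfl
    · cases s <;> rfl
    · rfl
    · cases d
      · rfl
      · rw [hX] at hc
        simp at hc
  · simp at hlt

/-- Otherwise the constant `!s` would be a model. So literals of both signs can be written, which
gives a contradiction with two constraints. -/
theorem exists_unsat {A : Kind → Bool} (hX : A (.par true) = false) {φ : List (Con V)}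
    (hA : ∀ c ∈ φ, A c.1 = true) (h : ¬ ∃ α, Sat φ α) (s : Bool) :
    A (.unit s) = true ∨ A (.or s) = true := by
  by_contra! hn
  refine h ⟨fun _ => !s, fun c hc => ?_⟩
  have := hA c hc
  rcases c with ⟨_ | t | t | _ | d, y, z⟩
  · rfl
  · have : t = !s := Bool.eq_not.2 fun e => hn.1 (e ▸ this)
    simp [Holds, Kind.holds, this]
  · have : t = !s := Bool.eq_not.2 fun e => hn.2 (e ▸ this)
    simp [Holds, Kind.holds, this]
  · simp [Holds, Kind.holds]
  · cases d
    · simp [Holds, Kind.holds]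
    · rw [hX] at this
      simp at this

variable [DecidableEq V]

/-- The variables of a formula. -/
def vars (φ : List (Con V)) : List V :=
  distinct (fun x y => decide (x = y)) (φ.flatMap fun c => [c.2.1, c.2.2])

/-- The literals of a formula. -/
def lits (φ : List (Con V)) : List (Lit V) := vars φ ×ˢ [true, false]

/-- One round of the computation of the transitive closure. -/
def closeStep (L : List (Lit V)) (E : List (Lit V × Lit V)) (w : Lit V) : List (Lit V × Lit V) :=
  (L ×ˢ L).filter fun p => has E p || (has E (p.1, w) && has E (w, p.2))

/-- The transitive closure of the implications of a formula. -/
def implications (φ : List (Con V)) : List (Lit V × Lit V) :=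
  (lits φ).foldl (closeStep (lits φ)) (φ.flatMap conEdges)

/-- The order of the literals which is given by a list of implications. -/
def leOf (E : List (Lit V × Lit V)) (u v : Lit V) : Bool :=
  decide (u = v) || has E (u, v) || has E (u, neg u) || has E (neg v, v)

/-- Satisfiability, by means of the list of implications. -/
def consistent (E : List (Lit V × Lit V)) (vs : List V) : Bool :=
  vs.all fun x => !(has E ((x, true), (x, false)) && has E ((x, false), (x, true)))

/-- Twice the minimal number of constraints. -/
def twiceMin (A : Kind → Bool) (φ : List (Con V)) : ℕ :=
  if consistent (implications φ) (vars φ) then twiceOpt (leOf (implications φ)) (vars φ) A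
  else if A (.par true) then 2 else 4

theorem mem_vars {φ : List (Con V)} {x : V} :
    x ∈ vars φ ↔ ∃ c ∈ φ, x = c.2.1 ∨ x = c.2.2 := by
  have : x ∈ vars φ ↔ x ∈ φ.flatMap fun c => [c.2.1, c.2.2] := by
    refine ⟨mem_of_mem_distinct, fun h => ?_⟩
    obtain ⟨y, hy, hxy⟩ := exists_mem_distinct (s := fun x y => decide (x = y)) h (by simp)
    rwa [of_decide_eq_true hxy]
  simp [this]

theorem nodup_vars (φ : List (Con V)) : (vars φ).Nodup :=
  (pairwise_distinct _).imp fun h => of_decide_eq_false h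

theorem mem_lits {φ : List (Con V)} {u : Lit V} : u ∈ lits φ ↔ u.1 ∈ vars φ := by
  rcases u with ⟨x, _ | _⟩ <;> simp [lits]

theorem mem_lits_of_edge {φ : List (Con V)} {u v : Lit V} (h : Edge φ u v) :
    u ∈ lits φ ∧ v ∈ lits φ := by
  obtain ⟨c, hc, h⟩ := h
  rw [mem_lits, mem_lits, mem_vars, mem_vars]
  rcases fst_of_mem_conEdges h with ⟨h₁, h₂⟩ | ⟨h₁, h₂⟩
  · exact ⟨⟨c, hc, Or.inl h₁⟩, c, hc, Or.inr h₂⟩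
  · exact ⟨⟨c, hc, Or.inr h₁⟩, c, hc, Or.inl h₂⟩

theorem closeStep_sublist (L : List (Lit V)) (E : List (Lit V × Lit V)) (w : Lit V) :
    (closeStep L E w).Sublist (L ×ˢ L) :=
  List.filter_sublist

theorem mem_closeStep {L : List (Lit V)} {E : List (Lit V × Lit V)} {w u v : Lit V} :
    (u, v) ∈ closeStep L E w ↔
      (u ∈ L ∧ v ∈ L) ∧ ((u, v) ∈ E ∨ (u, w) ∈ E ∧ (w, v) ∈ E) := by
  simp [closeStep, has_iff]

/-- Warshall's algorithm. The invariant is transitivity through the pivots in `S` that have been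
treated; a round for `w` preserves it and adds `w`, and it never creates a pair outside the
transitive closure. -/
theorem foldl_closeStep (L : List (Lit V)) (R : Lit V → Lit V → Prop) (l : List (Lit V)) :
    ∀ (E : List (Lit V × Lit V)) (S : Set (Lit V)), (∀ u v, (u, v) ∈ E → u ∈ L ∧ v ∈ L) →
    (∀ u v, (u, v) ∈ E → Relation.TransGen R u v) →
    (∀ w ∈ S, ∀ u v, (u, w) ∈ E → (w, v) ∈ E → (u, v) ∈ E) →
    (∀ u v, (u, v) ∈ l.foldl (closeStep L) E → Relation.TransGen R u v) ∧
    (∀ u v, (u, v) ∈ E → (u, v) ∈ l.foldl (closeStep L) E) ∧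
    (∀ u v, (u, v) ∈ l.foldl (closeStep L) E → u ∈ L ∧ v ∈ L) ∧
    ∀ w, w ∈ S ∨ w ∈ l → ∀ u v, (u, w) ∈ l.foldl (closeStep L) E →
      (w, v) ∈ l.foldl (closeStep L) E → (u, v) ∈ l.foldl (closeStep L) E := by
  induction l with
  | nil => exact fun E S h₁ h₂ h₃ => ⟨h₂, fun _ _ h => h, h₁, by simpa using h₃⟩
  | cons w l ih =>
    intro E S h₁ h₂ h₃
    have hc : ∀ z ∈ insert w S, ∀ u v, (u, z) ∈ closeStep L E w → (z, v) ∈ closeStep L E w →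
        (u, v) ∈ closeStep L E w := by
      intro z hz u v hu hv
      simp only [mem_closeStep] at hu hv ⊢
      refine ⟨⟨hu.1.1, hv.1.2⟩, ?_⟩
      rcases Set.mem_insert_iff.1 hz with rfl | hz
      · exact Or.inr ⟨hu.2.elim id fun h => h.1, hv.2.elim id fun h => h.2⟩
      · rcases hu.2 with hu | hu <;> rcases hv.2 with hv | hv
        · exact Or.inl (h₃ z hz u v hu hv)
        · exact Or.inr ⟨h₃ z hz u w hu hv.1, hv.2⟩
        · exact Or.inr ⟨hu.1, h₃ z hz w v hu.2 hv⟩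
        · exact Or.inr ⟨hu.1, hv.2⟩
    obtain ⟨h₄, h₅, h₆, h₇⟩ := ih (closeStep L E w) (insert w S)
      (fun u v h => (mem_closeStep.1 h).1)
      (fun u v h => (mem_closeStep.1 h).2.elim (h₂ u v) fun h => (h₂ _ _ h.1).trans (h₂ _ _ h.2)) hc
    refine ⟨h₄, fun u v h => h₅ u v (mem_closeStep.2 ⟨h₁ u v h, Or.inl h⟩), h₆, fun z hz => h₇ z ?_⟩
    rcases hz with hz | hz
    · exact Or.inl (Set.mem_insert_of_mem _ hz)
    · rcases List.mem_cons.1 hz with rfl | hz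
      · exact Or.inl (Set.mem_insert _ _)
      · exact Or.inr hz

theorem mem_implications {φ : List (Con V)} {u v : Lit V} :
    (u, v) ∈ implications φ ↔ Relation.TransGen (Edge φ) u v := by
  have hE : ∀ u v, (u, v) ∈ φ.flatMap conEdges ↔ Edge φ u v := by simp [Edge]
  obtain ⟨h₁, h₂, h₃, h₄⟩ := foldl_closeStep (lits φ) (Edge φ) (lits φ) (φ.flatMap conEdges) ∅
    (fun u v h => mem_lits_of_edge ((hE u v).1 h)) (fun u v h => .single ((hE u v).1 h)) (by simp)
  refine ⟨h₁ u v, fun h => ?_⟩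
  induction h with
  | single h => exact h₂ _ _ ((hE _ _).2 h)
  | tail _ h ih =>
    exact h₄ _ (Or.inr (mem_lits_of_edge h).1) _ _ ih (h₂ _ _ ((hE _ _).2 h))

theorem has_neg_iff {φ : List (Con V)} {u : Lit V} :
    has (implications φ) (u, neg u) = true ↔ Reach φ u (neg u) := by
  rw [has_iff, mem_implications, Reach, Relation.reflTransGen_iff_eq_or_transGen]
  simp [neg_ne]

theorem consistent_iff {φ : List (Con V)} :
    consistent (implications φ) (vars φ) = true ↔ ∃ α, Sat φ α := by
  rw [satisfiable_iff]
  have : ∀ x, (has (implications φ) ((x, true), (x, false)) = true ↔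
      Reach φ (x, true) (x, false)) ∧ (has (implications φ) ((x, false), (x, true)) = true ↔
      Reach φ (x, false) (x, true)) := fun x =>
    ⟨has_neg_iff (u := (x, true)), has_neg_iff (u := (x, false))⟩
  simp only [consistent, List.all_eq_true, Bool.not_eq_true', Bool.eq_false_iff, ne_eq,
    Bool.and_eq_true, this, mem_vars]
  exact ⟨fun h c hc x hx => h x ⟨c, hc, hx⟩, fun h x ⟨c, hc, hx⟩ => h c hc x hx⟩

/-- `leOf` is `le_iff_reach` read on the computed closure. The equality test supplies the empty
path, which the irreflexive closure lacks. -/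
theorem decides_implications {φ : List (Con V)} (hφ : ∃ α, Sat φ α) :
    Decides φ (leOf (implications φ)) (vars φ) where
  sat := hφ
  le_iff u v := by
    have h₁ := has_neg_iff (φ := φ) (u := u)
    have h₂ := has_neg_iff (φ := φ) (u := neg v)
    rw [neg_neg] at h₂
    rw [le_iff_reach hφ, ← h₁, ← h₂]
    simp only [leOf, Bool.or_eq_true, decide_eq_true_eq, has_iff (p := (u, v)), mem_implications,
      Reach, Relation.reflTransGen_iff_eq_or_transGen, or_assoc, eq_comm (a := v)]
  nodup := nodup_vars φ
  mem_of_forced x b h := by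
    obtain ⟨c, hc, hx⟩ := exists_mem_supp hφ h
    refine mem_vars.2 ⟨c, hc, ?_⟩
    rcases c with ⟨_ | s | s | _ | d, y, z⟩ <;> simp_all [supp]
  mem_of_le u v hu hv h hne := by
    have := reach_of_le hφ hu hv h
    refine ⟨?_, ?_⟩
    · rcases Relation.ReflTransGen.cases_head this with e | ⟨w, he, -⟩
      · exact absurd e hne
      · exact mem_lits.1 (mem_lits_of_edge he).1
    · rcases Relation.ReflTransGen.cases_tail this with e | ⟨w, -, he⟩
      · exact absurd e.symm hne
      · exact mem_lits.1 (mem_lits_of_edge he).2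

/-- The computed number is the minimum. -/
theorem exists_equivalent_iff {A : Kind → Bool} {φ : List (Con V)} (hA : ∀ c ∈ φ, A c.1 = true)
    (n : ℕ) : (∃ ψ : List (Con V), (∀ c ∈ ψ, A c.1 = true) ∧ (∀ α, Sat ψ α ↔ Sat φ α) ∧
      ψ.length ≤ n) ↔ twiceMin A φ ≤ 2 * n := by
  rw [twiceMin]
  by_cases hφ : ∃ α, Sat φ α
  · rw [if_pos (consistent_iff.2 hφ)]
    have hd := decides_implications hφ
    constructor
    · rintro ⟨ψ, hψA, hψ, hn⟩
      -- Every field of `Decides` is semantic, so the data computed from `φ` serve for the lower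
      -- bound on `ψ` as well.
      have e : Sat ψ = Sat φ := funext fun α => propext (hψ α)
      have hF : Forced ψ = Forced φ := by unfold Forced; rw [e]
      have hL : Le ψ = Le φ := by unfold Le; rw [e]
      have hFr : Free ψ = Free φ := by unfold Free; rw [hF]
      have hd' : Decides ψ (leOf (implications φ)) (vars φ) := by
        refine ⟨by rw [e]; exact hφ, fun u v => ?_, hd.nodup, ?_, ?_⟩
        · rw [hL]; exact hd.le_iff u v
        · rw [hF]; exact hd.mem_of_forced
        · rw [hL, hFr]; exact hd.mem_of_le
      have := twiceOpt_le hd' hψA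
      omega
    · intro hn
      obtain ⟨ψ, h₁, h₂, h₃⟩ := exists_optimal hd hA
      exact ⟨ψ, h₁, h₂, by omega⟩
  · rw [if_neg (fun h => hφ (consistent_iff.1 h))]
    obtain ⟨c, hc⟩ : ∃ c, c ∈ φ := by
      by_contra! hn
      exact hφ ⟨fun _ => true, fun c hc => absurd hc (hn c)⟩
    have hunsat : ∀ ψ : List (Con V), (∀ α, Sat ψ α ↔ Sat φ α) ↔ ¬ ∃ α, Sat ψ α := fun ψ =>
      ⟨fun h ⟨α, hα⟩ => hφ ⟨α, (h α).1 hα⟩,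
        fun h α => ⟨fun hα => absurd ⟨α, hα⟩ h, fun hα => absurd ⟨α, hα⟩ hφ⟩⟩
    simp only [hunsat]
    cases hX : A (.par true)
    · rw [if_neg (by simp)]
      constructor
      · rintro ⟨ψ, h₁, h₂, h₃⟩
        have := two_le_of_unsat hX h₁ h₂
        omega
      · intro hn
        -- With a repeated variable, `or s` acts as the literal; two opposite literals on a variable
        -- of `φ` give a contradiction.
        have hex : ∀ s, ∃ k : Kind, A k = true ∧ ∀ a, k.holds a a = (a == s) := by
          intro s
          rcases exists_unsat hX hA hφ s with h | h
          · exact ⟨_, h, fun a => rfl⟩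
          · exact ⟨_, h, fun a => by simp [Kind.holds]⟩
        choose k hk₁ hk₂ using hex
        refine ⟨[(k true, c.2.1, c.2.1), (k false, c.2.1, c.2.1)], ?_, ?_, by simpa using by omega⟩
        · simp [hk₁]
        · rintro ⟨α, hα⟩
          have h₁ := hα (k true, c.2.1, c.2.1) (by simp)
          have h₂ := hα (k false, c.2.1, c.2.1) (by simp)
          simp only [Holds, hk₂, beq_iff_eq] at h₁ h₂
          rw [h₁] at h₂
          simp at h₂
    · rw [if_pos rfl]
      constructor
      · rintro ⟨ψ, h₁, h₂, h₃⟩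
        rcases ψ with _ | ⟨d, ψ⟩
        · exact absurd ⟨fun _ => true, by simp [Sat]⟩ h₂
        · simp only [List.length_cons] at h₃
          omega
      · intro hn
        refine ⟨[(.par true, c.2.1, c.2.1)], by simp [hX], ?_, by simp; omega⟩
        rintro ⟨α, hα⟩
        have := hα _ (List.mem_singleton_self _)
        simp [Holds, Kind.holds] at this

end

end MinEquiv

namespace MinEquiv

open StackProg Polynomial

/-! ### The optimum is computed in polynomial time -/

noncomputable instance : Enc Kind := finEnc Kind

theorem enc_pair_injective {α β : Type} [Enc α] [Enc β]
    (hα : Function.Injective (Enc.enc : α → Tree)) (hβ : Function.Injective (Enc.enc : β → Tree)) :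
    Function.Injective (Enc.enc : α × β → Tree) := by
  rintro ⟨a, b⟩ ⟨a', b'⟩ h
  simp only [Enc.enc, Tree.cons.injEq] at h
  rw [hα h.1, hβ h.2]

section

variable {α β γ V : Type} [Enc α] [Enc β] [Enc γ] [Enc V]

/-- Equality is decided in polynomial time. -/
def PTEq (α : Type) [Enc α] [DecidableEq α] : Prop := PT fun x : α × α => decide (x.1 = x.2)

theorem PTEq.pair [DecidableEq α] [DecidableEq β] (hα : PTEq α) (hβ : PTEq β) : PTEq (α × β) :=
  ((hα.comp ((PT.fst.comp PT.fst).pair (PT.fst.comp PT.snd))).and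
    (hβ.comp ((PT.snd.comp PT.fst).pair (PT.snd.comp PT.snd)))).congr fun x => by
      simp [Prod.ext_iff]

theorem PTEq.eq [DecidableEq α] (hα : PTEq α) {a b : γ → α} (ha : PT a) (hb : PT b) :
    PT fun c => decide (a c = b c) :=
  PT.comp (f := fun c => (a c, b c)) hα (ha.pair hb)

theorem PTEq.has [DecidableEq α] (hα : PTEq α) {E : γ → List α} {p : γ → α} (hE : PT E)
    (hp : PT p) : PT fun c => has (E c) (p c) :=
  PT.any (f := fun c q => decide (q = p c)) (hα.eq PT.snd (hp.comp PT.fst)) hE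

theorem PT.distinct {s : γ → α → α → Bool} (hs : PT fun x : γ × α × α => s x.1 x.2.1 x.2.2)
    {l : γ → List α} (hl : PT l) : PT fun c => distinct (s c) (l c) := by
  refine PT.foldr (f := fun c x acc => if acc.any fun y => s c x y then acc else x :: acc)
    (b := fun _ => []) ?_ hl (PT.const []) ?_
  · refine PT.ite (c := fun z : γ × α × List α => z.2.2.any fun y => s z.1 z.2.1 y) ?_
      (PT.snd.comp PT.snd) ((PT.fst.comp PT.snd).cons (PT.snd.comp PT.snd))
    exact PT.any (f := fun (z : γ × α × List α) y => s z.1 z.2.1 y)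
      (hs.comp ((PT.fst.comp PT.fst).pair ((PT.fst.comp (PT.snd.comp PT.fst)).pair PT.snd)))
      (PT.snd.comp PT.snd)
  · obtain ⟨q, hq⟩ := hl.esize_le
    exact ⟨q, fun c l₁ h =>
      (esize_sublist ((distinct_sublist (s c) l₁).trans h.sublist)).trans (hq c)⟩

theorem pt_neg {u : γ → Lit V} (hu : PT u) : PT fun c => neg (u c) :=
  (PT.fst.comp hu).pair (PT.not (PT.snd.comp hu))

theorem pt_lit {x : γ → V} (hx : PT x) (b : Bool) : PT fun c => ((x c, b) : Lit V) :=
  hx.pair (PT.const b)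

theorem pt_holds : PT fun x : Kind × Bool × Bool => x.1.holds x.2.1 x.2.2 :=
  PT.of_finite (enc_pair_injective (finEnc_injective Kind)
    (enc_pair_injective enc_bool_injective enc_bool_injective)) _

theorem pt_conEdges : PT fun c : Con V => conEdges c := by
  refine PT.flatMap (f := fun (c : Con V) (p : Bool × Bool) => if c.1.holds p.1 p.2 then [] else
      [((c.2.1, p.1), (c.2.2, !p.2)), ((c.2.2, p.2), (c.2.1, !p.1))]) ?_ (PT.const _)
  have hx : PT fun z : Con V × Bool × Bool => z.1.2.1 := PT.fst.comp (PT.snd.comp PT.fst)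
  have hy : PT fun z : Con V × Bool × Bool => z.1.2.2 := PT.snd.comp (PT.snd.comp PT.fst)
  have ha : PT fun z : Con V × Bool × Bool => z.2.1 := PT.fst.comp PT.snd
  have hb : PT fun z : Con V × Bool × Bool => z.2.2 := PT.snd.comp PT.snd
  exact PT.ite (pt_holds.comp ((PT.fst.comp PT.fst).pair (ha.pair hb))) (PT.const [])
    (((hx.pair ha).pair (hy.pair hb.not)).cons
      (((hy.pair hb).pair (hx.pair ha.not)).cons (PT.const [])))

theorem pt_cost (A : Kind → Bool) {p q : γ → ℕ} (hp : PT p) (hq : PT q) :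
    PT fun c => cost A (p c) (q c) := by
  have h₁ : PT fun c => if (A (.par false) || decide (p c ≤ 1)) then p c - 1 else p c :=
    PT.ite ((PT.const _).or (hp.le (PT.const 1))) (hp.sub (PT.const 1)) hp
  have h₂ : PT fun c => if A (.par true) then p c + q c - 1 else
      if (A .imp || A (.par false)) then p c + q c else
        max (p c) (q c) + max (p c) (q c) :=
    PT.ite (PT.const _) ((hp.add hq).sub (PT.const 1)) (PT.ite (PT.const _) (hp.add hq)
      ((hp.max hq).add (hp.max hq)))
  refine (PT.ite (hq.le (PT.const 0)) h₁ h₂).congr fun c => ?_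
  simp [cost, two_mul]

variable [DecidableEq V]

theorem PTEq.lit (hV : PTEq V) : PTEq (Lit V) := hV.pair PT.bool_eq

theorem pt_vars (hV : PTEq V) : PT fun φ : List (Con V) => vars φ := by
  have h : PT fun φ : List (Con V) => φ.flatMap fun c => [c.2.1, c.2.2] := by
    refine PT.flatMap (f := fun (_ : List (Con V)) (c : Con V) => [c.2.1, c.2.2]) ?_ PT.id
    exact (PT.fst.comp (PT.snd.comp PT.snd)).cons
      ((PT.snd.comp (PT.snd.comp PT.snd)).cons (PT.const []))
  have hs : PT fun x : List (Con V) × V × V => decide (x.2.1 = x.2.2) := hV.comp PT.snd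
  exact PT.distinct (s := fun _ x y => decide (x = y)) hs h

theorem pt_closeStep (hV : PTEq V) {L : γ → List (Lit V)} {E : γ → List (Lit V × Lit V)}
    {w : γ → Lit V} (hL : PT L) (hE : PT E) (hw : PT w) :
    PT fun c => closeStep (L c) (E c) (w c) := by
  have hVE := hV.lit.pair hV.lit
  refine PT.filter (f := fun c p => has (E c) p || (has (E c) (p.1, w c) && has (E c) (w c, p.2)))
    ?_ (hL.product hL)
  have hE' : PT fun z : γ × Lit V × Lit V => E z.1 := hE.comp PT.fst
  have hw' : PT fun z : γ × Lit V × Lit V => w z.1 := hw.comp PT.fst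
  exact (hVE.has hE' PT.snd).or ((hVE.has hE' ((PT.fst.comp PT.snd).pair hw')).and
    (hVE.has hE' (hw'.pair (PT.snd.comp PT.snd))))

theorem pt_implications (hV : PTEq V) : PT fun φ : List (Con V) => implications φ := by
  have hL : PT fun φ : List (Con V) => lits φ := (pt_vars hV).product (PT.const _)
  have hE : PT fun φ : List (Con V) => φ.flatMap conEdges :=
    PT.flatMap (f := fun _ c => conEdges c) (pt_conEdges.comp PT.snd) PT.id
  refine PT.foldl (f := fun φ E w => closeStep (lits φ) E w) (b := fun φ => φ.flatMap conEdges)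
    (pt_closeStep hV (hL.comp PT.fst) (PT.fst.comp PT.snd) (PT.snd.comp PT.snd)) hL hE ?_
  obtain ⟨q, hq⟩ := hE.esize_le
  obtain ⟨r, hr⟩ := (hL.product hL).esize_le
  refine ⟨q + r, fun φ l _ => ?_⟩
  have h₁ := hq φ
  have h₂ := hr φ
  rw [eval_add]
  -- Each round returns a sublist of `lits φ ×ˢ lits φ`, whatever it started from, so the
  -- intermediate lists stay small.
  rcases l.eq_nil_or_concat with rfl | ⟨l, w, rfl⟩
  · rw [List.foldl_nil]
    omega
  · rw [List.concat_eq_append, List.foldl_append, List.foldl_cons, List.foldl_nil]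
    have := esize_sublist (closeStep_sublist (lits φ)
      (l.foldl (fun E w => closeStep (lits φ) E w) (φ.flatMap conEdges)) w)
    omega

section Order

variable {E : γ → List (Lit V × Lit V)} {vs : γ → List V}

theorem pt_leOf (hV : PTEq V) (hE : PT E) {u v : γ → Lit V} (hu : PT u) (hv : PT v) :
    PT fun c => leOf (E c) (u c) (v c) := by
  have hVE := hV.lit.pair hV.lit
  exact (((hV.lit.eq hu hv).or (hVE.has hE (hu.pair hv))).or (hVE.has hE (hu.pair (pt_neg hu)))).or
    (hVE.has hE ((pt_neg hv).pair hv))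

theorem pt_eqvLit (hV : PTEq V) (hE : PT E) {u v : γ → Lit V} (hu : PT u) (hv : PT v) :
    PT fun c => eqvLit (leOf (E c)) (u c) (v c) :=
  (pt_leOf hV hE hu hv).and (pt_leOf hV hE hv hu)

theorem pt_ltLit (hV : PTEq V) (hE : PT E) {u v : γ → Lit V} (hu : PT u) (hv : PT v) :
    PT fun c => ltLit (leOf (E c)) (u c) (v c) :=
  (pt_leOf hV hE hu hv).and (pt_leOf hV hE hv hu).not

theorem pt_forcedVars (hV : PTEq V) (hE : PT E) (hvs : PT vs) (s : Bool) :
    PT fun c => forcedVars (leOf (E c)) (vs c) s :=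
  PT.filter (f := fun c x => leOf (E c) (x, !s) (x, s))
    (pt_leOf hV (hE.comp PT.fst) (pt_lit PT.snd _) (pt_lit PT.snd _)) hvs

theorem pt_freeVars (hV : PTEq V) (hE : PT E) (hvs : PT vs) :
    PT fun c => freeVars (leOf (E c)) (vs c) :=
  PT.filter (f := fun c x => !(leOf (E c) (x, true) (x, false) || leOf (E c) (x, false) (x, true)))
    ((pt_leOf hV (hE.comp PT.fst) (pt_lit PT.snd _) (pt_lit PT.snd _)).or
      (pt_leOf hV (hE.comp PT.fst) (pt_lit PT.snd _) (pt_lit PT.snd _))).not hvs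

theorem pt_reps (hV : PTEq V) (hE : PT E) (hvs : PT vs) :
    PT fun c => reps (leOf (E c)) (vs c) :=
  PT.distinct (s := fun c x y => sameVar (leOf (E c)) x y)
    ((pt_eqvLit hV (hE.comp PT.fst) (pt_lit (PT.fst.comp PT.snd) _)
      (pt_lit (PT.snd.comp PT.snd) _)).or (pt_eqvLit hV (hE.comp PT.fst)
      (pt_lit (PT.fst.comp PT.snd) _) (pt_lit (PT.snd.comp PT.snd) _))) (pt_freeVars hV hE hvs)

theorem pt_side (hV : PTEq V) (hE : PT E) (hvs : PT vs) {r : γ → V} (hr : PT r) (t : Bool) :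
    PT fun c => side (leOf (E c)) (vs c) (r c) t :=
  PT.filter (f := fun c x => eqvLit (leOf (E c)) (x, true) (r c, t))
    (pt_eqvLit hV (hE.comp PT.fst) (pt_lit PT.snd _) (pt_lit (hr.comp PT.fst) _))
    (pt_freeVars hV hE hvs)

theorem pt_covers (hV : PTEq V) (hE : PT E) (hvs : PT vs) :
    PT fun c => covers (leOf (E c)) (vs c) := by
  have hL : PT fun c => repLits (leOf (E c)) (vs c) := (pt_reps hV hE hvs).product (PT.const _)
  refine PT.filter (f := fun c (p : Lit V × Lit V) => ltLit (leOf (E c)) p.1 p.2 &&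
    !(repLits (leOf (E c)) (vs c)).any fun z =>
      ltLit (leOf (E c)) p.1 z && ltLit (leOf (E c)) z p.2) ?_ (hL.product hL)
  refine (pt_ltLit hV (hE.comp PT.fst) (PT.fst.comp PT.snd) (PT.snd.comp PT.snd)).and
    (PT.not ?_)
  refine PT.any (f := fun (y : γ × Lit V × Lit V) z =>
    ltLit (leOf (E y.1)) y.2.1 z && ltLit (leOf (E y.1)) z y.2.2) ?_ (hL.comp PT.fst)
  have hE' : PT fun y : (γ × Lit V × Lit V) × Lit V => E y.1.1 := hE.comp (PT.fst.comp PT.fst)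
  exact (pt_ltLit hV hE' (PT.fst.comp (PT.snd.comp PT.fst)) PT.snd).and
    (pt_ltLit hV hE' PT.snd (PT.snd.comp (PT.snd.comp PT.fst)))

theorem pt_needsExtra (hV : PTEq V) (hE : PT E) (hvs : PT vs) (A : Kind → Bool) :
    PT fun c => needsExtra (leOf (E c)) (vs c) A := by
  have h : ∀ s, PT fun c => (forcedVars (leOf (E c)) (vs c) !s).isEmpty &&
      !(forcedVars (leOf (E c)) (vs c) s).isEmpty && !(A (.unit s) || A (.or s)) := fun s =>
    ((pt_forcedVars hV hE hvs _).isEmpty.and (pt_forcedVars hV hE hvs _).isEmpty.not).and (PT.const _)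
  exact ((h true).or (h false)).congr fun c => by simp [needsExtra]

theorem pt_twiceOpt (hV : PTEq V) (hE : PT E) (hvs : PT vs) (A : Kind → Bool) :
    PT fun c => twiceOpt (leOf (E c)) (vs c) A := by
  have h₁ := (((pt_forcedVars hV hE hvs true).length.add (pt_forcedVars hV hE hvs false).length).add
    ((pt_needsExtra hV hE hvs A).ite (PT.const 1) (PT.const 0))).add (PT.sum (PT.map
      (f := fun c r => cost A (side (leOf (E c)) (vs c) r true).length
        (side (leOf (E c)) (vs c) r false).length)
      (pt_cost A (pt_side hV (hE.comp PT.fst) (hvs.comp PT.fst) PT.snd true).length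
        (pt_side hV (hE.comp PT.fst) (hvs.comp PT.fst) PT.snd false).length) (pt_reps hV hE hvs)))
  exact ((h₁.add h₁).add (pt_covers hV hE hvs).length).congr fun c => by simp only [twiceOpt, two_mul]

theorem pt_consistent (hV : PTEq V) (hE : PT E) (hvs : PT vs) :
    PT fun c => consistent (E c) (vs c) := by
  have hVE := hV.lit.pair hV.lit
  have h : ∀ a b, PT fun y : γ × V => has (E y.1) (((y.2, a), (y.2, b)) : Lit V × Lit V) :=
    fun a b => hVE.has (hE.comp PT.fst) ((pt_lit PT.snd a).pair (pt_lit PT.snd b))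
  exact PT.all (f := fun c x => !(has (E c) ((x, true), (x, false)) &&
    has (E c) ((x, false), (x, true)))) ((h true false).and (h false true)).not hvs

end Order

theorem pt_twiceMin (hV : PTEq V) (A : Kind → Bool) : PT fun φ : List (Con V) => twiceMin A φ :=
  PT.ite (pt_consistent hV (pt_implications hV) (pt_vars hV))
    (pt_twiceOpt hV (pt_implications hV) (pt_vars hV) A) (PT.const _)

end

end MinEquiv

namespace MinEquiv

open StackProg Polynomial

/-! ### Reading an instance -/

/-- Rename the variables of a constraint. -/
def rename {V W : Type} (f : V → W) (c : Con V) : Con W := (c.1, f c.2.1, f c.2.2)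

/-- This allows the algorithm to use bit strings as variables, where unary numbers would be
exponentially long. -/
theorem sat_rename {V W : Type} {f : V → W} {φ : List (Con V)} {β : W → Bool} :
    Sat (φ.map (rename f)) β ↔ Sat φ (β ∘ f) := by
  simp only [Sat, List.forall_mem_map]
  rfl

/-- The input symbols: relation symbols with a kind and the order of the arguments, delimiters,
and bits. -/
abbrev Sym : Type := Bool × Bool × Bool × Kind

/-- The symbol of a relation. -/
def relSym (k : Kind) (sw : Bool) : Sym := (true, true, sw, k)

/-- The delimiter. -/
def sepSym : Sym := (false, true, false, .top)

/-- The symbol of a bit. -/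
def bitSym (b : Bool) : Sym := (false, false, b, .top)

/-- The constraint with a list of arguments. -/
def mkCon {V : Type} (k : Kind) (sw : Bool) (l : List V) : List (Con V) :=
  listCases l [] fun x t =>
    [(k, if sw then (listCases t x fun y _ => y, x) else (x, listCases t x fun y _ => y))]

/-- The state of the parser, which runs from right to left: the arguments which have been read, and
the constraints. -/
abbrev ParseState : Type := List (List Bool) × List (Con (List Bool))

/-- Read one symbol. -/
def parseStep (s : Sym) (st : ParseState) : ParseState :=
  if s.1 then ([], mkCon s.2.2.2 s.2.2.1 st.1 ++ st.2)
  else if s.2.1 then ([] :: st.1, st.2)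
  else (listCases st.1 [] fun a t => (s.2.2.1 :: a) :: t, st.2)

/-- Read a word. -/
def parse (l : List Sym) : ParseState := l.foldr parseStep ([], [])

/-- The value of a binary number, capped at `M`. -/
def cappedValue (M : ℕ) (l : List Bool) : ℕ :=
  l.foldr (fun b n => min M (n + n + if b then 1 else 0)) 0

/-- Decide an instance. -/
def solve (A : Kind → Bool) (l : List Sym) : Bool :=
  listCases (parse l).1 false fun a _ => listCases a false fun sgn bits =>
    !sgn && decide (twiceMin A (parse l).2 ≤
      cappedValue (twiceMin A (parse l).2) bits + cappedValue (twiceMin A (parse l).2) bits)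

/-- The value of a binary number. -/
def value (l : List Bool) : ℕ := l.foldr (fun b n => n + n + if b then 1 else 0) 0

/-- The value of a binary number may be exponential and cannot be written in unary. Doubling
commutes with capping, and a cap at the quantity to be compared does not affect the comparison. -/
theorem cappedValue_eq (M : ℕ) (l : List Bool) : cappedValue M l = min M (value l) := by
  induction l with
  | nil => simp [cappedValue, value]
  | cons b l ih =>
    have h₁ : cappedValue M (b :: l) =
      min M (cappedValue M l + cappedValue M l + if b then 1 else 0) := rfl
    have h₂ : value (b :: l) = value l + value l + if b then 1 else 0 := rfl
    rw [h₁, h₂, ih]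
    omega

theorem value_encodePosNum (n : PosNum) : value (Computability.encodePosNum n) = n := by
  induction n with
  | one => rfl
  | bit0 n ih =>
    have : value (Computability.encodePosNum n.bit0) =
      value (Computability.encodePosNum n) + value (Computability.encodePosNum n) + 0 := rfl
    rw [this, ih]
    simp
  | bit1 n ih =>
    have : value (Computability.encodePosNum n.bit1) =
      value (Computability.encodePosNum n) + value (Computability.encodePosNum n) + 1 := rfl
    rw [this, ih]
    simp

theorem value_encodeNat (n : ℕ) : value (Computability.encodeNat n) = n := by
  rw [Computability.encodeNat]
  rcases h : (n : Num) with _ | m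
  · rw [← Num.to_of_nat n, h]
    rfl
  · rw [← Num.to_of_nat n, h, Computability.encodeNum, value_encodePosNum]
    rfl

theorem solve_eq_true {A : Kind → Bool} {l : List Sym} {sgn : Bool} {n : ℕ}
    {φ : List (Con (List Bool))} (h : parse l = ([sgn :: Computability.encodeNat n], φ)) :
    solve A l = true ↔ sgn = false ∧ twiceMin A φ ≤ 2 * n := by
  simp only [solve, h, listCases, cappedValue_eq, value_encodeNat, Bool.and_eq_true,
    Bool.not_eq_true', decide_eq_true_eq]
  refine and_congr_right fun _ => ?_
  omega

/-! ### The decision procedure in polynomial time -/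

section PT

variable {γ V : Type} [Enc γ] [Enc V]

theorem pt_mkCon {k : γ → Kind} {sw : γ → Bool} {l : γ → List V} (hk : PT k) (hsw : PT sw)
    (hl : PT l) : PT fun c => mkCon (k c) (sw c) (l c) := by
  refine PT.listCases (x := fun _ => []) (f := fun c x t =>
    [(k c, if sw c then (listCases t x fun y _ => y, x) else (x, listCases t x fun y _ => y))])
    hl (PT.const []) ?_
  have hx : PT fun y : γ × V × List V => y.2.1 := PT.fst.comp PT.snd
  have ht : PT fun y : γ × V × List V => listCases y.2.2 y.2.1 fun y _ => y :=
    PT.listCases (l := fun y : γ × V × List V => y.2.2) (x := fun y => y.2.1) (f := fun _ y _ => y)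
      (PT.snd.comp PT.snd) hx (PT.fst.comp PT.snd)
  exact ((hk.comp PT.fst).pair (PT.ite (hsw.comp PT.fst) (ht.pair hx) (hx.pair ht))).cons
    (PT.const [])

theorem pt_parseStep : PT fun x : Sym × ParseState => parseStep x.1 x.2 := by
  have hk : PT fun x : Sym × ParseState => x.1.2.2.2 :=
    PT.snd.comp (PT.snd.comp (PT.snd.comp PT.fst))
  have hb : PT fun x : Sym × ParseState => x.1.2.2.1 :=
    PT.fst.comp (PT.snd.comp (PT.snd.comp PT.fst))
  have hs : PT fun x : Sym × ParseState => x.1.2.1 := PT.fst.comp (PT.snd.comp PT.fst)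
  have ha : PT fun x : Sym × ParseState => x.2.1 := PT.fst.comp PT.snd
  have ho : PT fun x : Sym × ParseState => x.2.2 := PT.snd.comp PT.snd
  refine PT.ite (PT.fst.comp PT.fst) ((PT.const []).pair ((pt_mkCon hk hb ha).append ho))
    (PT.ite hs (((PT.const []).cons ha).pair ho) (PT.pair ?_ ho))
  refine PT.listCases (l := fun x : Sym × ParseState => x.2.1) (x := fun _ => [])
    (f := fun x a t => (x.1.2.2.1 :: a) :: t) ha (PT.const []) ?_
  exact ((hb.comp PT.fst).cons (PT.fst.comp PT.snd)).cons (PT.snd.comp PT.snd)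

theorem esize_mkCon_le (k : Kind) (sw : Bool) (l : List V) :
    esize (mkCon k sw l) ≤ esize k + 2 * esize l + 4 := by
  rcases l with _ | ⟨x, _ | ⟨y, l⟩⟩ <;> cases sw <;> simp [mkCon, listCases] <;> omega

/-- An amortized bound. A relation symbol turns the arguments read so far into a constraint, which
may repeat its only argument and so double its size; the weight 3 on pending arguments pays for
this. -/
theorem exists_esize_parse_le : ∃ K, ∀ l : List Sym,
    3 * esize (parse l).1 + esize (parse l).2 ≤ K * (l.length + 1) := by
  obtain ⟨M, hM⟩ := (Set.finite_range fun k : Kind => esize k).bddAbove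
  refine ⟨M + 20, fun l => ?_⟩
  induction l with
  | nil => simp [parse]
  | cons s l ih =>
    have : parse (s :: l) = parseStep s (parse l) := rfl
    rw [this, List.length_cons, Nat.mul_succ]
    have hk : esize s.2.2.2 ≤ M := hM ⟨_, rfl⟩
    rw [parseStep]
    split_ifs
    · have h₁ := esize_mkCon_le s.2.2.2 s.2.2.1 (parse l).1
      have h₂ := esize_append (mkCon s.2.2.2 s.2.2.1 (parse l).1) (parse l).2
      simp only [esize_nil]
      omega
    · simp only [esize_cons, esize_nil]
      omega
    · have hb := esize_bool_le s.2.2.1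
      rcases h : (parse l).1 with _ | ⟨a, t⟩
      · rw [h] at ih
        simp only [listCases, esize_nil] at ih ⊢
        omega
      · rw [h] at ih
        simp only [listCases, esize_cons] at ih ⊢
        omega

theorem pt_parse : PT fun l : List Sym => parse l := by
  refine PT.foldr (f := fun _ s st => parseStep s st) (b := fun _ => ([], []))
    (pt_parseStep.comp PT.snd) PT.id (PT.const _) ?_
  obtain ⟨K, hK⟩ := exists_esize_parse_le
  refine ⟨C K * (X + 1) + 1, fun l l₁ h => ?_⟩
  have h₁ := hK l₁
  have h₂ := h.length_le.trans (length_le_esize l)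
  have h₃ : K * (l₁.length + 1) ≤ K * (esize l + 1) := Nat.mul_le_mul_left _ (by omega)
  have h₄ : l₁.foldr (fun s st => parseStep s st) ([], []) = parse l₁ := rfl
  have h₅ := esize_pair (parse l₁).1 (parse l₁).2
  simp only [eval_add, eval_mul, eval_C, eval_X, eval_one]
  rw [h₄]
  rw [Prod.mk.eta] at h₅
  omega

theorem pt_cappedValue {M : γ → ℕ} {l : γ → List Bool} (hM : PT M) (hl : PT l) :
    PT fun c => cappedValue (M c) (l c) := by
  have hstep : PT fun x : γ × Bool × ℕ =>
      min (M x.1) (x.2.2 + x.2.2 + if x.2.1 then 1 else 0) := by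
    have hn : PT fun x : γ × Bool × ℕ => x.2.2 := PT.snd.comp PT.snd
    exact (hM.comp PT.fst).min ((hn.add hn).add ((PT.fst.comp PT.snd).ite (PT.const 1) (PT.const 0)))
  have hbound : ∃ q : ℕ[X], ∀ c l₁, l₁ <:+ l c → esize (cappedValue (M c) l₁) ≤ q.eval (esize c) := by
    obtain ⟨q, hq⟩ := hM.esize_le
    refine ⟨q, fun c l₁ _ => le_trans ?_ (hq c)⟩
    rw [cappedValue_eq, esize_nat, esize_nat]
    omega
  have h₀ : PT fun _ : γ => 0 := PT.const 0
  have h := @PT.foldr Bool ℕ γ _ _ _ (fun c b n => min (M c) (n + n + if b then 1 else 0))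
    hstep l (fun _ => 0) hl h₀
  exact h hbound

theorem pt_solve (A : Kind → Bool) : PT fun l : List Sym => solve A l := by
  have hφ : PT fun l : List Sym => twiceMin A (parse l).2 :=
    (pt_twiceMin (PT.list_eq PT.bool_eq) A).comp (PT.snd.comp pt_parse)
  refine PT.listCases (l := fun l : List Sym => (parse l).1) (x := fun _ => false)
    (f := fun l a _ => listCases a false fun sgn bits => !sgn && decide (twiceMin A (parse l).2 ≤
      cappedValue (twiceMin A (parse l).2) bits + cappedValue (twiceMin A (parse l).2) bits))
    (PT.fst.comp pt_parse) (PT.const false) ?_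
  refine PT.listCases (l := fun y : List Sym × List Bool × List (List Bool) => y.2.1)
    (x := fun _ => false) (f := fun y sgn bits => !sgn && decide (twiceMin A (parse y.1).2 ≤
      cappedValue (twiceMin A (parse y.1).2) bits + cappedValue (twiceMin A (parse y.1).2) bits))
    (PT.fst.comp PT.snd) (PT.const false) ?_
  have hφ' : PT fun z : (List Sym × List Bool × List (List Bool)) × Bool × List Bool =>
      twiceMin A (parse z.1.1).2 := hφ.comp (PT.fst.comp PT.fst)
  have hv := pt_cappedValue hφ' (PT.snd.comp (PT.snd.comp PT.id))
  exact (PT.not (PT.fst.comp PT.snd)).and (hφ'.le (hv.add hv))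

end PT

end MinEquiv

namespace MinEquiv

/-! ### Irreducible bijunctive relations -/

/-- The relation of a kind, with its arguments exchanged if `sw` holds. -/
def Describes (R : BoolRel) (k : Kind) (sw : Bool) : Prop :=
  (∀ t : Fin R.arity → Bool, t ∈ R.tuples ↔ Sat (mkCon k sw (List.finRange R.arity)) t) ∧
    ∀ x y : ℕ, ∃ args : Fin R.arity → ℕ, ∀ α : ℕ → Bool,
      (fun i => α (args i)) ∈ R.tuples ↔ Holds (k, x, y) α

/-- The basic relations. -/
def basicRels : Set BoolRel :=
  {BoolRel.top1, BoolRel.posLit, BoolRel.negLit, BoolRel.or2, BoolRel.nand2, BoolRel.imp2,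
    BoolRel.eq2, BoolRel.xor2}

/-- A formula over binary relations that expresses `R` is a competitor in the definition of
irreducibility. The empty formula is not admitted there and is replaced by a trivial unary clause.
-/
theorem arity_le_two {R : BoolRel} (hirr : R.Irreducible) (hbij : R.Bijunctive) : R.arity ≤ 2 := by
  obtain ⟨φ, hφ⟩ := hbij
  rcases φ with _ | ⟨C, φ⟩
  · obtain ⟨D, hD, h⟩ := hirr [⟨⟨BoolRel.top1, trivial⟩, fun _ => 0⟩] (by simp) fun α => by
      rw [← hφ α]
      simp [CFormula.Sat, Clause.Sat, BoolRel.top1]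
    rw [List.mem_singleton] at hD
    subst hD
    exact h.trans (by decide)
  · let f : Clause {S : BoolRel | S.arity = 2} → Clause Set.univ := fun C =>
      ⟨⟨C.rel.1, trivial⟩, C.args⟩
    obtain ⟨D, hD, h⟩ := hirr ((C :: φ).map f) (by simp) fun α => by
        rw [← hφ α]
        simp only [CFormula.Sat, List.forall_mem_map]
        rfl
    obtain ⟨E, -, hE⟩ := List.mem_map.1 hD
    subst hE
    exact h.trans (le_of_eq E.rel.2)

theorem exists_kind_one (T : Set (Fin 1 → Bool)) (hT : T.Nonempty) :
    ∃ k ∈ [Kind.top, .unit true, .unit false], ∀ t, t ∈ T ↔ k.holds (t 0) (t 0) = true := by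
  have hc : ∀ t : Fin 1 → Bool, t = fun _ => t 0 := fun t => funext fun i => by
    rw [Subsingleton.elim i 0]
  by_cases h₁ : (fun _ => true) ∈ T <;> by_cases h₂ : (fun _ => false) ∈ T
  · refine ⟨.top, by simp, fun t => ?_⟩
    rw [hc t]
    cases t 0 <;> simp [h₁, h₂, Kind.holds]
  · refine ⟨.unit true, by simp, fun t => ?_⟩
    rw [hc t]
    cases t 0 <;> simp [h₁, h₂, Kind.holds]
  · refine ⟨.unit false, by simp, fun t => ?_⟩
    rw [hc t]
    cases t 0 <;> simp [h₁, h₂, Kind.holds]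
  · obtain ⟨t, ht⟩ := hT
    rw [hc t] at ht
    cases h : t 0 <;> rw [h] at ht <;> contradiction

/-- The entries belong to the argument pairs 00, 01, 10, 11. The first alternative is a product of
two unary relations; only implication is asymmetric and may need its arguments exchanged. -/
theorem exists_kind_table (a b c d : Bool) (h : a || b || c || d) :
    (∃ p q p' q' : Bool, a = (p && p') ∧ b = (p && q') ∧ c = (q && p') ∧ d = (q && q')) ∨
    ∃ k ∈ [Kind.or true, .or false, .imp, .par false, .par true], ∃ sw : Bool,
      (sw = true → k = .imp) ∧ a = k.holds false false ∧ d = k.holds true true ∧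
      b = k.holds sw (!sw) ∧ c = k.holds (!sw) sw := by
  revert a b c d
  decide

/-- A product of unary relations is expressed by two unary clauses, which contradicts
irreducibility. -/
theorem exists_kind_two (T : Set (Fin 2 → Bool)) (hT : T.Nonempty)
    (hirr : BoolRel.Irreducible ⟨2, by decide, T⟩) :
    ∃ k ∈ [Kind.or true, .or false, .imp, .par false, .par true], ∃ sw : Bool,
      (sw = true → k = .imp) ∧
      ∀ t, t ∈ T ↔ k.holds (t (if sw then 1 else 0)) (t (if sw then 0 else 1)) = true := by
  classical
  have hc : ∀ t : Fin 2 → Bool, t = ![t 0, t 1] := fun t => by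
    ext i
    fin_cases i <;> rfl
  let g : Bool → Bool → Bool := fun a b => decide (![a, b] ∈ T)
  have hg : ∀ t, t ∈ T ↔ g (t 0) (t 1) = true := fun t => by
    simp only [g, decide_eq_true_eq]
    rw [← hc t]
  have hne : g false false || g false true || g true false || g true true := by
    obtain ⟨t, ht⟩ := hT
    rw [hg] at ht
    cases h₀ : t 0 <;> cases h₁ : t 1 <;> rw [h₀, h₁] at ht <;> simp [ht]
  rcases exists_kind_table _ _ _ _ hne with ⟨p, q, p', q', h₁, h₂, h₃, h₄⟩ | ⟨k, hk, sw, hsw, h₁, h₂, h₃, h₄⟩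
  · let P : BoolRel := ⟨1, by decide, {t | (if t 0 then q else p) = true}⟩
    let Q : BoolRel := ⟨1, by decide, {t | (if t 0 then q' else p') = true}⟩
    obtain ⟨C, hC, h⟩ := hirr [⟨⟨P, trivial⟩, fun _ => 0⟩, ⟨⟨Q, trivial⟩, fun _ => 1⟩] (by simp)
      fun α => by
        change _ ↔ _ ∈ T
        rw [hg]
        have : CFormula.Sat (Γ := Set.univ) [⟨⟨P, trivial⟩, fun _ => 0⟩, ⟨⟨Q, trivial⟩, fun _ => 1⟩] α ↔
            (if α 0 then q else p) = true ∧ (if α 1 then q' else p') = true := by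
          simp [CFormula.Sat, Clause.Sat, P, Q]
        rw [this]
        change _ ↔ g (α 0) (α 1) = true
        cases α 0 <;> cases α 1 <;> simp [h₁, h₂, h₃, h₄]
    simp only [List.mem_cons, List.not_mem_nil, or_false] at hC
    rcases hC with rfl | rfl
    · exact absurd h (by decide : ¬ 2 ≤ 1)
    · exact absurd h (by decide : ¬ 2 ≤ 1)
  · refine ⟨k, hk, sw, hsw, fun t => ?_⟩
    rw [hg]
    cases sw <;> simp only [Bool.not_true, Bool.not_false, if_true, if_false,
      Bool.false_eq_true] at h₃ h₄ ⊢ <;> cases t 0 <;> cases t 1 <;> simp only [h₁, h₂, h₃, h₄]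

/-- An irreducible bijunctive relation is one of the basic relations. -/
theorem exists_describes {R : BoolRel} (hne : R.tuples.Nonempty) (hirr : R.Irreducible)
    (hbij : R.Bijunctive) :
    (∃ S ∈ basicRels, R.IsPermutationOf S) ∧ ∃ k sw, Describes R k sw := by
  have hle := arity_le_two hirr hbij
  obtain ⟨n, hn, T⟩ := R
  obtain rfl | rfl : n = 1 ∨ n = 2 := by
    change n ≤ 2 at hle
    omega
  · obtain ⟨k, hk, hkT⟩ := exists_kind_one T hne
    -- Unary kinds ignore the second variable, so any `y` may be put there.
    have hk' : ∀ a b c, k.holds a b = k.holds a c := by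
      clear hkT
      revert k
      decide
    refine ⟨?_, k, false, fun t => ?_, fun x y => ⟨fun _ => x, fun α => ?_⟩⟩
    · simp only [List.mem_cons, List.not_mem_nil, or_false] at hk
      rcases hk with rfl | rfl | rfl
      · exact ⟨BoolRel.top1, by simp [basicRels], Equiv.refl _, fun (t : Fin 1 → Bool) =>
          (hkT t).trans ⟨fun _ => trivial, fun _ => rfl⟩⟩
      · exact ⟨BoolRel.posLit, by simp [basicRels], Equiv.refl _, fun (t : Fin 1 → Bool) =>
          (hkT t).trans beq_iff_eq⟩
      · exact ⟨BoolRel.negLit, by simp [basicRels], Equiv.refl _, fun (t : Fin 1 → Bool) =>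
          (hkT t).trans beq_iff_eq⟩
    · change t ∈ T ↔ Sat [(k, 0, 0)] t
      rw [hkT]
      simp [Sat, Holds]
    · change (fun _ => α x) ∈ T ↔ _
      rw [hkT, Holds, hk' _ _ (α y)]
  · obtain ⟨k, hk, sw, hsw, hkT⟩ := exists_kind_two T hne hirr
    refine ⟨?_, k, sw, fun t => ?_, fun x y => ⟨if sw then ![y, x] else ![x, y], fun α => ?_⟩⟩
    · simp only [List.mem_cons, List.not_mem_nil, or_false] at hk
      have hsw' : k ≠ .imp → sw = false := by
        intro h
        cases sw
        · rfl
        · exact absurd (hsw rfl) h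
      rcases hk with rfl | rfl | rfl | rfl | rfl
      · obtain rfl := hsw' (by simp)
        refine ⟨BoolRel.or2, by simp [basicRels], Equiv.refl _, fun (t : Fin 2 → Bool) =>
          (hkT t).trans ?_⟩
        change (t 0 == true || t 1 == true) = true ↔ (t 0 = true ∨ t 1 = true)
        simp
      · obtain rfl := hsw' (by simp)
        refine ⟨BoolRel.nand2, by simp [basicRels], Equiv.refl _, fun (t : Fin 2 → Bool) =>
          (hkT t).trans ?_⟩
        change (t 0 == false || t 1 == false) = true ↔ ¬ (t 0 = true ∧ t 1 = true)
        cases t 0 <;> simp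
      · cases sw
        · refine ⟨BoolRel.imp2, by simp [basicRels], Equiv.refl _, fun (t : Fin 2 → Bool) =>
            (hkT t).trans ?_⟩
          change (!t 0 || t 1) = true ↔ (t 0 = true → t 1 = true)
          cases t 0 <;> simp
        · refine ⟨BoolRel.imp2, by simp [basicRels], (Equiv.swap (0 : Fin 2) (1 : Fin 2) :),
            fun (t : Fin 2 → Bool) => (hkT t).trans ?_⟩
          change (!t 1 || t 0) = true ↔
            (t (Equiv.swap (0 : Fin 2) 1 0) = true → t (Equiv.swap (0 : Fin 2) 1 1) = true)
          rw [Equiv.swap_apply_left, Equiv.swap_apply_right]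
          cases t 1 <;> simp
      · obtain rfl := hsw' (by simp)
        refine ⟨BoolRel.eq2, by simp [basicRels], Equiv.refl _, fun (t : Fin 2 → Bool) =>
          (hkT t).trans ?_⟩
        change (xor (t 0) (t 1) == false) = true ↔ t 0 = t 1
        cases t 0 <;> simp
      · obtain rfl := hsw' (by simp)
        refine ⟨BoolRel.xor2, by simp [basicRels], Equiv.refl _, fun (t : Fin 2 → Bool) =>
          (hkT t).trans ?_⟩
        change (xor (t 0) (t 1) == true) = true ↔ t 0 ≠ t 1
        cases t 0 <;> simp
    · change t ∈ T ↔ Sat [(k, if sw then (1, 0) else (0, 1))] t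
      rw [hkT]
      cases sw <;> simp [Sat, Holds]
    · rw [hkT]
      cases sw <;> rfl

end MinEquiv

namespace MinEquiv

open StackProg

/-! ### Translating clauses -/

theorem mkCon_map {V W : Type} (f : V → W) (k : Kind) (sw : Bool) (l : List V) :
    mkCon k sw (l.map f) = (mkCon k sw l).map (rename f) := by
  rcases l with _ | ⟨x, _ | ⟨y, l⟩⟩ <;> cases sw <;> rfl

theorem length_mkCon_le {V : Type} (k : Kind) (sw : Bool) (l : List V) :
    (mkCon k sw l).length ≤ 1 := by
  rcases l with _ | ⟨x, l⟩ <;> simp [mkCon, listCases]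

theorem kind_of_mem_mkCon {V : Type} {k : Kind} {sw : Bool} {l : List V} {c : Con V}
    (h : c ∈ mkCon k sw l) : c.1 = k := by
  rcases l with _ | ⟨x, l⟩
  · simp [mkCon, listCases] at h
  · simp only [mkCon, listCases, List.mem_singleton] at h
    rw [h]

instance (Γ : ConstraintLanguage) : Finite Γ.toSet := Γ.rels.finite_toSet

instance (Γ : ConstraintLanguage) : Finite (MEESymbol Γ) :=
  Finite.of_injective (β := Γ.toSet ⊕ Option Bool)
    (fun s => match s with
      | .rel R => .inl R
      | .bit b => .inr (some b)
      | .sep => .inr none)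
    (by rintro (_ | _ | _) (_ | _ | _) h <;> simp_all)

section

variable {Γ : ConstraintLanguage} (K : Γ.toSet → Kind) (sw : Γ.toSet → Bool)

/-- The constraint of a clause. -/
def clauseCon {V : Type} (f : ℕ → V) (C : Clause Γ.toSet) : List (Con V) :=
  mkCon (K C.rel) (sw C.rel) ((List.ofFn C.args).map f)

/-- The constraints of a formula. -/
def translate (φ : CFormula Γ.toSet) : List (Con ℕ) := φ.flatMap (clauseCon K sw id)

/-- The kinds which are available. -/
noncomputable def available (k : Kind) : Bool :=
  open Classical in decide (∃ R, K R = k)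

/-- The input symbol for the parser. -/
def toSym : MEESymbol Γ → Sym
  | .rel R => relSym (K R) (sw R)
  | .bit b => bitSym b
  | .sep => sepSym

theorem flatMap_clauseCon {V : Type} (f : ℕ → V) (φ : CFormula Γ.toSet) :
    φ.flatMap (clauseCon K sw f) = (translate K sw φ).map (rename f) := by
  rw [translate, List.map_flatMap]
  congr 1
  funext C
  rw [clauseCon, clauseCon, List.map_id, mkCon_map]

theorem available_of_mem_translate {φ : CFormula Γ.toSet} {c : Con ℕ} (h : c ∈ translate K sw φ) :
    available K c.1 = true := by
  obtain ⟨C, -, hc⟩ := List.mem_flatMap.1 h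
  rw [kind_of_mem_mkCon hc]
  exact decide_eq_true ⟨_, rfl⟩

theorem length_translate_le (φ : CFormula Γ.toSet) : (translate K sw φ).length ≤ φ.length := by
  induction φ with
  | nil => exact le_rfl
  | cons C φ ih =>
    have := length_mkCon_le (K C.rel) (sw C.rel) ((List.ofFn C.args).map id)
    simp only [translate, clauseCon, List.flatMap_cons, List.length_append, List.length_cons] at *
    omega

theorem parse_encodeNat (n : ℕ) (m : List Sym) :
    parse ((MEESymbol.encodeNat (Γ := Γ) n).map (toSym K sw) ++ m) =
      (Computability.encodeNat n :: (parse m).1, (parse m).2) := by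
  have key : ∀ l : List Bool, parse (l.map bitSym ++ sepSym :: m) =
      (l :: (parse m).1, (parse m).2) := by
    intro l
    induction l with
    | nil => rfl
    | cons b l ih =>
      have : parse ((b :: l).map bitSym ++ sepSym :: m) =
        parseStep (bitSym b) (parse (l.map bitSym ++ sepSym :: m)) := rfl
      rw [this, ih]
      rfl
  rw [← key]
  simp only [MEESymbol.encodeNat, List.map_append, List.map_map, List.map_cons, List.map_nil,
    List.append_assoc, List.cons_append, List.nil_append]
  rfl

theorem parse_encodeNats (l : List ℕ) (m : List Sym) :
    parse ((l.flatMap (MEESymbol.encodeNat (Γ := Γ))).map (toSym K sw) ++ m) =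
      (l.map Computability.encodeNat ++ (parse m).1, (parse m).2) := by
  induction l with
  | nil => rfl
  | cons n l ih =>
    rw [List.flatMap_cons, List.map_append, List.append_assoc, parse_encodeNat, ih]
    rfl

theorem parse_encodeClauses (φ : CFormula Γ.toSet) :
    parse ((φ.flatMap MEESymbol.encodeClause).map (toSym K sw)) =
      ([], φ.flatMap (clauseCon K sw Computability.encodeNat)) := by
  induction φ with
  | nil => rfl
  | cons C φ ih =>
    have : parse (((C :: φ).flatMap MEESymbol.encodeClause).map (toSym K sw)) =
        parseStep (relSym (K C.rel) (sw C.rel)) (parse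
          (((List.ofFn C.args).flatMap (MEESymbol.encodeNat (Γ := Γ))).map (toSym K sw) ++
            (φ.flatMap MEESymbol.encodeClause).map (toSym K sw))) := by
      rw [List.flatMap_cons, MEESymbol.encodeClause, List.cons_append, List.map_cons,
        List.map_append]
      rfl
    rw [this, parse_encodeNats, ih, List.append_nil]
    rfl

theorem parse_encode (I : MEEInstance Γ) :
    parse (I.encode.map (toSym K sw)) =
      ([decide (I.bound < 0) :: Computability.encodeNat I.bound.natAbs],
        (translate K sw I.formula).map (rename Computability.encodeNat)) := by
  have : parse (I.encode.map (toSym K sw)) = parseStep (bitSym (decide (I.bound < 0)))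
      (parse ((MEESymbol.encodeNat (Γ := Γ) I.bound.natAbs).map (toSym K sw) ++
        (I.formula.flatMap MEESymbol.encodeClause).map (toSym K sw))) := by
    rw [MEEInstance.encode, MEESymbol.encodeInt, List.cons_append, List.map_cons, List.map_append]
    rfl
  rw [this, parse_encodeNat, parse_encodeClauses, flatMap_clauseCon]
  rfl

variable {K sw}

theorem sat_translate (hK : ∀ R : Γ.toSet, Describes R.1 (K R) (sw R)) (φ : CFormula Γ.toSet)
    (α : ℕ → Bool) : Sat (translate K sw φ) α ↔ CFormula.Sat φ α := by
  have : ∀ C : Clause Γ.toSet, Sat (clauseCon K sw id C) α ↔ C.Sat α := by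
    intro C
    rw [clauseCon, List.map_id, List.ofFn_eq_map, mkCon_map, sat_rename]
    exact ((hK C.rel).1 _).symm
  simp only [translate, Sat, CFormula.Sat, List.mem_flatMap, ← this]
  exact ⟨fun h C hC c hc => h c ⟨C, hC, hc⟩, fun h c ⟨C, hC, hc⟩ => h C hC c hc⟩

theorem exists_formula (hK : ∀ R : Γ.toSet, Describes R.1 (K R) (sw R)) {ψ : List (Con ℕ)}
    (hψ : ∀ c ∈ ψ, available K c.1 = true) :
    ∃ χ : CFormula Γ.toSet, χ.length = ψ.length ∧ ∀ α, CFormula.Sat χ α ↔ Sat ψ α := by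
  induction ψ with
  | nil => exact ⟨[], rfl, by simp [CFormula.Sat, Sat]⟩
  | cons c ψ ih =>
    obtain ⟨χ, h₁, h₂⟩ := ih fun c hc => hψ c (by simp [hc])
    obtain ⟨R, hR⟩ := of_decide_eq_true (hψ c (by simp))
    obtain ⟨args, hargs⟩ := (hK R).2 c.2.1 c.2.2
    refine ⟨⟨R, args⟩ :: χ, by simp [h₁], fun α => ?_⟩
    rw [sat_cons, ← h₂ α]
    have := hargs α
    rw [hR] at this
    rw [← this]
    simp [CFormula.Sat, Clause.Sat]

/-- Clauses and constraints translate into each other without increasing their number. A constraint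
formula may use bit strings that name no number; decoding all variables keeps it equivalent because
decoding inverts encoding. The sign test is needed since the absolute value loses a negative bound.
-/
theorem mee_iff (hK : ∀ R : Γ.toSet, Describes R.1 (K R) (sw R)) (I : MEEInstance Γ) :
    MEE Γ I ↔ decide (I.bound < 0) = false ∧
      twiceMin (available K) ((translate K sw I.formula).map (rename Computability.encodeNat)) ≤
        2 * I.bound.natAbs := by
  have hA : ∀ c ∈ (translate K sw I.formula).map (rename Computability.encodeNat),
      available K c.1 = true := by
    intro c hc
    obtain ⟨d, hd, rfl⟩ := List.mem_map.1 hc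
    exact available_of_mem_translate K sw hd
  rw [← exists_equivalent_iff hA, MEE]
  simp only [decide_eq_false_iff_not, not_lt]
  constructor
  · rintro ⟨ψ, h₁, h₂⟩
    have hlen := length_translate_le K sw ψ
    refine ⟨by omega, (translate K sw ψ).map (rename Computability.encodeNat), ?_, fun β => ?_, ?_⟩
    · intro c hc
      obtain ⟨d, hd, rfl⟩ := List.mem_map.1 hc
      exact available_of_mem_translate K sw hd
    · rw [sat_rename, sat_rename, sat_translate hK, sat_translate hK]
      exact h₂ _
    · rw [List.length_map]
      omega
  · rintro ⟨h₀, ψ, h₁, h₂, h₃⟩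
    obtain ⟨χ, h₄, h₅⟩ := exists_formula (K := K) hK (ψ := ψ.map (rename Computability.decodeNat)) <| by
      intro c hc
      obtain ⟨d, hd, rfl⟩ := List.mem_map.1 hc
      exact h₁ d hd
    refine ⟨χ, by rw [h₄, List.length_map]; omega, fun α => ?_⟩
    rw [h₅, sat_rename, h₂, sat_rename, ← sat_translate hK]
    have : (α ∘ Computability.decodeNat) ∘ Computability.encodeNat = α :=
      funext fun n => congrArg α (Computability.decode_encodeNat n)
    rw [this]

theorem mee_inP (hK : ∀ R : Γ.toSet, Describes R.1 (K R) (sw R)) :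
    InP (MEEInstance.encode (Γ := Γ)) (MEE Γ) := by
  let _ := finEnc (MEESymbol Γ)
  have h : PT fun l : List (MEESymbol Γ) => solve (available K) (l.map (toSym K sw)) :=
    (pt_solve _).comp (PT.map (f := fun _ s => toSym K sw s)
      ((PT.of_finite (finEnc_injective (MEESymbol Γ)) (toSym K sw)).comp PT.snd) PT.id)
  exact PT.inP h _ _ fun I => by
    rw [solve_eq_true (parse_encode K sw I), mee_iff hK]

end

end MinEquiv

theorem mainTheorem6 (Γ : ConstraintLanguage) (hirr : Γ.Irreducible) (hbij : Γ.Bijunctive) :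
    (∀ R ∈ Γ.rels, ∃ S ∈ ({BoolRel.top1, BoolRel.posLit, BoolRel.negLit, BoolRel.or2,
        BoolRel.nand2, BoolRel.imp2, BoolRel.eq2, BoolRel.xor2} : Set BoolRel),
      R.IsPermutationOf S) ∧
    InP (MEEInstance.encode (Γ := Γ)) (MEE Γ) := by
  have h : ∀ R ∈ Γ.rels, (∃ S ∈ MinEquiv.basicRels, R.IsPermutationOf S) ∧
      ∃ k sw, MinEquiv.Describes R k sw := fun R hR =>
    MinEquiv.exists_describes (Γ.nonempty R hR) (hirr R hR) (hbij R hR)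
  choose K sw hK using fun R : Γ.toSet => (h R.1 R.2).2
  exact ⟨fun R hR => (h R hR).1, MinEquiv.mee_inP hK⟩
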